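/- Let $s\ge 1$ and $n\ge 2$. Consider a chain of $2n$ spins, each with the $2s$ orthonormal basis states $u^1,\dots,u^s,d^1,\dots,d^s$ (steps up and down of $s$ colors). The Fredkin Hamiltonian on $(\mathbb C^{2s})^{\otimes 2n}$ is $$H=\sum_{j=1}^{2n-2}\Pi_{j,j+1,j+2}+\sum_{j=1}^{2n-1}\Pi^{cross}_{j,j+1}+\Pi_{boundary},$$ $$\Pi_{j,j+1,j+2}=\sum_{k_1,k_2=1}^{s}\Big(|U^{k_1,k_2}\rangle\langle U^{k_1,k_2}|_{j,j+1,j+2}+|D^{k_1,k_2}\rangle\langle D^{k_1,k_2}|_{j,j+1,j+2}+|\varphi^{k_1,k_2}\rangle\langle\varphi^{k_1,k_2}|_{j,j+1}\Big),$$ $$\Pi^{cross}_{j,j+1}=\sum_{k_1\neq k_2}|u^{k_1}d^{k_2}\rangle\langle u^{k_1}d^{k_2}|_{j,j+1},\qquad \Pi_{boundary}=\sum_{k=1}^{s}\big(|d^{k}\rangle\langle d^{k}|_{1}+|u^{k}\rangle\langle u^{k}|_{2n}\big),$$ where $|U^{k_1,k_2}\rangle=\frac1{\sqrt2}(|u^{k_1}u^{k_2}d^{k_2}\rangle-|u^{k_2}d^{k_2}u^{k_1}\rangle)$,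 $|D^{k_1,k_2}\rangle=\frac1{\sqrt2}(|d^{k_1}u^{k_2}d^{k_2}\rangle-|u^{k_2}d^{k_2}d^{k_1}\rangle)$, $|\varphi^{k_1,k_2}\rangle=\frac1{\sqrt2}(|u^{k_1}d^{k_1}\rangle-|u^{k_2}d^{k_2}\rangle)$, and every operator acts as the identity on the sites that are not indicated. Let $\Delta(\cdot)$ denote the difference of the two smallest eigenvalues of a Hermitian operator, counted with multiplicity. The balanced subspace is spanned by the basis words that are $s$-colored Dyck words (Dyck paths in which matched up and down steps have the same color), the unbalanced subspace by all other basis words. The Hamiltonian $H$ leaves the balanced and the unbalanced subspace invariant, and the following bounds hold; all constants $c,c',c'',C>0$ and exponents $a,a'$ are independent of $n$ and $s$. 1. The gap is polynomially small: there are $c,C>0$ and $a\ge 2$ such that for all $s\ge1$, $n\ge 2$ $$c\,n^{-a}\le\Delta(H)\le C\,n^{-2}.$$ 2. There is $c'>0$ such that for every $s\ge 1$ the gap of $H$ restricted to the balanced subspace satisfies $\Delta(H|_{bal})\ge c'\,n^{-15/2}$ for all $n\ge2$, and $\Delta(H|_{bal})\ge c'\,s\,n^{-15/2}$ for all $n\ge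 n_0(s)$. 3. There are $c''>0$ and $a'>0$ such that for all $s\ge 1$, $n\ge2$ the smallest eigenvalue of $H$ restricted to the unbalanced subspace is at least $c''\,n^{-a'}$. -/

import Mathlib

open Filter

noncomputable section

namespace Fredkin

/-- The `2s` states of one spin: a step up or down carrying one of `s` colors. -/
abbrev Spin (s : ℕ) : Type := Bool × Fin s

/-- A step up of color `k`. -/
def up {s : ℕ} (k : Fin s) : Spin s := (true, k)

/-- A step down of color `k`. -/
def dn {s : ℕ} (k : Fin s) : Spin s := (false, k)

/-- The words of length `L`; they label the standard orthonormal basis of `(ℂ^{2s})^{⊗ L}`. -/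
abbrev Config (s L : ℕ) : Type := Fin L → Spin s

/-- The standard basis vector `|w⟩` of `(ℂ^{2s})^{⊗ m}`. -/
def ket {s m : ℕ} (w : Config s m) : Config s m → ℂ := Pi.single w 1

/-- The operator `|v⟩⟨v|`. -/
def ketbra {s m : ℕ} (v : Config s m → ℂ) : Matrix (Config s m) (Config s m) ℂ :=
  Matrix.vecMulVec v (star v)

/-- The operator on a chain of length `L` that acts as `A` on the sites `e 0, …, e (m-1)`
and as the identity on all other sites. -/
def onSites {s L m : ℕ} (e : Fin m → Fin L) (A : Matrix (Config s m) (Config s m) ℂ) :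
    Matrix (Config s L) (Config s L) ℂ :=
  Matrix.of fun x y => if ∀ i, (∀ a, e a ≠ i) → x i = y i then A (x ∘ e) (y ∘ e) else 0

/-- `|U^{k₁,k₂}⟩ = (|u^{k₁} u^{k₂} d^{k₂}⟩ - |u^{k₂} d^{k₂} u^{k₁}⟩) / √2`. -/
def vecU {s : ℕ} (k₁ k₂ : Fin s) : Config s 3 → ℂ :=
  ((1 / Real.sqrt 2 : ℝ) : ℂ) • (ket ![up k₁, up k₂, dn k₂] - ket ![up k₂, dn k₂, up k₁])

/-- `|D^{k₁,k₂}⟩ = (|d^{k₁} u^{k₂} d^{k₂}⟩ - |u^{k₂} d^{k₂} d^{k₁}⟩) / √2`. -/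
def vecD {s : ℕ} (k₁ k₂ : Fin s) : Config s 3 → ℂ :=
  ((1 / Real.sqrt 2 : ℝ) : ℂ) • (ket ![dn k₁, up k₂, dn k₂] - ket ![up k₂, dn k₂, dn k₁])

/-- `|φ^{k₁,k₂}⟩ = (|u^{k₁} d^{k₁}⟩ - |u^{k₂} d^{k₂}⟩) / √2`. -/
def vecPhi {s : ℕ} (k₁ k₂ : Fin s) : Config s 2 → ℂ :=
  ((1 / Real.sqrt 2 : ℝ) : ℂ) • (ket ![up k₁, dn k₁] - ket ![up k₂, dn k₂])

/-- The interaction `Π_{j,j+1,j+2}`; the sites are numbered from `0`. The two-site vectors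
`|φ⟩` act on the first two sites of the window. -/
def bulkTerm (s L : ℕ) (j : Fin (L - 2)) : Matrix (Config s L) (Config s L) ℂ :=
  ∑ k₁ : Fin s, ∑ k₂ : Fin s,
    (onSites ![⟨j, by omega⟩, ⟨j + 1, by omega⟩, ⟨j + 2, by omega⟩] (ketbra (vecU k₁ k₂))
      + onSites ![⟨j, by omega⟩, ⟨j + 1, by omega⟩, ⟨j + 2, by omega⟩] (ketbra (vecD k₁ k₂))
      + onSites ![⟨j, by omega⟩, ⟨j + 1, by omega⟩] (ketbra (vecPhi k₁ k₂)))

/-- The penalty `Π^{cross}_{j,j+1}` for neighbors `u^{k₁} d^{k₂}` of different colors. -/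
def crossTerm (s L : ℕ) (j : Fin (L - 1)) : Matrix (Config s L) (Config s L) ℂ :=
  ∑ k₁ : Fin s, ∑ k₂ : Fin s,
    if k₁ ≠ k₂ then
      onSites ![⟨j, by omega⟩, ⟨j + 1, by omega⟩] (ketbra (ket ![up k₁, dn k₂]))
    else 0

/-- The penalty `Π_{boundary}` for a first step down and for a last step up. -/
def boundaryTerm (s L : ℕ) : Matrix (Config s L) (Config s L) ℂ :=
  if h : 0 < L then
    ∑ k : Fin s,
      (onSites ![⟨0, h⟩] (ketbra (ket ![dn k]))
        + onSites ![⟨L - 1, by omega⟩] (ketbra (ket ![up k])))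
  else 0

/-- The Hamiltonian of the Fredkin spin chain with `s` colors on `2n` spins. -/
def hamiltonian (s n : ℕ) : Matrix (Config s (2 * n)) (Config s (2 * n)) ℂ :=
  ∑ j : Fin (2 * n - 2), bulkTerm s (2 * n) j
    + ∑ j : Fin (2 * n - 1), crossTerm s (2 * n) j
    + boundaryTerm s (2 * n)

theorem ketbra_isHermitian {s m : ℕ} (v : Config s m → ℂ) : (ketbra v).IsHermitian := by
  ext x y
  simp [ketbra, Matrix.vecMulVec_apply, mul_comm]

theorem onSites_isHermitian {s L m : ℕ} (e : Fin m → Fin L)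
    {A : Matrix (Config s m) (Config s m) ℂ} (hA : A.IsHermitian) :
    (onSites e A).IsHermitian := by
  ext x y
  by_cases h : ∀ i, (∀ a, e a ≠ i) → x i = y i
  · have h' : ∀ i, (∀ a, e a ≠ i) → y i = x i := fun i hi => (h i hi).symm
    simp only [Matrix.conjTranspose_apply, onSites, Matrix.of_apply, if_pos h, if_pos h']
    exact hA.apply _ _
  · have h' : ¬ ∀ i, (∀ a, e a ≠ i) → y i = x i := fun g => h fun i hi => (g i hi).symm
    simp only [Matrix.conjTranspose_apply, onSites, Matrix.of_apply, if_neg h, if_neg h', star_zero]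

theorem sum_isHermitian {ι κ : Type*} [Fintype κ] (f : κ → Matrix ι ι ℂ)
    (h : ∀ k, (f k).IsHermitian) : (∑ k, f k).IsHermitian := by
  unfold Matrix.IsHermitian
  rw [Matrix.conjTranspose_sum]
  exact Finset.sum_congr rfl fun k _ => h k

theorem hamiltonian_isHermitian (s n : ℕ) : (hamiltonian s n).IsHermitian := by
  refine Matrix.IsHermitian.add (Matrix.IsHermitian.add ?_ ?_) ?_
  · refine sum_isHermitian _ fun j => sum_isHermitian _ fun k₁ => sum_isHermitian _ fun k₂ => ?_
    exact ((onSites_isHermitian _ (ketbra_isHermitian _)).add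
      (onSites_isHermitian _ (ketbra_isHermitian _))).add
      (onSites_isHermitian _ (ketbra_isHermitian _))
  · refine sum_isHermitian _ fun j => sum_isHermitian _ fun k₁ => sum_isHermitian _ fun k₂ => ?_
    split_ifs
    · exact onSites_isHermitian _ (ketbra_isHermitian _)
    · exact Matrix.isHermitian_zero
  · unfold boundaryTerm
    split_ifs
    · exact sum_isHermitian _ fun k => (onSites_isHermitian _ (ketbra_isHermitian _)).add
        (onSites_isHermitian _ (ketbra_isHermitian _))
    · exact Matrix.isHermitian_zero

/-- The eigenvalues of a Hermitian matrix, repeated according to multiplicity, in increasing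
order. -/
def energies {ι : Type*} [Fintype ι] [DecidableEq ι] {A : Matrix ι ι ℂ} (hA : A.IsHermitian) :
    List ℝ :=
  (Finset.univ.val.map hA.eigenvalues).sort (· ≤ ·)

/-- The smallest eigenvalue of a Hermitian matrix (of size at least one). -/
def groundEnergy {ι : Type*} [Fintype ι] [DecidableEq ι] {A : Matrix ι ι ℂ}
    (hA : A.IsHermitian) : ℝ :=
  (energies hA).getD 0 0

/-- The difference of the two smallest eigenvalues, counted with multiplicity, of a Hermitian
matrix (of size at least two). -/
def gap {ι : Type*} [Fintype ι] [DecidableEq ι] {A : Matrix ι ι ℂ} (hA : A.IsHermitian) : ℝ :=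
  (energies hA).getD 1 0 - (energies hA).getD 0 0

/-- The `s`-colored Dyck words: either empty, or of the form `u^k w d^k v` with `s`-colored Dyck
words `w` and `v`. In a Dyck path that starts with an up step, `d^k` is the first return to
height zero, i.e. the down step matched with that up step. -/
inductive IsColoredDyck {s : ℕ} : List (Spin s) → Prop
  | nil : IsColoredDyck []
  | cons (k : Fin s) (w v : List (Spin s)) (hw : IsColoredDyck w) (hv : IsColoredDyck v) :
      IsColoredDyck (up k :: (w ++ dn k :: v))

/-- The basis words that are `s`-colored Dyck paths; they span the balanced subspace, and the
remaining basis words span the unbalanced subspace. -/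
def IsBalanced {s L : ℕ} (x : Config s L) : Prop := IsColoredDyck (List.ofFn x)

/-- The gap of the Hamiltonian on the whole Hilbert space. -/
def chainGap (s n : ℕ) : ℝ := gap (hamiltonian_isHermitian s n)

open Classical in
/-- The gap of the Hamiltonian restricted to the balanced subspace. -/
def balancedGap (s n : ℕ) : ℝ :=
  gap ((hamiltonian_isHermitian s n).submatrix
    (Subtype.val : {x : Config s (2 * n) // IsBalanced x} → Config s (2 * n)))

open Classical in
/-- The smallest eigenvalue of the Hamiltonian restricted to the unbalanced subspace. -/
def unbalancedGroundEnergy (s n : ℕ) : ℝ :=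
  groundEnergy ((hamiltonian_isHermitian s n).submatrix
    (Subtype.val : {x : Config s (2 * n) // ¬ IsBalanced x} → Config s (2 * n)))

end Fredkin

end

namespace Fredkin

/-! ### Sums over finite sets and injections -/

/-! Describe a state by the amplitudes `F` of its words. By `qform_hamiltonian` the quadratic form
of the Hamiltonian is `energy`: squared differences of amplitudes when a peak u^k d^k moves past a
neighboring letter or changes its color, plus squared amplitudes of penalized words. A peak leaves
no trace in the reduced word computed by `reduce`, so every matrix element between words of
different reduction vanishes. Dyck words are the words with empty reduction; hence the two subspaces
are invariant, and the uniform superposition of Dyck words has energy zero.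

Lower bounds. Dyck words are colored binary trees. `peel` removes a random peak with weights for
which a uniform tree stays uniform (`sum_peel_right`, `sum_peel_left`). Starting from a pair (w,
nil), peaks are taken from the first tree one at a time while the second grows by the reversed
chain, until (nil, w') is reached with w' uniform and independent of w. `transport` bounds the mean
square of the total change by the contributions of single steps. A step removes a peak from a word
and reinserts one elsewhere, so it is paid for by local energy (`spread_le`, `sum_localEnergy_le`).
Comparing the distributions of the intermediate pairs with counting measure costs a polynomial
factor only, because C_{i+j+1} is at most (i+j+2)^3 C_i C_j.

With nothing between the two trees this is a Poincaré inequality with constant of order n^7,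
uniformly in the number of colors (`balanced_poincare`). With a letter c between them, a Dyck word
is carried across c. By `exists_defect` every unbalanced word contains an unmatched or mismatched
letter next to a Dyck word; removing that Dyck word from the way exposes the letter to a boundary or
crossing penalty. Summation over the at most quadratically many positions gives a constant of order
n^9 (`unbalanced_energy_bound`).

Upper bound. On the words with reduction d^k d^k, let the amplitude be the position of the first
unmatched down step (`dropState`). A local move changes it by at most 2, while its mean square is of
order n^2, so the energy per norm is O(n^{-2}). This state lies in another invariant subspace than
the ground state, and `gap_le` applies. The variational principles `le_groundEnergy`, `le_gap` and
`gap_le` turn the estimates for forms into statements about eigenvalues. -/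

theorem sum_comp_le_sum {ι κ : Type*} {S : Finset ι} {T : Finset κ} (φ : ι → κ) (g : κ → ℝ)
    (hg : ∀ x, 0 ≤ g x) (hmem : ∀ i ∈ S, φ i ∈ T) (hinj : Set.InjOn φ S) :
    ∑ i ∈ S, g (φ i) ≤ ∑ x ∈ T, g x := by
  classical
  rw [← Finset.sum_image (f := g) hinj]
  refine Finset.sum_le_sum_of_subset_of_nonneg ?_ fun x _ _ => hg x
  intro x hx
  obtain ⟨i, hi, rfl⟩ := Finset.mem_image.1 hx
  exact hmem i hi

theorem sum_le_sum_comp {ι κ : Type*} {S : Finset ι} {T : Finset κ} (φ : ι → κ) (g : κ → ℝ)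
    (hg : ∀ x, 0 ≤ g x) (hsurj : ∀ x ∈ T, ∃ i ∈ S, φ i = x) :
    ∑ x ∈ T, g x ≤ ∑ i ∈ S, g (φ i) := by
  classical
  refine le_trans ?_ (Finset.sum_image_le_of_nonneg (s := S) (g := φ) (f := g) fun u _ => hg u)
  refine Finset.sum_le_sum_of_subset_of_nonneg ?_ fun x _ _ => hg x
  intro x hx
  obtain ⟨i, hi, h⟩ := hsurj x hx
  exact Finset.mem_image.2 ⟨i, hi, h⟩

/-! ### Words as lists -/

/-- The words of length `L`, as lists. -/
def words (s L : ℕ) : Finset (List (Spin s)) :=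
  (Finset.univ : Finset (Config s L)).image List.ofFn

theorem mem_words {s L : ℕ} {l : List (Spin s)} : l ∈ words s L ↔ l.length = L := by
  constructor
  · intro h
    obtain ⟨z, -, rfl⟩ := Finset.mem_image.1 h
    simp
  · rintro rfl
    exact Finset.mem_image.2 ⟨l.get, Finset.mem_univ _, List.ofFn_get l⟩

theorem sum_ofFn {s L : ℕ} {M : Type*} [AddCommMonoid M] (h : List (Spin s) → M) :
    ∑ z : Config s L, h (List.ofFn z) = ∑ l ∈ words s L, h l := by
  rw [words, Finset.sum_image (fun a _ b _ hab => List.ofFn_injective hab)]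

/-- Splitting a word of length `i + m + r` into three parts. -/
theorem sum_words_split {s i m r L : ℕ} {M : Type*} [AddCommMonoid M] (h : List (Spin s) → M)
    (hL : L = i + m + r) :
    ∑ l ∈ words s L, h l =
      ∑ x ∈ words s i, ∑ c ∈ words s m, ∑ y ∈ words s r, h (x ++ c ++ y) := by
  subst hL
  simp_rw [← Finset.sum_product']
  symm
  refine Finset.sum_bij (fun t _ => t.1 ++ t.2.1 ++ t.2.2) ?_ ?_ ?_ ?_
  · rintro ⟨x, c, y⟩ ht
    simp only [Finset.mem_product, mem_words] at ht ⊢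
    simp only [List.length_append]
    omega
  · rintro ⟨x, c, y⟩ ht ⟨x', c', y'⟩ ht' heq
    simp only [Finset.mem_product, mem_words] at ht ht'
    simp only [List.append_assoc] at heq
    obtain ⟨h1, h2⟩ := List.append_inj heq (by omega)
    obtain ⟨h3, h4⟩ := List.append_inj h2 (by omega)
    rw [h1, h3, h4]
  · intro l hl
    rw [mem_words] at hl
    refine ⟨(l.take i, (l.drop i).take m, (l.drop i).drop m), ?_, ?_⟩
    · simp only [Finset.mem_product, mem_words, List.length_take, List.length_drop]
      omega
    · simp only [List.append_assoc, List.take_append_drop]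
  · intro t _
    rfl

theorem sum_words_one {s : ℕ} {M : Type*} [AddCommMonoid M] (h : List (Spin s) → M) :
    ∑ l ∈ words s 1, h l = ∑ k : Fin s, (h [up k] + h [dn k]) := by
  rw [← sum_ofFn]
  rw [← (Equiv.funUnique (Fin 1) (Spin s)).symm.sum_comp]
  simp only [Equiv.funUnique_symm_apply, List.ofFn_succ, List.ofFn_zero, uniqueElim_const]
  rw [Fintype.sum_prod_type, Fintype.sum_bool, ← Finset.sum_add_distrib]
  rfl

theorem words_zero (s : ℕ) : words s 0 = {[]} := by
  ext l
  rw [mem_words, Finset.mem_singleton, List.length_eq_zero_iff]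

/-! ### Reduction of words -/

/-- One step of the reduction: a down step cancels an up step of the same color on top of
the stack, and every other letter is pushed. -/
def pushSpin {s : ℕ} (st : List (Spin s)) (c : Spin s) : List (Spin s) :=
  match st with
  | [] => [c]
  | t :: st' => if t = (true, c.2) ∧ c.1 = false then st' else c :: t :: st'

/-- The reduced word (as a stack, last letter first) obtained by reading `l`, starting with the
stack `st`. -/
def reduce {s : ℕ} (st : List (Spin s)) (l : List (Spin s)) : List (Spin s) :=
  l.foldl pushSpin st

variable {s : ℕ}

@[simp] theorem reduce_nil (st : List (Spin s)) : reduce st [] = st := rfl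

@[simp] theorem reduce_cons (st : List (Spin s)) (c : Spin s) (l : List (Spin s)) :
    reduce st (c :: l) = reduce (pushSpin st c) l := rfl

@[simp] theorem reduce_append (st l₁ l₂ : List (Spin s)) :
    reduce st (l₁ ++ l₂) = reduce (reduce st l₁) l₂ := List.foldl_append

@[simp] theorem pushSpin_up (st : List (Spin s)) (k : Fin s) :
    pushSpin st (up k) = up k :: st := by
  cases st <;> simp [pushSpin, up]

@[simp] theorem pushSpin_dn_nil (k : Fin s) : pushSpin [] (dn k) = [dn k] := rfl

@[simp] theorem pushSpin_dn_up (st : List (Spin s)) (k : Fin s) :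
    pushSpin (up k :: st) (dn k) = st := by
  simp [pushSpin, up, dn]

theorem pushSpin_dn_up_ne (st : List (Spin s)) {k l : Fin s} (h : k ≠ l) :
    pushSpin (up k :: st) (dn l) = dn l :: up k :: st := by
  simp [pushSpin, up, dn, h]

@[simp] theorem pushSpin_dn_dn (st : List (Spin s)) (k l : Fin s) :
    pushSpin (dn k :: st) (dn l) = dn l :: dn k :: st := by
  simp [pushSpin, dn]

theorem up_or_dn (c : Spin s) : (∃ k, c = up k) ∨ ∃ k, c = dn k := by
  rcases c with ⟨_ | _, k⟩
  · exact Or.inr ⟨k, rfl⟩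
  · exact Or.inl ⟨k, rfl⟩

theorem up_ne_dn (k l : Fin s) : up k ≠ dn l := by simp [up, dn]

@[simp] theorem up_inj {k l : Fin s} : up k = up l ↔ k = l := by simp [up]

@[simp] theorem dn_inj {k l : Fin s} : dn k = dn l ↔ k = l := by simp [dn]

/-- A down step on the stack is never removed. -/
theorem reduce_append_dn (k : Fin s) (st l : List (Spin s)) : ∀ y : List (Spin s),
    reduce (y ++ dn k :: st) l = reduce y l ++ dn k :: st := by
  induction l with
  | nil => exact fun y => rfl
  | cons c l ih =>
    intro y
    have h : pushSpin (y ++ dn k :: st) c = pushSpin y c ++ dn k :: st := by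
      rcases up_or_dn c with ⟨m, rfl⟩ | ⟨m, rfl⟩
      · simp
      · rcases y with _ | ⟨t, y⟩
        · simp
        · simp only [List.cons_append, pushSpin]
          split_ifs <;> rfl
    rw [reduce_cons, reduce_cons, h, ih]

theorem reduce_dn_cons (k : Fin s) (st l : List (Spin s)) :
    reduce (dn k :: st) l = reduce [] l ++ dn k :: st :=
  reduce_append_dn k st l []

/-- Dyck words reduce to nothing. -/
theorem IsColoredDyck.reduce_eq {l : List (Spin s)} (h : IsColoredDyck l) (st : List (Spin s)) :
    reduce st l = st := by
  induction h generalizing st with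
  | nil => rfl
  | cons k w v _ _ ihw ihv => simp [ihw, ihv]

theorem IsColoredDyck.append {l₁ l₂ : List (Spin s)} (h₁ : IsColoredDyck l₁)
    (h₂ : IsColoredDyck l₂) : IsColoredDyck (l₁ ++ l₂) := by
  induction h₁ with
  | nil => exact h₂
  | cons k w v hw _ _ ihv =>
    have := IsColoredDyck.cons k w _ hw ihv
    simpa using this

/-- A word that is not a Dyck word has a defect: an unmatched down step, an unmatched up step, or
an up and a down step that face each other with different colors. -/
theorem exists_defect (l : List (Spin s)) : IsColoredDyck l ∨
    (∃ w k z, IsColoredDyck w ∧ l = w ++ dn k :: z) ∨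
    (∃ z k w, IsColoredDyck w ∧ l = z ++ up k :: w) ∨
    (∃ x j w k z, IsColoredDyck w ∧ j ≠ k ∧ l = x ++ up j :: (w ++ dn k :: z)) := by
  induction hn : l.length using Nat.strong_induction_on generalizing l with
  | _ n ih =>
  rcases l with _ | ⟨c, t⟩
  · exact Or.inl .nil
  rcases up_or_dn c with ⟨k, rfl⟩ | ⟨k, rfl⟩
  swap
  · exact Or.inr (Or.inl ⟨[], k, t, .nil, rfl⟩)
  simp only [List.length_cons] at hn
  rcases ih t.length (by omega) t rfl with h | ⟨w, j, z, hw, rfl⟩ | ⟨z, j, w, hw, rfl⟩ |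
    ⟨x, i, w, j, z, hw, hij, rfl⟩
  · exact Or.inr (Or.inr (Or.inl ⟨[], k, t, h, rfl⟩))
  · by_cases hkj : k = j
    · subst hkj
      have hd : IsColoredDyck (up k :: (w ++ dn k :: [])) := .cons k w [] hw .nil
      have e : ∀ z, up k :: (w ++ dn k :: z) = up k :: (w ++ dn k :: []) ++ z := by simp
      simp only [List.length_append, List.length_cons] at hn
      rcases ih z.length (by omega) z rfl with h | ⟨w', j, z', hw', rfl⟩ | ⟨z', j, w', hw', rfl⟩ |
        ⟨x', i, w', j, z', hw', hij, rfl⟩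
      · exact Or.inl (.cons k w z hw h)
      · exact Or.inr (Or.inl ⟨_, j, z', hd.append hw', by simp⟩)
      · exact Or.inr (Or.inr (Or.inl ⟨up k :: (w ++ dn k :: z'), j, w', hw', by simp⟩))
      · exact Or.inr (Or.inr (Or.inr
          ⟨up k :: (w ++ dn k :: x'), i, w', j, z', hw', hij, by simp⟩))
    · exact Or.inr (Or.inr (Or.inr ⟨[], k, w, j, z, hw, hkj, rfl⟩))
  · exact Or.inr (Or.inr (Or.inl ⟨up k :: z, j, w, hw, rfl⟩))
  · exact Or.inr (Or.inr (Or.inr ⟨up k :: x, i, w, j, z, hw, hij, rfl⟩))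

/-- For the converse, each kind of defect in `exists_defect` leaves a letter on the stack for good:
an unmatched down step is never removed, and it shields everything below it. -/
theorem isColoredDyck_iff {l : List (Spin s)} : IsColoredDyck l ↔ reduce [] l = [] := by
  refine ⟨fun h => h.reduce_eq [], fun h => ?_⟩
  rcases exists_defect l with h' | ⟨w, j, z, hw, rfl⟩ | ⟨z, j, w, hw, rfl⟩ |
    ⟨x, i, w, j, z, hw, hij, rfl⟩
  · exact h'
  · simp [hw.reduce_eq, reduce_dn_cons] at h
  · simp [hw.reduce_eq] at h
  · simp [hw.reduce_eq, pushSpin_dn_up_ne _ hij, reduce_dn_cons] at h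

end Fredkin

namespace Fredkin

/-! ### The quadratic form of the Hamiltonian -/

/-- The real quadratic form `⟨f, A f⟩`. -/
noncomputable def qform {ι : Type*} [Fintype ι] (A : Matrix ι ι ℂ) (f : ι → ℂ) : ℝ :=
  (star f ⬝ᵥ A.mulVec f).re

theorem qform_add {ι : Type*} [Fintype ι] (A B : Matrix ι ι ℂ) (f : ι → ℂ) :
    qform (A + B) f = qform A f + qform B f := by
  simp [qform, Matrix.add_mulVec, dotProduct_add]

theorem qform_zero {ι : Type*} [Fintype ι] (f : ι → ℂ) : qform (0 : Matrix ι ι ℂ) f = 0 := by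
  simp [qform]

theorem qform_sum {ι κ : Type*} [Fintype ι] (S : Finset κ) (A : κ → Matrix ι ι ℂ) (f : ι → ℂ) :
    qform (∑ k ∈ S, A k) f = ∑ k ∈ S, qform (A k) f := by
  classical
  induction S using Finset.induction_on with
  | empty => simp [qform_zero]
  | insert a S ha ih => rw [Finset.sum_insert ha, Finset.sum_insert ha, qform_add, ih]

/-! ### Local operators as sums over windows of sites -/

section Sites

variable {s L m : ℕ} {e : Fin m → Fin L}

theorem extend_comp_sites (he : Function.Injective e) (a : Config s m) (z : Config s L) :
    Function.extend e a z ∘ e = a := by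
  funext i
  exact he.extend_apply a z i

theorem extend_extend_sites (he : Function.Injective e) (a b : Config s m) (z : Config s L) :
    Function.extend e a (Function.extend e b z) = Function.extend e a z := by
  funext i
  by_cases hi : ∃ j, e j = i
  · obtain ⟨j, rfl⟩ := hi
    rw [he.extend_apply, he.extend_apply]
  · rw [Function.extend_apply' _ _ _ hi, Function.extend_apply' _ _ _ hi,
      Function.extend_apply' _ _ _ hi]

theorem extend_comp_self_sites (he : Function.Injective e) (z : Config s L) :
    Function.extend e (z ∘ e) z = z := by
  funext i
  by_cases hi : ∃ j, e j = i
  · obtain ⟨j, rfl⟩ := hi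
    rw [he.extend_apply]; rfl
  · rw [Function.extend_apply' _ _ _ hi]

/-- A configuration is its restriction to the window together with its values outside. The outside
part is represented by the configuration whose window has been overwritten with the arbitrary
pattern `α`. -/
theorem sum_sites (he : Function.Injective e) (α : Config s m) (h : Config s L → ℂ) :
    ∑ x, h x = ∑ z with z ∘ e = α, ∑ a, h (Function.extend e a z) := by
  rw [← Finset.sum_product']
  refine Finset.sum_bij' (fun x _ => (Function.extend e α x, x ∘ e))
    (fun p _ => Function.extend e p.2 p.1) ?_ ?_ ?_ ?_ ?_
  · intro x _
    simp [extend_comp_sites he]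
  · intro p _
    exact Finset.mem_univ _
  · intro x _
    simp [extend_extend_sites he, extend_comp_self_sites he]
  · rintro ⟨z, a⟩ hz
    simp only [Finset.mem_product, Finset.mem_filter, Finset.mem_univ, true_and, and_true] at hz
    subst hz
    simp [extend_extend_sites he, extend_comp_sites he, extend_comp_self_sites he]
  · intro x _
    simp [extend_extend_sites he, extend_comp_self_sites he]

theorem sum_sites_fiber (he : Function.Injective e) (x : Config s L) (h : Config s L → ℂ) :
    ∑ y, (if ∀ i, (∀ a, e a ≠ i) → x i = y i then h y else 0) =
      ∑ a, h (Function.extend e a x) := by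
  rw [← Finset.sum_filter]
  symm
  refine Finset.sum_bij' (fun a _ => Function.extend e a x) (fun y _ => y ∘ e) ?_ ?_ ?_ ?_ ?_
  · intro a _
    simp only [Finset.mem_filter, Finset.mem_univ, true_and]
    intro i hi
    rw [Function.extend_apply' _ _ _ (by simpa using hi)]
  · intro y _
    exact Finset.mem_univ _
  · intro a _
    exact extend_comp_sites he a x
  · intro y hy
    simp only [Finset.mem_filter, Finset.mem_univ, true_and] at hy
    funext i
    by_cases hi : ∃ j, e j = i
    · obtain ⟨j, rfl⟩ := hi
      rw [he.extend_apply]; rfl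
    · rw [Function.extend_apply' _ _ _ hi]
      exact hy i (by simpa using hi)
  · intro a _
    rfl

/-- The operator is block diagonal with respect to the values outside the window, and on each block
it is the rank-one form of `v`. The pattern `α` only selects one representative per block; later it
is chosen as one of the two words occurring in `v`. -/
theorem qform_onSites_ketbra (he : Function.Injective e) (α : Config s m) (v : Config s m → ℂ)
    (f : Config s L → ℂ) :
    qform (onSites e (ketbra v)) f =
      ∑ z with z ∘ e = α, ‖∑ a, star (v a) * f (Function.extend e a z)‖ ^ 2 := by
  have h1 : star f ⬝ᵥ (onSites e (ketbra v)).mulVec f =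
      ∑ x, star (f x) * (v (x ∘ e) * ∑ a, star (v a) * f (Function.extend e a x)) := by
    refine Finset.sum_congr rfl fun x _ => ?_
    simp only [Pi.star_apply]
    congr 1
    have := sum_sites_fiber he x fun y => v (x ∘ e) * star (v (y ∘ e)) * f y
    simp only [extend_comp_sites he] at this
    rw [Finset.mul_sum]
    simp_rw [← mul_assoc]
    rw [← this, Matrix.mulVec, dotProduct]
    refine Finset.sum_congr rfl fun y _ => ?_
    by_cases hxy : ∀ i, (∀ a, e a ≠ i) → x i = y i
    · simp [onSites, ketbra, Matrix.vecMulVec_apply]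
    · simp [onSites, hxy]
  rw [qform, h1, sum_sites he α, Complex.re_sum]
  refine Finset.sum_congr rfl fun z _ => ?_
  simp only [extend_extend_sites he, extend_comp_sites he]
  set A := ∑ a, star (v a) * f (Function.extend e a z) with hA
  have : ∑ a, star (f (Function.extend e a z)) * (v a * A) = star A * A := by
    rw [hA, star_sum, Finset.sum_mul]
    refine Finset.sum_congr rfl fun a _ => ?_
    rw [star_mul, star_star, mul_assoc]
  rw [this, Complex.star_def, Complex.conj_mul', ← Complex.ofReal_pow, Complex.ofReal_re]

theorem qform_onSites_ket (he : Function.Injective e) (α : Config s m) (f : Config s L → ℂ) :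
    qform (onSites e (ketbra (ket α))) f = ∑ z with z ∘ e = α, ‖f z‖ ^ 2 := by
  rw [qform_onSites_ketbra he α]
  refine Finset.sum_congr rfl fun z hz => ?_
  have hz' : z ∘ e = α := by simpa using hz
  have h0 : Function.extend e α z = z := by rw [← hz', extend_comp_self_sites he]
  rw [Finset.sum_eq_single α]
  · simp [ket, h0]
  · intro b _ hb
    simp [ket, hb]
  · simp

theorem qform_onSites_sub (he : Function.Injective e) (α β : Config s m)
    (f : Config s L → ℂ) :
    qform (onSites e (ketbra (((1 / Real.sqrt 2 : ℝ) : ℂ) • (ket α - ket β)))) f =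
      1 / 2 * ∑ z with z ∘ e = α, ‖f z - f (Function.extend e β z)‖ ^ 2 := by
  rw [qform_onSites_ketbra he α, Finset.mul_sum]
  refine Finset.sum_congr rfl fun z hz => ?_
  have hz' : z ∘ e = α := by simpa using hz
  have h0 : Function.extend e α z = z := by rw [← hz', extend_comp_self_sites he]
  have h1 : ∀ γ : Config s m, ∑ a, star (ket γ a) * f (Function.extend e a z) =
      f (Function.extend e γ z) := by
    intro γ
    rw [Finset.sum_eq_single γ]
    · simp [ket]
    · intro b _ hb
      simp [ket, hb]
    · simp
  have h2 : ∑ a, star ((((1 / Real.sqrt 2 : ℝ) : ℂ) • (ket α - ket β)) a) *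
      f (Function.extend e a z) =
      ((1 / Real.sqrt 2 : ℝ) : ℂ) * (f z - f (Function.extend e β z)) := by
    rw [← h1 β]
    conv_rhs => rw [← h0, ← h1 α]
    rw [← Finset.sum_sub_distrib, Finset.mul_sum]
    refine Finset.sum_congr rfl fun a _ => ?_
    simp only [Pi.smul_apply, Pi.sub_apply, smul_eq_mul, star_mul, star_sub, h0, Complex.star_def,
      Complex.conj_ofReal]
    ring
  rw [h2, norm_mul, mul_pow, Complex.norm_real, Real.norm_eq_abs, sq_abs, div_pow,
    Real.sq_sqrt (by norm_num), one_pow]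

theorem sites_injective {j : ℕ} (he : ∀ i, (e i : ℕ) = j + i) : Function.Injective e :=
  fun a b hab => by
    have := congrArg Fin.val hab
    rw [he, he] at this
    exact Fin.ext (by omega)

/-- For consecutive sites, overwriting the window is replacing a middle segment of the list. This is
the passage from operators on sites to lists. -/
theorem ofFn_extend {j r : ℕ} (hL : L = j + m + r) (he : ∀ i, (e i : ℕ) = j + i)
    (β : Config s m) (z : Config s L) : List.ofFn (Function.extend e β z) =
      (List.ofFn z).take j ++ List.ofFn β ++ (List.ofFn z).drop (j + m) := by
  refine List.ext_getElem (by simp; omega) fun i hi hi' => ?_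
  simp only [List.length_ofFn] at hi
  rw [List.getElem_ofFn, List.getElem_append]
  by_cases hij : i < j
  · rw [dif_pos (by simp; omega), List.getElem_append_left (by simp; omega)]
    rw [List.getElem_take, List.getElem_ofFn, Function.extend_apply']
    rintro ⟨a, ha⟩
    have := congrArg Fin.val ha
    rw [he] at this
    simp at this
    omega
  · by_cases hjm : i < j + m
    · rw [dif_pos (by simp; omega), List.getElem_append_right (by simp; omega)]
      have : (⟨i, hi⟩ : Fin L) = e ⟨i - j, by omega⟩ := Fin.ext (by rw [he]; simp; omega)
      rw [this, (sites_injective he).extend_apply, List.getElem_ofFn]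
      congr 1
      exact Fin.ext (by simp; omega)
    · rw [dif_neg (by simp; omega), List.getElem_drop, List.getElem_ofFn,
        Function.extend_apply']
      · congr 1
        exact Fin.ext (by simp; omega)
      · rintro ⟨a, ha⟩
        have := congrArg Fin.val ha
        rw [he] at this
        simp at this
        omega

/-- Sums over the configurations with a prescribed window, as sums over the two remaining parts
of the word. -/
theorem sum_window {j r : ℕ} (hL : L = j + m + r) (he : ∀ i, (e i : ℕ) = j + i)
    (α β : Config s m) (h : List (Spin s) → List (Spin s) → ℝ) :
    ∑ z with z ∘ e = α, h (List.ofFn z) (List.ofFn (Function.extend e β z)) =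
      ∑ x ∈ words s j, ∑ y ∈ words s r,
        h (x ++ List.ofFn α ++ y) (x ++ List.ofFn β ++ y) := by
  have h1 : ∀ z : Config s L, z ∘ e = α ↔ ((List.ofFn z).drop j).take m = List.ofFn α := by
    intro z
    constructor
    · rintro rfl
      refine List.ext_getElem (by simp; omega) fun i hi hi' => ?_
      simp only [List.length_ofFn] at hi'
      simp only [List.getElem_take, List.getElem_drop, List.getElem_ofFn, Function.comp]
      congr 1
      exact Fin.ext (he ⟨i, hi'⟩).symm
    · intro H
      funext i
      have h2 : (((List.ofFn z).drop j).take m)[(i : ℕ)]'(by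
          have := i.2; simp; omega) = (List.ofFn α)[(i : ℕ)]'(by simp) := by
        simp only [H]
      simp only [List.getElem_take, List.getElem_drop, List.getElem_ofFn] at h2
      rw [← h2]
      simp only [Function.comp]
      congr 1
      exact Fin.ext (he i)
  rw [Finset.sum_filter]
  simp only [h1, ofFn_extend hL he]
  rw [sum_ofFn (fun l => if (l.drop j).take m = List.ofFn α then
    h l (l.take j ++ List.ofFn β ++ l.drop (j + m)) else 0), sum_words_split _ hL]
  refine Finset.sum_congr rfl fun x hx => ?_
  rw [mem_words] at hx
  rw [Finset.sum_comm]
  refine Finset.sum_congr rfl fun y _ => ?_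
  rw [Finset.sum_eq_single (List.ofFn α)]
  · have hd : List.drop (j + m) (x ++ (List.ofFn α ++ y)) = y := by
      rw [← List.append_assoc]
      exact List.drop_left' (by simp [hx])
    simp [hd, List.drop_left' hx, List.take_left' hx, List.take_left']
  · intro c hc hne
    rw [mem_words] at hc
    simp [List.drop_left' hx, List.take_left' hc, hne]
  · intro hα
    exact absurd (mem_words.2 (by simp)) hα

end Sites

/-! ### The quadratic form as a sum over words -/

/-- The energy of the interactions, for the amplitudes `F` of the words. -/
noncomputable def bulkEnergy (s L : ℕ) (F : List (Spin s) → ℂ) : ℝ :=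
  ∑ j : Fin (L - 2), ∑ k₁ : Fin s, ∑ k₂ : Fin s,
    (1 / 2 * ∑ x ∈ words s j, ∑ y ∈ words s (L - 3 - j),
        ‖F (x ++ [up k₁, up k₂, dn k₂] ++ y) - F (x ++ [up k₂, dn k₂, up k₁] ++ y)‖ ^ 2
      + 1 / 2 * ∑ x ∈ words s j, ∑ y ∈ words s (L - 3 - j),
        ‖F (x ++ [dn k₁, up k₂, dn k₂] ++ y) - F (x ++ [up k₂, dn k₂, dn k₁] ++ y)‖ ^ 2
      + 1 / 2 * ∑ x ∈ words s j, ∑ y ∈ words s (L - 2 - j),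
        ‖F (x ++ [up k₁, dn k₁] ++ y) - F (x ++ [up k₂, dn k₂] ++ y)‖ ^ 2)

/-- The energy of the penalties for differently colored neighbors. -/
noncomputable def crossEnergy (s L : ℕ) (F : List (Spin s) → ℂ) : ℝ :=
  ∑ j : Fin (L - 1), ∑ k₁ : Fin s, ∑ k₂ : Fin s,
    (if k₁ ≠ k₂ then ∑ x ∈ words s j, ∑ y ∈ words s (L - 2 - j),
      ‖F (x ++ [up k₁, dn k₂] ++ y)‖ ^ 2 else 0)

/-- The energy of the penalties at the boundary. -/
noncomputable def boundaryEnergy (s L : ℕ) (F : List (Spin s) → ℂ) : ℝ :=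
  ∑ k : Fin s, (∑ y ∈ words s (L - 1), ‖F (dn k :: y)‖ ^ 2
      + ∑ x ∈ words s (L - 1), ‖F (x ++ [up k])‖ ^ 2)

/-- The quadratic form of the Hamiltonian in terms of words. -/
noncomputable def energy (s L : ℕ) (F : List (Spin s) → ℂ) : ℝ :=
  bulkEnergy s L F + crossEnergy s L F + boundaryEnergy s L F

theorem bulkEnergy_nonneg (s L : ℕ) (F : List (Spin s) → ℂ) : 0 ≤ bulkEnergy s L F := by
  unfold bulkEnergy; positivity

theorem crossEnergy_nonneg (s L : ℕ) (F : List (Spin s) → ℂ) : 0 ≤ crossEnergy s L F := by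
  unfold crossEnergy
  refine Finset.sum_nonneg fun j _ => Finset.sum_nonneg fun k _ => Finset.sum_nonneg fun l _ => ?_
  split_ifs <;> positivity

theorem boundaryEnergy_nonneg (s L : ℕ) (F : List (Spin s) → ℂ) : 0 ≤ boundaryEnergy s L F := by
  unfold boundaryEnergy; positivity

theorem energy_nonneg (s L : ℕ) (F : List (Spin s) → ℂ) : 0 ≤ energy s L F :=
  add_nonneg (add_nonneg (bulkEnergy_nonneg s L F) (crossEnergy_nonneg s L F))
    (boundaryEnergy_nonneg s L F)

theorem qform_hamiltonian {s n : ℕ} (hn : 1 ≤ n) (F : List (Spin s) → ℂ) :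
    qform (hamiltonian s n) (fun z => F (List.ofFn z)) = energy s (2 * n) F := by
  have e3 : ∀ j : Fin (2 * n - 2), ∀ i : Fin 3, ((![⟨j, by omega⟩, ⟨j + 1, by omega⟩,
      ⟨j + 2, by omega⟩] : Fin 3 → Fin (2 * n)) i : ℕ) = j + i := by
    intro j i
    fin_cases i <;> rfl
  have e2 : ∀ j : ℕ, ∀ h : j + 1 < 2 * n, ∀ i : Fin 2, ((![⟨j, by omega⟩, ⟨j + 1, h⟩] :
      Fin 2 → Fin (2 * n)) i : ℕ) = j + i := by
    intro j h i
    fin_cases i <;> rfl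
  have e1 : ∀ j : ℕ, ∀ h : j < 2 * n, ∀ i : Fin 1, ((![⟨j, h⟩] :
      Fin 1 → Fin (2 * n)) i : ℕ) = j + i := by
    intro j h i
    fin_cases i; rfl
  have key : ∀ {m j r : ℕ} {e : Fin m → Fin (2 * n)} (_ : 2 * n = j + m + r)
      (_ : ∀ i, (e i : ℕ) = j + i) (α β : Config s m),
      qform (onSites e (ketbra (((1 / Real.sqrt 2 : ℝ) : ℂ) • (ket α - ket β))))
        (fun z => F (List.ofFn z)) = 1 / 2 * ∑ x ∈ words s j, ∑ y ∈ words s r,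
          ‖F (x ++ List.ofFn α ++ y) - F (x ++ List.ofFn β ++ y)‖ ^ 2 := by
    intro m j r e hL he α β
    rw [qform_onSites_sub (sites_injective he), sum_window hL he α β fun l l' => ‖F l - F l'‖ ^ 2]
  have key' : ∀ {m j r : ℕ} {e : Fin m → Fin (2 * n)} (_ : 2 * n = j + m + r)
      (_ : ∀ i, (e i : ℕ) = j + i) (α : Config s m),
      qform (onSites e (ketbra (ket α)))
        (fun z => F (List.ofFn z)) = ∑ x ∈ words s j, ∑ y ∈ words s r,
          ‖F (x ++ List.ofFn α ++ y)‖ ^ 2 := by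
    intro m j r e hL he α
    rw [qform_onSites_ket (sites_injective he), sum_window hL he α α fun l _ => ‖F l‖ ^ 2]
  rw [hamiltonian, qform_add, qform_add, energy, bulkEnergy, crossEnergy, boundaryEnergy]
  congr 1
  · congr 1
    · rw [qform_sum]
      refine Finset.sum_congr rfl fun j _ => ?_
      have hj := j.2
      rw [bulkTerm, qform_sum]
      refine Finset.sum_congr rfl fun k₁ _ => ?_
      rw [qform_sum]
      refine Finset.sum_congr rfl fun k₂ _ => ?_
      rw [qform_add, qform_add, vecU, vecD, vecPhi,
        key (r := 2 * n - 3 - j) (by omega) (e3 j), key (r := 2 * n - 3 - j) (by omega) (e3 j),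
        key (r := 2 * n - 2 - j) (by omega) (e2 j (by omega))]
      simp [List.ofFn_succ]
    · rw [qform_sum]
      refine Finset.sum_congr rfl fun j _ => ?_
      have hj := j.2
      rw [crossTerm, qform_sum]
      refine Finset.sum_congr rfl fun k₁ _ => ?_
      rw [qform_sum]
      refine Finset.sum_congr rfl fun k₂ _ => ?_
      split_ifs
      · rw [key' (r := 2 * n - 2 - j) (by omega) (e2 j (by omega))]
        simp [List.ofFn_succ]
      · exact qform_zero _
  · rw [boundaryTerm, dif_pos (by omega), qform_sum]
    refine Finset.sum_congr rfl fun k _ => ?_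
    rw [qform_add, key' (r := 2 * n - 1) (by omega) (e1 0 (by omega)),
      key' (r := 0) (by omega) (e1 (2 * n - 1) (by omega))]
    simp [words_zero, List.ofFn_succ]

end Fredkin

namespace Fredkin

/-! ### Colored binary trees -/

/-- Binary trees with nodes colored by `Fin s`; they encode the colored Dyck words. -/
inductive CTree (s : ℕ) : Type
  | nil : CTree s
  | node (k : Fin s) (a b : CTree s) : CTree s

variable {s : ℕ}

/-- The number of nodes. -/
def CTree.size : CTree s → ℕ
  | nil => 0
  | node _ a b => a.size + b.size + 1

/-- The Dyck word encoded by a tree. -/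
def CTree.word : CTree s → List (Spin s)
  | nil => []
  | node k a b => up k :: (a.word ++ dn k :: b.word)

open CTree

theorem length_word (t : CTree s) : t.word.length = 2 * t.size := by
  induction t with
  | nil => rfl
  | node k a b iha ihb =>
    simp only [word, size, List.length_cons, List.length_append, iha, ihb]
    ring

theorem isColoredDyck_word (t : CTree s) : IsColoredDyck t.word := by
  induction t with
  | nil => exact .nil
  | node k a b iha ihb => exact .cons k _ _ iha ihb

theorem IsColoredDyck.exists_word {l : List (Spin s)} (h : IsColoredDyck l) :
    ∃ t : CTree s, t.word = l := by
  induction h with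
  | nil => exact ⟨CTree.nil, rfl⟩
  | cons k w v _ _ ihw ihv =>
    obtain ⟨a, rfl⟩ := ihw
    obtain ⟨b, rfl⟩ := ihv
    exact ⟨node k a b, rfl⟩

/-- Unique parsing. Since the remainder does not start with an up step, it cannot contribute another
node at the right end of the tree, so the Dyck prefix is the maximal one. A remainder starting with
a down step occurs inside the induction. -/
theorem word_append_inj (a : CTree s) : ∀ (b : CTree s) (x y : List (Spin s)),
    (∀ k z, x ≠ up k :: z) → (∀ k z, y ≠ up k :: z) → a.word ++ x = b.word ++ y →
    a = b ∧ x = y := by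
  induction a with
  | nil =>
    intro b x y hx _ h
    rcases b with _ | ⟨k, c, d⟩
    · exact ⟨rfl, h⟩
    · exact absurd h (hx k _)
  | node k a₁ a₂ ih₁ ih₂ =>
    intro b x y hx hy h
    rcases b with _ | ⟨k', b₁, b₂⟩
    · exact absurd h.symm (hy k _)
    · simp only [word, List.cons_append, List.append_assoc, List.cons.injEq, up_inj] at h
      obtain ⟨rfl, h⟩ := h
      obtain ⟨rfl, h'⟩ := ih₁ b₁ _ _ (by simp [up, dn]) (by simp [up, dn]) h
      simp only [List.cons.injEq, true_and] at h'
      obtain ⟨rfl, rfl⟩ := ih₂ b₂ _ _ hx hy h'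
      exact ⟨rfl, rfl⟩

theorem word_injective : Function.Injective (word : CTree s → List (Spin s)) := fun a b h =>
  (word_append_inj a b [] [] (by simp) (by simp) (by simpa using h)).1

/-- The trees with `n` nodes. -/
noncomputable def trees (s n : ℕ) : Finset (CTree s) :=
  (words s (2 * n)).preimage word word_injective.injOn

theorem mem_trees {n : ℕ} {t : CTree s} : t ∈ trees s n ↔ t.size = n := by
  rw [trees, Finset.mem_preimage, mem_words, length_word]
  omega

theorem trees_zero : trees s 0 = {nil} := by
  ext t
  rw [mem_trees, Finset.mem_singleton]
  cases t <;> simp [size]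

theorem sum_trees_succ {M : Type*} [AddCommMonoid M] (n : ℕ) (g : CTree s → M) :
    ∑ t ∈ trees s (n + 1), g t = ∑ ij ∈ Finset.HasAntidiagonal.antidiagonal n, ∑ k : Fin s,
      ∑ a ∈ trees s ij.1, ∑ b ∈ trees s ij.2, g (node k a b) := by
  simp_rw [← Finset.sum_product']
  rw [Finset.sum_sigma']
  symm
  refine Finset.sum_bij (fun x _ => node x.2.1 x.2.2.1 x.2.2.2) ?_ ?_ ?_ ?_
  · rintro ⟨⟨i, j⟩, k, a, b⟩ h
    simp only [Finset.mem_sigma, Finset.HasAntidiagonal.mem_antidiagonal, Finset.mem_product, mem_trees] at h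
    change node k a b ∈ _
    rw [mem_trees, size]
    omega
  · rintro ⟨⟨i, j⟩, k, a, b⟩ h ⟨⟨i', j'⟩, k', a', b'⟩ h' heq
    simp only [Finset.mem_sigma, Finset.HasAntidiagonal.mem_antidiagonal, Finset.mem_product, mem_trees] at h h'
    simp only [node.injEq] at heq
    obtain ⟨rfl, rfl, rfl⟩ := heq
    obtain ⟨-, -, rfl, rfl⟩ := h
    obtain ⟨-, -, rfl, rfl⟩ := h'
    rfl
  · intro t ht
    rw [mem_trees] at ht
    rcases t with _ | ⟨k, a, b⟩
    · simp [size] at ht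
    · refine ⟨⟨(a.size, b.size), k, a, b⟩, ?_, rfl⟩
      simp only [size, Nat.add_right_cancel_iff] at ht
      simp [mem_trees, ht]
  · intro x _
    rfl

/-! ### Counting trees by Catalan numbers -/

/-- The number of trees with `n` nodes. -/
noncomputable def numTrees (s n : ℕ) : ℝ := ((trees s n).card : ℝ)

theorem numTrees_succ (n : ℕ) : numTrees s (n + 1) =
    s * ∑ ij ∈ Finset.HasAntidiagonal.antidiagonal n, numTrees s ij.1 * numTrees s ij.2 := by
  have := sum_trees_succ (s := s) n fun _ => (1 : ℝ)
  simp only [Finset.sum_const, nsmul_eq_mul, mul_one, Finset.card_univ, Fintype.card_fin] at this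
  rw [numTrees, this, Finset.mul_sum]
  rfl

theorem numTrees_eq (s n : ℕ) : numTrees s n = catalan n * (s : ℝ) ^ n := by
  induction n using Nat.strong_induction_on with
  | _ n ih =>
  rcases n with _ | n
  · simp [numTrees, trees_zero]
  · rw [numTrees_succ, catalan_succ', Nat.cast_sum, Finset.sum_mul, Finset.mul_sum]
    refine Finset.sum_congr rfl fun ij hij => ?_
    have h := Finset.HasAntidiagonal.mem_antidiagonal.1 hij
    rw [ih ij.1 (by omega), ih ij.2 (by omega), ← h]
    push_cast
    ring

theorem catalan_pos (n : ℕ) : 0 < catalan n := by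
  have h := succ_mul_catalan_eq_centralBinom n
  have h' := Nat.centralBinom_pos n
  rw [← h] at h'
  exact Nat.pos_of_mul_pos_left h'

theorem numTrees_pos (hs : 1 ≤ s) (n : ℕ) : 0 < numTrees s n := by
  rw [numTrees_eq]
  have := catalan_pos n
  positivity

theorem catalan_succ_ratio (n : ℕ) :
    (catalan (n + 1) : ℝ) = (4 * n + 2) / (n + 2) * catalan n := by
  have h1 := succ_mul_catalan_eq_centralBinom n
  have h2 := succ_mul_catalan_eq_centralBinom (n + 1)
  have h3 := Nat.succ_mul_centralBinom_succ n
  have h4 : (n + 1) * ((n + 2) * catalan (n + 1)) = (n + 1) * ((4 * n + 2) * catalan n) := by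
    calc (n + 1) * ((n + 2) * catalan (n + 1)) = (n + 1) * (n + 1).centralBinom := by rw [← h2]
      _ = 2 * (2 * n + 1) * n.centralBinom := h3
      _ = _ := by rw [← h1]; ring
  have h5 := Nat.eq_of_mul_eq_mul_left (Nat.succ_pos n) h4
  have h6 : ((n : ℝ) + 2) * catalan (n + 1) = (4 * n + 2) * catalan n := by exact_mod_cast h5
  field_simp
  linarith

theorem numTrees_succ_ratio (s n : ℕ) :
    numTrees s (n + 1) = s * ((4 * n + 2) / (n + 2)) * numTrees s n := by
  rw [numTrees_eq, numTrees_eq, catalan_succ_ratio]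
  ring

theorem le_numTrees_succ (s n : ℕ) : s * numTrees s n ≤ numTrees s (n + 1) := by
  rw [numTrees_succ_ratio]
  have h : (1 : ℝ) ≤ (4 * n + 2) / (n + 2) := by
    rw [le_div_iff₀ (by positivity)]
    have : (0 : ℝ) ≤ n := by positivity
    linarith
  have h0 : 0 ≤ numTrees s n := by rw [numTrees]; positivity
  nlinarith [mul_nonneg (Nat.cast_nonneg (α := ℝ) s) h0]

/-! ### Removing a random peak -/

/-- The probability to remove a peak from the left subtree, if the left and right subtrees have
`i` and `j` nodes. -/
noncomputable def leftProb (i j : ℕ) : ℝ :=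
  i * (i + 1) * (i + 3 * j + 2) / ((i + j) * (i + j + 1) * (i + j + 2))

theorem leftProb_nonneg (i j : ℕ) : 0 ≤ leftProb i j := by
  unfold leftProb; positivity

theorem leftProb_zero (j : ℕ) : leftProb 0 j = 0 := by simp [leftProb]

/-- The weights for the two subtrees form a probability distribution; this gives row sums 1 in
`sum_peel_right`. -/
theorem leftProb_add (i j : ℕ) (h : 0 < i + j) : leftProb i j + leftProb j i = 1 := by
  have h' : (0 : ℝ) < i + j := by exact_mod_cast h
  unfold leftProb
  rw [show (j : ℝ) + i = i + j by ring, ← add_div, div_eq_one_iff_eq (by positivity)]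
  ring

/-- The identity that determines the form of `leftProb`: adding a peak to the left or to the right
subtree, weighted by the Catalan ratios of the subtrees, reproduces the Catalan ratio of the whole
tree. It is the induction step for the column sums in `sum_peel_left`. -/
theorem leftProb_balance (i j : ℕ) :
    leftProb (i + 1) j * ((4 * i + 2) / (i + 2)) + leftProb (j + 1) i * ((4 * j + 2) / (j + 2)) =
      (4 * ((i + j + 1 : ℕ) : ℝ) + 2) / (((i + j + 1 : ℕ) : ℝ) + 2) := by
  unfold leftProb
  push_cast
  rw [show (j : ℝ) + 1 + i = i + j + 1 by ring, show (i : ℝ) + 1 + j = i + j + 1 by ring]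
  field_simp
  ring

open Classical in
/-- The weight with which the tree `w` is turned into `w'` by the removal of a peak. The weights
are chosen such that uniformly distributed trees stay uniformly distributed. -/
noncomputable def peel : CTree s → CTree s → ℝ
  | nil, _ => 0
  | node _ a b, nil => if a = nil ∧ b = nil then 1 else 0
  | node k a b, node k' a' b' =>
      (if k = k' ∧ b = b' then leftProb a.size b.size * peel a a' else 0) +
      (if k = k' ∧ a = a' then leftProb b.size a.size * peel b b' else 0)

theorem peel_nonneg (w : CTree s) : ∀ w' : CTree s, 0 ≤ peel w w' := by
  induction w with
  | nil => intro w'; simp [peel]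
  | node k a b iha ihb =>
    rintro (_ | ⟨k', a', b'⟩)
    · rw [peel]; split_ifs <;> norm_num
    · rw [peel]
      have h1 := mul_nonneg (leftProb_nonneg a.size b.size) (iha a')
      have h2 := mul_nonneg (leftProb_nonneg b.size a.size) (ihb b')
      split_ifs <;> simp [h1, h2, add_nonneg]

/-- Only actual removals of an adjacent pair u^k d^k carry weight. This connects the Markov chain on
trees with the moves of the Hamiltonian. -/
theorem exists_peak_of_peel_ne_zero (w : CTree s) : ∀ w' : CTree s, peel w w' ≠ 0 →
    ∃ k l₁ l₂, w.word = l₁ ++ up k :: dn k :: l₂ ∧ w'.word = l₁ ++ l₂ := by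
  induction w with
  | nil => intro w' h; simp [peel] at h
  | node k a b iha ihb =>
    rintro (_ | ⟨k', a', b'⟩) h
    · rw [peel] at h
      split_ifs at h with hab
      · obtain ⟨rfl, rfl⟩ := hab
        exact ⟨k, [], [], rfl, rfl⟩
      · exact absurd rfl h
    · rw [peel] at h
      by_cases h1 : (if k = k' ∧ b = b' then leftProb a.size b.size * peel a a' else 0) = 0
      · rw [h1, zero_add] at h
        split_ifs at h with h2
        · obtain ⟨rfl, rfl⟩ := h2
          obtain ⟨m, l₁, l₂, e1, e2⟩ := ihb b' (right_ne_zero_of_mul h)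
          exact ⟨m, up k :: (a.word ++ dn k :: l₁), l₂, by simp [word, e1], by simp [word, e2]⟩
        · exact absurd rfl h
      · split_ifs at h1 with h2
        · obtain ⟨rfl, rfl⟩ := h2
          obtain ⟨m, l₁, l₂, e1, e2⟩ := iha a' (right_ne_zero_of_mul h1)
          exact ⟨m, up k :: l₁, l₂ ++ dn k :: b.word, by simp [word, e1], by simp [word, e2]⟩
        · exact absurd rfl h1

theorem sum_trees_left {i n : ℕ} (k : Fin s) (b : CTree s) (h : i + b.size + 1 = n)
    (g : CTree s → ℝ) (hg : ∀ t, g t ≠ 0 → ∃ a, t = node k a b) :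
    ∑ t ∈ trees s n, g t = ∑ a ∈ trees s i, g (node k a b) := by
  symm
  refine Finset.sum_bij_ne_zero (fun a _ _ => node k a b) ?_ ?_ ?_ ?_
  · intro a ha _
    rw [mem_trees] at ha ⊢
    rw [size, ha, h]
  · intro a _ _ a' _ _ heq
    simpa using heq
  · intro t ht h0
    obtain ⟨a, rfl⟩ := hg t h0
    refine ⟨a, ?_, h0, rfl⟩
    rw [mem_trees, size] at ht
    rw [mem_trees]
    omega
  · intro a _ _
    rfl

theorem sum_trees_right {j n : ℕ} (k : Fin s) (a : CTree s) (h : a.size + j + 1 = n)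
    (g : CTree s → ℝ) (hg : ∀ t, g t ≠ 0 → ∃ b, t = node k a b) :
    ∑ t ∈ trees s n, g t = ∑ b ∈ trees s j, g (node k a b) := by
  symm
  refine Finset.sum_bij_ne_zero (fun b _ _ => node k a b) ?_ ?_ ?_ ?_
  · intro b hb _
    rw [mem_trees] at hb ⊢
    rw [size, hb, h]
  · intro b _ _ b' _ _ heq
    simpa using heq
  · intro t ht h0
    obtain ⟨b, rfl⟩ := hg t h0
    refine ⟨b, ?_, h0, rfl⟩
    rw [mem_trees, size] at ht
    rw [mem_trees]
    omega
  · intro b _ _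
    rfl

open Classical in
/-- The part of `peel` that removes a peak from the left subtree. -/
noncomputable def peelLeft : CTree s → CTree s → ℝ
  | node k a b, node k' a' b' =>
      if k = k' ∧ b = b' then leftProb a.size b.size * peel a a' else 0
  | _, _ => 0

open Classical in
/-- The part of `peel` that removes a peak from the right subtree. -/
noncomputable def peelRight : CTree s → CTree s → ℝ
  | node k a b, node k' a' b' =>
      if k = k' ∧ a = a' then leftProb b.size a.size * peel b b' else 0
  | _, _ => 0

theorem peel_eq_left_add_right (w w' : CTree s) (h : w' ≠ nil) :
    peel w w' = peelLeft w w' + peelRight w w' := by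
  rcases w with _ | ⟨k, a, b⟩ <;> rcases w' with _ | ⟨k', a', b'⟩
  · exact absurd rfl h
  · simp [peel, peelLeft, peelRight]
  · exact absurd rfl h
  · rw [peel, peelLeft, peelRight]

theorem sum_peel_right {n : ℕ} (w : CTree s) : w.size = n + 1 →
    ∑ w' ∈ trees s n, peel w w' = 1 := by
  induction w generalizing n with
  | nil => intro h; simp [size] at h
  | node k a b iha ihb =>
    intro h
    rw [size] at h
    rcases n with _ | m
    · have ha : a = nil := Finset.mem_singleton.1
        (trees_zero (s := s) ▸ mem_trees.2 (by omega : a.size = 0))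
      have hb : b = nil := Finset.mem_singleton.1
        (trees_zero (s := s) ▸ mem_trees.2 (by omega : b.size = 0))
      subst ha hb
      simp [trees_zero, peel]
    · have h1 : ∀ w' ∈ trees s (m + 1), peel (node k a b) w' =
          peelLeft (node k a b) w' + peelRight (node k a b) w' := by
        intro w' hw'
        refine peel_eq_left_add_right _ _ ?_
        rintro rfl
        simp [mem_trees, size] at hw'
      rw [Finset.sum_congr rfl h1, Finset.sum_add_distrib,
        ← leftProb_add a.size b.size (by omega)]
      congr 1
      -- An empty subtree has no peak to lose, so the induction hypothesis does not apply to it; its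
      -- weight `leftProb 0 _` vanishes.
      · rcases ha : a.size with _ | i
        · rw [leftProb_zero]
          refine Finset.sum_eq_zero fun w' _ => ?_
          rcases w' with _ | ⟨k', a', b'⟩ <;> simp [peelLeft, ha, leftProb_zero]
        · rw [sum_trees_left (i := i) k b (by omega)]
          · simp only [peelLeft, and_self, if_true]
            rw [← Finset.mul_sum, iha ha, mul_one, ha]
          · rintro (_ | ⟨k', a', b'⟩) ht
            · simp [peelLeft] at ht
            · rw [peelLeft] at ht
              split_ifs at ht with hh
              · exact ⟨a', by rw [hh.1, hh.2]⟩
              · exact absurd rfl ht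
      · rcases hb : b.size with _ | i
        · rw [leftProb_zero]
          refine Finset.sum_eq_zero fun w' _ => ?_
          rcases w' with _ | ⟨k', a', b'⟩ <;> simp [peelRight, hb, leftProb_zero]
        · rw [sum_trees_right (j := i) k a (by omega)]
          · simp only [peelRight, and_self, if_true]
            rw [← Finset.mul_sum, ihb hb, mul_one, hb]
          · rintro (_ | ⟨k', a', b'⟩) ht
            · simp [peelRight] at ht
            · rw [peelRight] at ht
              split_ifs at ht with hh
              · exact ⟨b', by rw [hh.1, hh.2]⟩
              · exact absurd rfl ht

/-- The column sum depends only on the size of the tree, so a uniform tree with n+1 nodes is mapped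
to a uniform tree with n nodes. In the induction, a predecessor of `node k a b` enlarges exactly one
of the two subtrees, and `leftProb` is evaluated at the enlarged size. -/
theorem sum_peel_left {n : ℕ} (w' : CTree s) : w'.size = n →
    ∑ w ∈ trees s (n + 1), peel w w' = s * ((4 * n + 2) / (n + 2)) := by
  induction w' generalizing n with
  | nil =>
    rintro rfl
    rw [sum_trees_succ]
    simp [size, trees_zero, peel, Finset.filter_singleton]
  | node k a b iha ihb =>
    intro h
    rw [size] at h
    have h1 : ∀ w ∈ trees s (n + 1), peel w (node k a b) =
        peelLeft w (node k a b) + peelRight w (node k a b) := fun w _ =>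
      peel_eq_left_add_right _ _ (by simp)
    rw [Finset.sum_congr rfl h1, Finset.sum_add_distrib,
      sum_trees_left (i := a.size + 1) k b (by omega) (fun w => peelLeft w (node k a b)) ?_,
      sum_trees_right (j := b.size + 1) k a (by omega) (fun w => peelRight w (node k a b)) ?_]
    · simp only [peelLeft, peelRight, and_self, if_true]
      have h2 : ∑ x ∈ trees s (a.size + 1), leftProb x.size b.size * peel x a =
          leftProb (a.size + 1) b.size * (s * ((4 * a.size + 2) / (a.size + 2))) := by
        rw [← iha rfl, Finset.mul_sum]
        exact Finset.sum_congr rfl fun x hx => by rw [mem_trees.1 hx]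
      have h3 : ∑ x ∈ trees s (b.size + 1), leftProb x.size a.size * peel x b =
          leftProb (b.size + 1) a.size * (s * ((4 * b.size + 2) / (b.size + 2))) := by
        rw [← ihb rfl, Finset.mul_sum]
        exact Finset.sum_congr rfl fun x hx => by rw [mem_trees.1 hx]
      rw [h2, h3, ← h, ← leftProb_balance]
      ring
    · rintro (_ | ⟨k', a', b'⟩) ht
      · simp [peelRight] at ht
      · rw [peelRight] at ht
        split_ifs at ht with hh
        · exact ⟨b', by rw [hh.1, hh.2]⟩
        · exact absurd rfl ht
    · rintro (_ | ⟨k', a', b'⟩) ht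
      · simp [peelLeft] at ht
      · rw [peelLeft] at ht
        split_ifs at ht with hh
        · exact ⟨a', by rw [hh.1, hh.2]⟩
        · exact absurd rfl ht

theorem peel_le_one {n : ℕ} {w w' : CTree s} (hw : w.size = n + 1) (hw' : w'.size = n) :
    peel w w' ≤ 1 := by
  rw [← sum_peel_right w hw]
  exact Finset.single_le_sum (f := fun t => peel w t) (fun t _ => peel_nonneg w t)
    (mem_trees.2 hw')

end Fredkin

namespace Fredkin

open CTree

variable {s : ℕ}

/-! ### Transport along randomly removed peaks -/

theorem catalan_lower (i : ℕ) : (4 : ℝ) ^ i ≤ 2 * (i + 1) ^ 2 * catalan i := by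
  rcases Nat.eq_zero_or_pos i with rfl | hi
  · norm_num
  · have h1 := Nat.four_pow_le_two_mul_self_mul_centralBinom i hi
    rw [← succ_mul_catalan_eq_centralBinom] at h1
    have h2 : (4 : ℝ) ^ i ≤ 2 * i * ((i + 1) * catalan i) := by exact_mod_cast h1
    refine h2.trans ?_
    have h3 : (0 : ℝ) ≤ (i + 1) * catalan i := by positivity
    nlinarith

theorem catalan_upper (i : ℕ) : (i + 1) * (catalan i : ℝ) ≤ 4 ^ i := by
  have h1 : (i + 1) * catalan i ≤ 4 ^ i := by
    rw [succ_mul_catalan_eq_centralBinom, Nat.centralBinom]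
    calc (2 * i).choose i ≤ 2 ^ (2 * i) := Nat.choose_le_two_pow _ _
      _ = 4 ^ i := by rw [pow_mul]; norm_num
  exact_mod_cast h1

/-- Each Catalan number is a power of 4 up to a polynomial factor, by bounds on the central binomial
coefficient. The factors are collected with 4(i+1)(j+1) ≤ (i+j+2)^2. -/
theorem catalan_le_mul (i j : ℕ) :
    (catalan (i + j + 1) : ℝ) ≤ (i + j + 2) ^ 3 * (catalan i * catalan j) := by
  have h1 := catalan_upper (i + j + 1)
  have h2 := catalan_lower i
  have h3 := catalan_lower j
  have hx : (0 : ℝ) ≤ i := by positivity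
  have hy : (0 : ℝ) ≤ j := by positivity
  set c : ℝ := catalan i * catalan j with hc
  have hc0 : 0 ≤ c := by positivity
  have h4 : (4 : ℝ) ^ (i + j + 1) ≤ 16 * ((i + 1) * (j + 1)) ^ 2 * c := by
    have := mul_le_mul h2 h3 (by positivity) (by positivity)
    rw [pow_succ, pow_add, hc]
    nlinarith
  have h5 : 4 * (((i : ℝ) + 1) * (j + 1)) ≤ (i + j + 2) ^ 2 := by nlinarith [sq_nonneg ((i : ℝ) - j)]
  have h6 : 16 * (((i : ℝ) + 1) * (j + 1)) ^ 2 ≤ (i + j + 2) ^ 4 := by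
    have := pow_le_pow_left₀ (by positivity) h5 2
    nlinarith
  have h7 : ((i : ℝ) + j + 2) * catalan (i + j + 1) ≤
      (i + j + 2) * ((i + j + 2) ^ 3 * c) := by
    calc ((i : ℝ) + j + 2) * catalan (i + j + 1) = (((i + j + 1 : ℕ) : ℝ) + 1) *
          catalan (i + j + 1) := by push_cast; ring
      _ ≤ 4 ^ (i + j + 1) := h1
      _ ≤ 16 * ((i + 1) * (j + 1)) ^ 2 * c := h4
      _ ≤ (i + j + 2) ^ 4 * c := by gcongr
      _ = _ := by ring
  exact le_of_mul_le_mul_left h7 (by positivity)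

theorem numTrees_le_mul (i j : ℕ) : numTrees s (i + j + 1) ≤
    (i + j + 2) ^ 3 * (s * numTrees s i * numTrees s j) := by
  rw [numTrees_eq, numTrees_eq, numTrees_eq]
  have := mul_le_mul_of_nonneg_right (catalan_le_mul i j)
    (by positivity : (0 : ℝ) ≤ (s : ℝ) ^ (i + j + 1))
  refine this.trans (le_of_eq ?_)
  ring

/-! ### The chain of removals and the change of a function of two trees -/

open Classical in
/-- The `j`-step transition probabilities of the random removal of peaks. -/
noncomputable def ancestor : ℕ → CTree s → CTree s → ℝ
  | 0, w, a => if w = a then 1 else 0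
  | j + 1, w, a' => ∑ a ∈ trees s (a'.size + 1), ancestor j w a * peel a a'

theorem ancestor_nonneg (j : ℕ) (w a : CTree s) : 0 ≤ ancestor j w a := by
  induction j generalizing a with
  | zero => rw [ancestor]; split_ifs <;> norm_num
  | succ j ih =>
    rw [ancestor]
    exact Finset.sum_nonneg fun b _ => mul_nonneg (ih b) (peel_nonneg b a)

theorem sum_peel_left_eq (hs : 1 ≤ s) {n : ℕ} {w' : CTree s} (h : w'.size = n) :
    ∑ w ∈ trees s (n + 1), peel w w' = numTrees s (n + 1) / numTrees s n := by
  rw [sum_peel_left w' h, numTrees_succ_ratio, mul_div_cancel_right₀ _ (numTrees_pos hs n).ne']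

/-- Iteration of the column sums: the ratios of successive tree counts telescope. -/
theorem sum_ancestor_left (hs : 1 ≤ s) (j : ℕ) {m : ℕ} {a : CTree s} (ha : a.size = m) :
    ∑ w ∈ trees s (m + j), ancestor j w a = numTrees s (m + j) / numTrees s m := by
  induction j generalizing m a with
  | zero =>
    rw [add_zero, div_self (numTrees_pos hs m).ne',
      Finset.sum_eq_single a (fun b _ hb => by simp [ancestor, hb])
        (fun h => absurd (mem_trees.2 ha) h)]
    simp [ancestor]
  | succ j ih =>
    simp only [ancestor, ha]
    rw [Finset.sum_comm]
    have h1 : ∀ b ∈ trees s (m + 1), ∑ w ∈ trees s (m + (j + 1)), ancestor j w b * peel b a =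
        numTrees s (m + (j + 1)) / numTrees s (m + 1) * peel b a := by
      intro b hb
      rw [← Finset.sum_mul, show m + (j + 1) = m + 1 + j by ring, ih (mem_trees.1 hb)]
    rw [Finset.sum_congr rfl h1, ← Finset.mul_sum, sum_peel_left_eq hs ha]
    have := (numTrees_pos hs (m + 1)).ne'
    field_simp

theorem sum_ancestor_right (j : ℕ) {m : ℕ} {w : CTree s} (hw : w.size = m + j) :
    ∑ a ∈ trees s m, ancestor j w a = 1 := by
  induction j generalizing m with
  | zero =>
    rw [add_zero] at hw
    rw [Finset.sum_eq_single w (fun b _ hb => by simp [ancestor, hb.symm])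
      (fun h => absurd (mem_trees.2 hw) h)]
    simp [ancestor]
  | succ j ih =>
    have h1 : ∀ a ∈ trees s m, ancestor (j + 1) w a =
        ∑ b ∈ trees s (m + 1), ancestor j w b * peel b a := by
      intro a ha
      rw [ancestor, mem_trees.1 ha]
    rw [Finset.sum_congr rfl h1, Finset.sum_comm, ← ih (m := m + 1) (by omega)]
    refine Finset.sum_congr rfl fun b hb => ?_
    rw [← Finset.mul_sum, sum_peel_right b (mem_trees.1 hb), mul_one]

theorem sq_norm_sub_le (x y z : ℂ) {t : ℝ} (ht : 0 < t) :
    ‖x - z‖ ^ 2 ≤ (1 + 1 / t) * ‖x - y‖ ^ 2 + (1 + t) * ‖y - z‖ ^ 2 := by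
  have h1 : ‖x - z‖ ≤ ‖x - y‖ + ‖y - z‖ := norm_sub_le_norm_sub_add_norm_sub x y z
  have h2 : ‖x - z‖ ^ 2 ≤ (‖x - y‖ + ‖y - z‖) ^ 2 := pow_le_pow_left₀ (norm_nonneg _) h1 2
  have h3 : 0 ≤ (1 / t) * (‖x - y‖ - t * ‖y - z‖) ^ 2 := by positivity
  have h4 : (1 / t) * (‖x - y‖ - t * ‖y - z‖) ^ 2 =
      1 / t * ‖x - y‖ ^ 2 - 2 * ‖x - y‖ * ‖y - z‖ + t * ‖y - z‖ ^ 2 := by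
    field_simp
    ring
  nlinarith

theorem sq_norm_sub_le_two (x y z : ℂ) :
    ‖x - z‖ ^ 2 ≤ 2 * ‖x - y‖ ^ 2 + 2 * ‖z - y‖ ^ 2 := by
  have := sq_norm_sub_le x y z one_pos
  rw [norm_sub_rev z y]
  norm_num at this
  linarith

theorem sum_sum_comm₂ {ι κ ι' κ' : Type*} (A : Finset ι) (B : Finset κ) (A' : Finset ι')
    (B' : Finset κ') (f : ι → κ → ι' → κ' → ℝ) :
    ∑ a ∈ A, ∑ b ∈ B, ∑ a' ∈ A', ∑ b' ∈ B', f a b a' b' =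
      ∑ a' ∈ A', ∑ b' ∈ B', ∑ a ∈ A, ∑ b ∈ B, f a b a' b' := by
  have h1 : ∀ a ∈ A, ∑ b ∈ B, ∑ a' ∈ A', ∑ b' ∈ B', f a b a' b' =
      ∑ a' ∈ A', ∑ b' ∈ B', ∑ b ∈ B, f a b a' b' := by
    intro a _
    rw [Finset.sum_comm]
    exact Finset.sum_congr rfl fun a' _ => Finset.sum_comm
  rw [Finset.sum_congr rfl h1, Finset.sum_comm]
  exact Finset.sum_congr rfl fun a' _ => Finset.sum_comm

/-- The mean square of the change of `G` in the first `j` steps, up to normalization. -/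
noncomputable def drift (G : CTree s → CTree s → ℂ) (j m : ℕ) : ℝ :=
  ∑ w ∈ trees s (m + j), ∑ a ∈ trees s m, ∑ b ∈ trees s j,
    ancestor j w a * ‖G w nil - G a b‖ ^ 2

/-- The mean square of the change of `G` in one step, up to normalization. -/
noncomputable def stepDrift (G : CTree s → CTree s → ℂ) (j m : ℕ) : ℝ :=
  ∑ a ∈ trees s (m + 1), ∑ b ∈ trees s j, ∑ a' ∈ trees s m, ∑ b' ∈ trees s (j + 1),
    peel a a' * peel b' b * ‖G a b - G a' b'‖ ^ 2

/-- The triangle inequality through the pair (a, b) reached one step earlier, with Young's parameter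
`t` left free. All terms are written over one common weight `ancestor j w a * (peel a a' * peel b'
b)`; row and column sums of `peel` then integrate out the variables on which a term does not depend.
-/
theorem drift_succ_le (hs : 1 ≤ s) (G : CTree s → CTree s → ℂ) (j m : ℕ) {t : ℝ} (ht : 0 < t) :
    drift G (j + 1) m ≤ (1 + 1 / t) * (numTrees s (j + 1) / numTrees s j * drift G j (m + 1)) +
      (1 + t) * (numTrees s (m + j + 1) / numTrees s (m + 1) * stepDrift G j m) := by
  have h1 : drift G (j + 1) m = ∑ w ∈ trees s (m + j + 1), ∑ a ∈ trees s (m + 1),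
      ∑ b ∈ trees s j, ∑ a' ∈ trees s m, ∑ b' ∈ trees s (j + 1),
        ancestor j w a * (peel a a' * peel b' b) * ‖G w nil - G a' b'‖ ^ 2 := by
    refine Finset.sum_congr rfl fun w _ => ?_
    rw [sum_sum_comm₂]
    refine Finset.sum_congr rfl fun a' ha' => Finset.sum_congr rfl fun b' hb' => ?_
    rw [ancestor, mem_trees.1 ha', Finset.sum_mul]
    refine Finset.sum_congr rfl fun a _ => ?_
    rw [← Finset.sum_mul, ← Finset.mul_sum, ← Finset.mul_sum, sum_peel_right b' (mem_trees.1 hb'),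
      mul_one]
  have h2 : ∑ w ∈ trees s (m + j + 1), ∑ a ∈ trees s (m + 1),
      ∑ b ∈ trees s j, ∑ a' ∈ trees s m, ∑ b' ∈ trees s (j + 1),
        ancestor j w a * (peel a a' * peel b' b) * ‖G w nil - G a b‖ ^ 2 =
      numTrees s (j + 1) / numTrees s j * drift G j (m + 1) := by
    rw [drift, show m + 1 + j = m + j + 1 by ring, Finset.mul_sum]
    refine Finset.sum_congr rfl fun w _ => ?_
    rw [Finset.mul_sum]
    refine Finset.sum_congr rfl fun a ha => ?_
    rw [Finset.mul_sum]
    refine Finset.sum_congr rfl fun b hb => ?_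
    simp_rw [← Finset.sum_mul, ← Finset.mul_sum, sum_peel_left_eq hs (mem_trees.1 hb)]
    rw [← Finset.sum_mul, sum_peel_right a (mem_trees.1 ha)]
    ring
  have h3 : ∑ w ∈ trees s (m + j + 1), ∑ a ∈ trees s (m + 1),
      ∑ b ∈ trees s j, ∑ a' ∈ trees s m, ∑ b' ∈ trees s (j + 1),
        ancestor j w a * (peel a a' * peel b' b) * ‖G a b - G a' b'‖ ^ 2 =
      numTrees s (m + j + 1) / numTrees s (m + 1) * stepDrift G j m := by
    rw [Finset.sum_comm, stepDrift, Finset.mul_sum]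
    refine Finset.sum_congr rfl fun a ha => ?_
    have := sum_ancestor_left hs j (mem_trees.1 ha)
    rw [show m + 1 + j = m + j + 1 by ring] at this
    rw [← this, Finset.sum_mul]
    refine Finset.sum_congr rfl fun w _ => ?_
    simp_rw [Finset.mul_sum, mul_assoc]
  rw [h1, ← h2, ← h3]
  simp_rw [Finset.mul_sum]
  simp_rw [← Finset.sum_add_distrib]
  refine Finset.sum_le_sum fun w _ => Finset.sum_le_sum fun a _ => Finset.sum_le_sum fun b _ =>
    Finset.sum_le_sum fun a' _ => Finset.sum_le_sum fun b' _ => ?_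
  have h4 : 0 ≤ ancestor j w a * (peel a a' * peel b' b) :=
    mul_nonneg (ancestor_nonneg _ _ _) (mul_nonneg (peel_nonneg _ _) (peel_nonneg _ _))
  have := mul_le_mul_of_nonneg_left (sq_norm_sub_le (G w nil) (G a b) (G a' b') ht) h4
  linarith

/-- Both (a, b) and (a', b') arise from the smaller pair (a', b) by adding one peak, on the left or
on the right. Comparing each with a common center γ decouples the sums over a and b', so no joint
estimate of the two positions of the peak is needed. -/
theorem stepDrift_le (hs : 1 ≤ s) (G : CTree s → CTree s → ℂ) (Λ : CTree s → CTree s → ℝ)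
    (j m : ℕ) (hΛ : ∀ a' ∈ trees s m, ∀ b ∈ trees s j, ∃ γ : ℂ,
      ∑ a ∈ trees s (m + 1), peel a a' * ‖G a b - γ‖ ^ 2 ≤ Λ a' b ∧
      ∑ b' ∈ trees s (j + 1), peel b' b * ‖G a' b' - γ‖ ^ 2 ≤ Λ a' b) :
    stepDrift G j m ≤ 2 * (numTrees s (j + 1) / numTrees s j + numTrees s (m + 1) / numTrees s m) *
      ∑ a' ∈ trees s m, ∑ b ∈ trees s j, Λ a' b := by
  have h1 : stepDrift G j m = ∑ a' ∈ trees s m, ∑ b ∈ trees s j, ∑ a ∈ trees s (m + 1),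
      ∑ b' ∈ trees s (j + 1), peel a a' * peel b' b * ‖G a b - G a' b'‖ ^ 2 := by
    rw [stepDrift]
    have : ∀ a ∈ trees s (m + 1), ∑ b ∈ trees s j, ∑ a' ∈ trees s m, ∑ b' ∈ trees s (j + 1),
        peel a a' * peel b' b * ‖G a b - G a' b'‖ ^ 2 = ∑ a' ∈ trees s m, ∑ b ∈ trees s j,
          ∑ b' ∈ trees s (j + 1), peel a a' * peel b' b * ‖G a b - G a' b'‖ ^ 2 :=
      fun a _ => Finset.sum_comm
    rw [Finset.sum_congr rfl this, Finset.sum_comm]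
    exact Finset.sum_congr rfl fun a' _ => Finset.sum_comm
  rw [h1, Finset.mul_sum]
  refine Finset.sum_le_sum fun a' ha' => ?_
  rw [Finset.mul_sum]
  refine Finset.sum_le_sum fun b hb => ?_
  obtain ⟨γ, h2, h3⟩ := hΛ a' ha' b hb
  have h4 : ∑ a ∈ trees s (m + 1), ∑ b' ∈ trees s (j + 1),
      peel a a' * peel b' b * ‖G a b - G a' b'‖ ^ 2 ≤
      ∑ a ∈ trees s (m + 1), ∑ b' ∈ trees s (j + 1),
        (2 * (peel b' b * (peel a a' * ‖G a b - γ‖ ^ 2)) +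
          2 * (peel a a' * (peel b' b * ‖G a' b' - γ‖ ^ 2))) := by
    refine Finset.sum_le_sum fun a _ => Finset.sum_le_sum fun b' _ => ?_
    have := mul_le_mul_of_nonneg_left (sq_norm_sub_le_two (G a b) γ (G a' b'))
      (mul_nonneg (peel_nonneg a a') (peel_nonneg b' b))
    linarith
  refine h4.trans ?_
  simp_rw [Finset.sum_add_distrib, ← Finset.mul_sum, ← Finset.sum_mul, ← Finset.mul_sum]
  rw [sum_peel_left_eq hs (mem_trees.1 ha'), sum_peel_left_eq hs (mem_trees.1 hb)]
  have p1 : 0 < numTrees s (j + 1) / numTrees s j := div_pos (numTrees_pos hs _) (numTrees_pos hs _)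
  have p2 : 0 < numTrees s (m + 1) / numTrees s m := div_pos (numTrees_pos hs _) (numTrees_pos hs _)
  nlinarith [mul_le_mul_of_nonneg_left h2 p1.le, mul_le_mul_of_nonneg_left h3 p2.le]

/-- Here `P` counts trees of the total size, and the other letters count trees of the current sizes
before and after a step. The hypothesis `h` comes from `numTrees_le_mul`, and the result is the
price of replacing the law of the intermediate pair by counting measure. -/
theorem ratio_bound {σ P m m' j j' K : ℝ} (hj : 0 < j) (hj' : 0 < j') (hm : 0 < m)
    (hm' : 0 < m') (h₁ : σ * m ≤ m') (h₂ : σ * j ≤ j') (hK : 0 ≤ K) (h : P ≤ K * (σ * m * j)) :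
    P / m' * (j' / j + m' / m) ≤ j' * (2 * K) := by
  have e1 : P / m' * (j' / j + m' / m) = j' * (P / (m' * j)) + j' * (P / (j' * m)) := by
    field_simp
  have e2 : P / (m' * j) ≤ K := by
    rw [div_le_iff₀ (by positivity)]
    refine h.trans ?_
    gcongr
  have e3 : P / (j' * m) ≤ K := by
    rw [div_le_iff₀ (by positivity)]
    refine h.trans ?_
    rw [mul_right_comm]
    gcongr
  rw [e1]
  linarith [mul_le_mul_of_nonneg_left e2 hj'.le, mul_le_mul_of_nonneg_left e3 hj'.le]

theorem drift_le (hs : 1 ≤ s) (G : CTree s → CTree s → ℂ) (Λ : CTree s → CTree s → ℝ)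
    (hΛ0 : ∀ a b, 0 ≤ Λ a b) (p : ℕ)
    (hΛ : ∀ j m, j + m + 1 = p → ∀ a' ∈ trees s m, ∀ b ∈ trees s j, ∃ γ : ℂ,
      ∑ a ∈ trees s (m + 1), peel a a' * ‖G a b - γ‖ ^ 2 ≤ Λ a' b ∧
      ∑ b' ∈ trees s (j + 1), peel b' b * ‖G a' b' - γ‖ ^ 2 ≤ Λ a' b)
    (j m : ℕ) (hp : j + m = p) :
    drift G j m ≤ numTrees s j * ((j + 1) * (4 * (p + 1) ^ 3) *
      ∑ i ∈ Finset.range j, ∑ a' ∈ trees s (p - 1 - i), ∑ b ∈ trees s i, Λ a' b) := by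
  induction j generalizing m with
  | zero =>
    refine le_of_eq ?_
    simp only [Finset.range_zero, Finset.sum_empty, mul_zero]
    refine Finset.sum_eq_zero fun w _ => Finset.sum_eq_zero fun a _ =>
      Finset.sum_eq_zero fun b hb => ?_
    rw [trees_zero, Finset.mem_singleton] at hb
    subst hb
    rw [ancestor]
    split_ifs with h
    · simp [h]
    · simp
  | succ j ih =>
    -- With t = j+1 both terms acquire the factor j+2, since (1 + 1/(j+1))(j+1) = 1 + (j+1) = j+2.
    -- Hence the number of steps enters linearly, as in a Cauchy–Schwarz bound for a telescoping
    -- sum.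
    have h1 := drift_succ_le hs G j m (t := (j : ℝ) + 1) (by positivity)
    have h2 := stepDrift_le hs G Λ j m (hΛ j m (by omega))
    have h3 := ih (m + 1) (by omega)
    have e : p - 1 - j = m := by omega
    rw [Finset.sum_range_succ, e]
    set X := ∑ i ∈ Finset.range j, ∑ a' ∈ trees s (p - 1 - i), ∑ b ∈ trees s i, Λ a' b
    set Y := ∑ a' ∈ trees s m, ∑ b ∈ trees s j, Λ a' b with hY
    have hY0 : 0 ≤ Y := Finset.sum_nonneg fun a _ => Finset.sum_nonneg fun b _ => hΛ0 a b
    have pj := numTrees_pos hs j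
    have pj' := numTrees_pos hs (j + 1)
    have pm := numTrees_pos hs m
    have pm' := numTrees_pos hs (m + 1)
    have pp := numTrees_pos hs (m + j + 1)
    have hs' : (0 : ℝ) < s := by exact_mod_cast hs
    have h4 : numTrees s (m + j + 1) / numTrees s (m + 1) * stepDrift G j m ≤
        numTrees s (j + 1) * ((4 * (p + 1) ^ 3) * Y) := by
      have h5 : numTrees s (m + j + 1) ≤ (p + 1) ^ 3 * (s * numTrees s m * numTrees s j) := by
        have := numTrees_le_mul (s := s) m j
        have hp' : (p : ℝ) + 1 = m + j + 2 := by rw [← hp]; push_cast; ring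
        rwa [hp']
      have h6 := le_numTrees_succ s m
      have h7 := le_numTrees_succ s j
      have h8 := ratio_bound pj pj' pm pm' h6 h7 (by positivity : (0 : ℝ) ≤ (p + 1) ^ 3) h5
      calc numTrees s (m + j + 1) / numTrees s (m + 1) * stepDrift G j m
          ≤ numTrees s (m + j + 1) / numTrees s (m + 1) *
            (2 * (numTrees s (j + 1) / numTrees s j + numTrees s (m + 1) / numTrees s m) * Y) := by
            gcongr
        _ = 2 * Y * (numTrees s (m + j + 1) / numTrees s (m + 1) *
          (numTrees s (j + 1) / numTrees s j + numTrees s (m + 1) / numTrees s m)) := by ring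
        _ ≤ 2 * Y * (numTrees s (j + 1) * (2 * (p + 1) ^ 3)) := by gcongr
        _ = _ := by ring
    have h9 : numTrees s (j + 1) / numTrees s j * drift G j (m + 1) ≤
        numTrees s (j + 1) * ((j + 1) * (4 * (p + 1) ^ 3) * X) := by
      rw [div_mul_eq_mul_div, div_le_iff₀ pj, mul_assoc]
      refine mul_le_mul_of_nonneg_left ?_ pj'.le
      linarith
    calc drift G (j + 1) m ≤ _ := h1
      _ ≤ (1 + 1 / ((j : ℝ) + 1)) * (numTrees s (j + 1) * ((j + 1) * (4 * (p + 1) ^ 3) * X)) +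
          (1 + ((j : ℝ) + 1)) * (numTrees s (j + 1) * ((4 * (p + 1) ^ 3) * Y)) := by gcongr
      _ = _ := by
        push_cast
        field_simp
        ring

/-- The mean square difference of `G w nil` and `G nil w'` for independent random trees is
controlled by the effect of moving a single peak from the first to the second tree. -/
theorem transport (hs : 1 ≤ s) (G : CTree s → CTree s → ℂ) (Λ : CTree s → CTree s → ℝ)
    (hΛ0 : ∀ a b, 0 ≤ Λ a b) (p : ℕ)
    (hΛ : ∀ j m, j + m + 1 = p → ∀ a' ∈ trees s m, ∀ b ∈ trees s j, ∃ γ : ℂ,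
      ∑ a ∈ trees s (m + 1), peel a a' * ‖G a b - γ‖ ^ 2 ≤ Λ a' b ∧
      ∑ b' ∈ trees s (j + 1), peel b' b * ‖G a' b' - γ‖ ^ 2 ≤ Λ a' b) :
    ∑ w ∈ trees s p, ∑ w' ∈ trees s p, ‖G w nil - G nil w'‖ ^ 2 ≤
      numTrees s p * (4 * (p + 1) ^ 4 *
        ∑ i ∈ Finset.range p, ∑ a' ∈ trees s (p - 1 - i), ∑ b ∈ trees s i, Λ a' b) := by
  have h1 := drift_le hs G Λ hΛ0 p hΛ p 0 (by omega)
  have h2 : drift G p 0 = ∑ w ∈ trees s p, ∑ w' ∈ trees s p, ‖G w nil - G nil w'‖ ^ 2 := by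
    rw [drift, zero_add, trees_zero]
    refine Finset.sum_congr rfl fun w hw => ?_
    -- After p removals only the empty tree is left, so the remaining weight is 1 for every w.
    have h3 := sum_ancestor_right p (m := 0) (w := w) (by rw [mem_trees.1 hw, zero_add])
    rw [trees_zero, Finset.sum_singleton] at h3
    simp [h3]
  rw [← h2]
  refine h1.trans (le_of_eq ?_)
  ring

end Fredkin

namespace Fredkin

open CTree

variable {s : ℕ}

/-! ### Moving a single peak through a word -/

/-- Insertion of a peak of color `k` at position `i`. -/
def insertPeak (i : ℕ) (k : Fin s) (l : List (Spin s)) : List (Spin s) :=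
  l.take i ++ up k :: dn k :: l.drop i

/-- The energy of the moves of a single peak inserted into `l`. -/
noncomputable def localEnergy (F : List (Spin s) → ℂ) (M : ℕ) (l : List (Spin s)) : ℝ :=
  ∑ i ∈ Finset.range M, ∑ k : Fin s,
      ‖F (insertPeak (i + 1) k l) - F (insertPeak i k l)‖ ^ 2 +
    ∑ k₁ : Fin s, ∑ k₂ : Fin s, ‖F (insertPeak 0 k₁ l) - F (insertPeak 0 k₂ l)‖ ^ 2

/-- Moving the inserted peak past the letter at position i is a U-move or a D-move according to the
direction of that letter, and recoloring it in front is a φ-move. Every such move occurs once in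
`bulkEnergy`; the factor 2 compensates the normalization 1/2 there. -/
theorem sum_localEnergy_le {M : ℕ} (hM : 1 ≤ M) (F : List (Spin s) → ℂ) :
    ∑ l ∈ words s M, localEnergy F M l ≤ 2 * energy s (M + 2) F := by
  have h1 : ∀ i : Fin M, ∑ l ∈ words s M, ∑ k : Fin s,
      ‖F (insertPeak (i + 1) k l) - F (insertPeak i k l)‖ ^ 2 =
      ∑ k₁ : Fin s, ∑ k₂ : Fin s, (∑ x ∈ words s i, ∑ y ∈ words s (M - 1 - i),
        ‖F (x ++ [up k₁, up k₂, dn k₂] ++ y) - F (x ++ [up k₂, dn k₂, up k₁] ++ y)‖ ^ 2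
      + ∑ x ∈ words s i, ∑ y ∈ words s (M - 1 - i),
        ‖F (x ++ [dn k₁, up k₂, dn k₂] ++ y) - F (x ++ [up k₂, dn k₂, dn k₁] ++ y)‖ ^ 2) := by
    intro i
    have hi := i.2
    rw [sum_words_split (i := i) (m := 1) (r := M - 1 - i) _ (by omega)]
    simp_rw [sum_words_one]
    have e : ∀ x ∈ words s i, ∀ (c : Spin s) (y : List (Spin s)) (k : Fin s),
        insertPeak (i + 1) k (x ++ [c] ++ y) = x ++ [c, up k, dn k] ++ y ∧
        insertPeak i k (x ++ [c] ++ y) = x ++ [up k, dn k, c] ++ y := by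
      intro x hx c y k
      rw [mem_words] at hx
      constructor
      · rw [insertPeak, List.take_left' (by simp [hx]), List.drop_left' (by simp [hx])]
        simp
      · rw [insertPeak, List.append_assoc, List.take_left' hx, List.drop_left' hx]
        simp
    have e' : ∀ x ∈ words s i, ∑ k₁ : Fin s,
        (∑ y ∈ words s (M - 1 - i), ∑ k : Fin s,
          ‖F (insertPeak (i + 1) k (x ++ [up k₁] ++ y)) - F (insertPeak i k (x ++ [up k₁] ++ y))‖ ^ 2
        + ∑ y ∈ words s (M - 1 - i), ∑ k : Fin s,
          ‖F (insertPeak (i + 1) k (x ++ [dn k₁] ++ y)) -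
            F (insertPeak i k (x ++ [dn k₁] ++ y))‖ ^ 2) =
        ∑ k₁ : Fin s, ∑ k₂ : Fin s, (∑ y ∈ words s (M - 1 - i),
          ‖F (x ++ [up k₁, up k₂, dn k₂] ++ y) - F (x ++ [up k₂, dn k₂, up k₁] ++ y)‖ ^ 2
        + ∑ y ∈ words s (M - 1 - i),
          ‖F (x ++ [dn k₁, up k₂, dn k₂] ++ y) - F (x ++ [up k₂, dn k₂, dn k₁] ++ y)‖ ^ 2) := by
      intro x hx
      refine Finset.sum_congr rfl fun k₁ _ => ?_
      rw [Finset.sum_add_distrib]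
      congr 1
      · rw [Finset.sum_comm]
        refine Finset.sum_congr rfl fun k₂ _ => Finset.sum_congr rfl fun y _ => ?_
        rw [(e x hx _ y k₂).1, (e x hx _ y k₂).2]
      · rw [Finset.sum_comm]
        refine Finset.sum_congr rfl fun k₂ _ => Finset.sum_congr rfl fun y _ => ?_
        rw [(e x hx _ y k₂).1, (e x hx _ y k₂).2]
    rw [Finset.sum_congr rfl e', Finset.sum_comm]
    refine Finset.sum_congr rfl fun k₁ _ => ?_
    rw [Finset.sum_comm]
    refine Finset.sum_congr rfl fun k₂ _ => ?_
    rw [Finset.sum_add_distrib]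
  have h2 : ∑ l ∈ words s M, ∑ k₁ : Fin s, ∑ k₂ : Fin s,
      ‖F (insertPeak 0 k₁ l) - F (insertPeak 0 k₂ l)‖ ^ 2 =
      ∑ k₁ : Fin s, ∑ k₂ : Fin s, ∑ x ∈ words s 0, ∑ y ∈ words s M,
        ‖F (x ++ [up k₁, dn k₁] ++ y) - F (x ++ [up k₂, dn k₂] ++ y)‖ ^ 2 := by
    rw [Finset.sum_comm]
    refine Finset.sum_congr rfl fun k₁ _ => ?_
    rw [Finset.sum_comm]
    refine Finset.sum_congr rfl fun k₂ _ => ?_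
    rw [words_zero, Finset.sum_singleton]
    rfl
  -- Recoloring is needed at a single position only, as a peak can be carried to the front,
  -- recolored, and carried back.
  have h3 : ∑ k₁ : Fin s, ∑ k₂ : Fin s, ∑ x ∈ words s 0, ∑ y ∈ words s M,
        ‖F (x ++ [up k₁, dn k₁] ++ y) - F (x ++ [up k₂, dn k₂] ++ y)‖ ^ 2 ≤
      ∑ j : Fin M, ∑ k₁ : Fin s, ∑ k₂ : Fin s, ∑ x ∈ words s j, ∑ y ∈ words s (M - j),
        ‖F (x ++ [up k₁, dn k₁] ++ y) - F (x ++ [up k₂, dn k₂] ++ y)‖ ^ 2 := by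
    have := Finset.single_le_sum (s := Finset.univ) (f := fun j : Fin M =>
      ∑ k₁ : Fin s, ∑ k₂ : Fin s, ∑ x ∈ words s j, ∑ y ∈ words s (M - j),
        ‖F (x ++ [up k₁, dn k₁] ++ y) - F (x ++ [up k₂, dn k₂] ++ y)‖ ^ 2)
      (fun j _ => by positivity) (Finset.mem_univ (⟨0, hM⟩ : Fin M))
    simpa only [Nat.sub_zero] using this
  have h4 : bulkEnergy s (M + 2) F ≤ energy s (M + 2) F := by
    have := crossEnergy_nonneg s (M + 2) F
    have := boundaryEnergy_nonneg s (M + 2) F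
    rw [energy]
    linarith
  have h5 : 2 * bulkEnergy s (M + 2) F = ∑ j : Fin M, ∑ k₁ : Fin s, ∑ k₂ : Fin s,
      (∑ x ∈ words s j, ∑ y ∈ words s (M - 1 - j),
        ‖F (x ++ [up k₁, up k₂, dn k₂] ++ y) - F (x ++ [up k₂, dn k₂, up k₁] ++ y)‖ ^ 2
      + ∑ x ∈ words s j, ∑ y ∈ words s (M - 1 - j),
        ‖F (x ++ [dn k₁, up k₂, dn k₂] ++ y) - F (x ++ [up k₂, dn k₂, dn k₁] ++ y)‖ ^ 2) +
      ∑ j : Fin M, ∑ k₁ : Fin s, ∑ k₂ : Fin s, ∑ x ∈ words s j, ∑ y ∈ words s (M - j),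
        ‖F (x ++ [up k₁, dn k₁] ++ y) - F (x ++ [up k₂, dn k₂] ++ y)‖ ^ 2 := by
    rw [bulkEnergy, Finset.mul_sum, ← Finset.sum_add_distrib]
    refine Finset.sum_congr rfl fun j _ => ?_
    rw [Finset.mul_sum, ← Finset.sum_add_distrib]
    refine Finset.sum_congr rfl fun k₁ _ => ?_
    rw [Finset.mul_sum, ← Finset.sum_add_distrib]
    refine Finset.sum_congr rfl fun k₂ _ => ?_
    rw [show M + 2 - 3 - (j : ℕ) = M - 1 - j by omega, show M + 2 - 2 - (j : ℕ) = M - j by omega]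
    ring
  have h6 : ∑ l ∈ words s M, localEnergy F M l = ∑ j : Fin M, ∑ l ∈ words s M, ∑ k : Fin s,
      ‖F (insertPeak (j + 1) k l) - F (insertPeak j k l)‖ ^ 2 +
      ∑ l ∈ words s M, ∑ k₁ : Fin s, ∑ k₂ : Fin s,
      ‖F (insertPeak 0 k₁ l) - F (insertPeak 0 k₂ l)‖ ^ 2 := by
    simp only [localEnergy]
    rw [Finset.sum_add_distrib, Finset.sum_comm, Finset.sum_range]
  rw [h6, h2, Finset.sum_congr rfl fun i _ => h1 i]
  linarith

/-! ### Fluctuation of the amplitude under insertion of a peak -/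

theorem sq_norm_sum_le {ι : Type*} (T : Finset ι) (f : ι → ℂ) :
    ‖∑ i ∈ T, f i‖ ^ 2 ≤ T.card * ∑ i ∈ T, ‖f i‖ ^ 2 := by
  calc ‖∑ i ∈ T, f i‖ ^ 2 ≤ (∑ i ∈ T, ‖f i‖) ^ 2 :=
        pow_le_pow_left₀ (norm_nonneg _) (norm_sum_le _ _) 2
    _ ≤ _ := sq_sum_le_card_mul_sum_sq

theorem sq_norm_sub_mean_le {ι : Type*} (T : Finset ι) (hT : 0 < T.card) (f : ι → ℂ) (z : ℂ) :
    ‖z - (T.card : ℂ)⁻¹ * ∑ i ∈ T, f i‖ ^ 2 ≤ (T.card : ℝ)⁻¹ * ∑ i ∈ T, ‖z - f i‖ ^ 2 := by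
  have h0 : (T.card : ℂ) ≠ 0 := by exact_mod_cast hT.ne'
  have h0' : (T.card : ℝ) ≠ 0 := by exact_mod_cast hT.ne'
  have h1 : z - (T.card : ℂ)⁻¹ * ∑ i ∈ T, f i = (T.card : ℂ)⁻¹ * ∑ i ∈ T, (z - f i) := by
    rw [Finset.sum_sub_distrib, Finset.sum_const, nsmul_eq_mul]
    field_simp
  rw [h1, norm_mul, mul_pow, norm_inv, Complex.norm_natCast]
  calc ((T.card : ℝ)⁻¹) ^ 2 * ‖∑ i ∈ T, (z - f i)‖ ^ 2
      ≤ ((T.card : ℝ)⁻¹) ^ 2 * (T.card * ∑ i ∈ T, ‖z - f i‖ ^ 2) := by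
        gcongr; exact sq_norm_sum_le _ _
    _ = _ := by field_simp

/-- The mean amplitude of the words with a peak in front of `l`. -/
noncomputable def frontMean (F : List (Spin s) → ℂ) (l : List (Spin s)) : ℂ :=
  (s : ℂ)⁻¹ * ∑ k : Fin s, F (insertPeak 0 k l)

/-- The spread of the amplitudes of the words obtained from `l` by insertion of a peak. -/
noncomputable def spread (F : List (Spin s) → ℂ) (M : ℕ) (l : List (Spin s)) : ℝ :=
  ∑ i ∈ Finset.range (M + 1), ∑ k : Fin s, ‖F (insertPeak i k l) - frontMean F l‖ ^ 2

theorem spread_nonneg (F : List (Spin s) → ℂ) (M : ℕ) (l : List (Spin s)) :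
    0 ≤ spread F M l := by
  unfold spread; positivity

/-- The peak is moved to the front by at most M steps, with Cauchy–Schwarz for the telescoping sum,
and there its amplitude is compared with the mean over colors. The factor 1/s from this mean is
bounded by 1, so the constant does not depend on s. -/
theorem spread_le (hs : 1 ≤ s) (F : List (Spin s) → ℂ) (M : ℕ) (l : List (Spin s)) :
    spread F M l ≤ 2 * (M + 1) ^ 2 * localEnergy F M l := by
  set A := ∑ i ∈ Finset.range M, ∑ k : Fin s,
      ‖F (insertPeak (i + 1) k l) - F (insertPeak i k l)‖ ^ 2 with hA
  set B := ∑ k₁ : Fin s, ∑ k₂ : Fin s, ‖F (insertPeak 0 k₁ l) - F (insertPeak 0 k₂ l)‖ ^ 2 with hB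
  have hA0 : 0 ≤ A := by positivity
  have hB0 : 0 ≤ B := by positivity
  have h1 : ∀ i ∈ Finset.range (M + 1), ∑ k : Fin s,
      ‖F (insertPeak i k l) - F (insertPeak 0 k l)‖ ^ 2 ≤ M * A := by
    intro i hi
    have hi' : i ≤ M := by simpa [Nat.lt_succ_iff] using hi
    rw [hA, Finset.sum_comm, Finset.mul_sum]
    refine Finset.sum_le_sum fun k _ => ?_
    rw [← Finset.sum_range_sub (fun i => F (insertPeak i k l)) i]
    refine (sq_norm_sum_le _ _).trans ?_
    rw [Finset.card_range]
    have hsub : Finset.range i ⊆ Finset.range M := Finset.range_mono hi'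
    have := Finset.sum_le_sum_of_subset_of_nonneg hsub
      (f := fun j => ‖F (insertPeak (j + 1) k l) - F (insertPeak j k l)‖ ^ 2)
      fun j _ _ => by positivity
    gcongr
  have h2 : ∑ k : Fin s, ‖F (insertPeak 0 k l) - frontMean F l‖ ^ 2 ≤ B := by
    rw [hB]
    refine Finset.sum_le_sum fun k _ => ?_
    have h3 := sq_norm_sub_mean_le (Finset.univ : Finset (Fin s)) (by simpa using Nat.lt_of_succ_le hs)
      (fun k => F (insertPeak 0 k l)) (F (insertPeak 0 k l))
    simp only [Finset.card_univ, Fintype.card_fin] at h3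
    refine h3.trans (mul_le_of_le_one_left (by positivity) (inv_le_one_of_one_le₀ ?_))
    exact_mod_cast hs
  have h4 : ∀ i ∈ Finset.range (M + 1), ∑ k : Fin s,
      ‖F (insertPeak i k l) - frontMean F l‖ ^ 2 ≤ 2 * (M * A) + 2 * B := by
    intro i hi
    calc ∑ k : Fin s, ‖F (insertPeak i k l) - frontMean F l‖ ^ 2
        ≤ ∑ k : Fin s, (2 * ‖F (insertPeak i k l) - F (insertPeak 0 k l)‖ ^ 2 +
          2 * ‖F (insertPeak 0 k l) - frontMean F l‖ ^ 2) := by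
          refine Finset.sum_le_sum fun k _ => ?_
          have := sq_norm_sub_le_two (F (insertPeak i k l)) (F (insertPeak 0 k l)) (frontMean F l)
          rwa [norm_sub_rev (frontMean F l)] at this
      _ ≤ _ := by
          rw [Finset.sum_add_distrib, ← Finset.mul_sum, ← Finset.mul_sum]
          linarith [h1 i hi]
  have h5 := Finset.sum_le_card_nsmul _ _ _ h4
  rw [Finset.card_range, nsmul_eq_mul] at h5
  refine h5.trans ?_
  rw [localEnergy, ← hA, ← hB]
  push_cast
  have hM : (0 : ℝ) ≤ M := by positivity
  nlinarith [mul_nonneg hM hB0, mul_nonneg hM hA0, mul_nonneg hM (mul_nonneg hM hB0)]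

theorem sum_spread_le (hs : 1 ≤ s) {M : ℕ} (hM : 1 ≤ M) (F : List (Spin s) → ℂ) :
    ∑ l ∈ words s M, spread F M l ≤ 4 * (M + 1) ^ 2 * energy s (M + 2) F := by
  calc ∑ l ∈ words s M, spread F M l ≤ ∑ l ∈ words s M, 2 * (M + 1) ^ 2 * localEnergy F M l :=
        Finset.sum_le_sum fun l _ => spread_le hs F M l
    _ = 2 * (M + 1) ^ 2 * ∑ l ∈ words s M, localEnergy F M l := by rw [Finset.mul_sum]
    _ ≤ 2 * (M + 1) ^ 2 * (2 * energy s (M + 2) F) := by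
        gcongr; exact sum_localEnergy_le hM F
    _ = _ := by ring

/-! ### Moving all peaks of a Dyck word within a larger word -/

/-- The weights are at most 1, and each tree of positive weight is obtained by inserting a peak at
some position. Different trees give different words, so they can be counted by positions and colors.
-/
theorem sum_peel_le {m : ℕ} {a' : CTree s} (ha' : a'.size = m) (pre post : List (Spin s))
    {M : ℕ} (hM : (pre ++ a'.word ++ post).length = M) (g : List (Spin s) → ℝ)
    (hg : ∀ l, 0 ≤ g l) :
    ∑ a ∈ trees s (m + 1), peel a a' * g (pre ++ a.word ++ post) ≤
      ∑ i ∈ Finset.range (M + 1), ∑ k : Fin s, g (insertPeak i k (pre ++ a'.word ++ post)) := by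
  classical
  rw [← Finset.sum_product']
  have h1 : ∑ a ∈ trees s (m + 1), peel a a' * g (pre ++ a.word ++ post) ≤
      ∑ a ∈ trees s (m + 1) with peel a a' ≠ 0, g (pre ++ a.word ++ post) := by
    rw [Finset.sum_filter]
    refine Finset.sum_le_sum fun a ha => ?_
    split_ifs with h
    · exact mul_le_of_le_one_left (hg _) (peel_le_one (mem_trees.1 ha) ha')
    · rw [not_not.1 h, zero_mul]
  refine h1.trans ?_
  rw [← Finset.sum_image (s := (trees s (m + 1)).filter fun a => peel a a' ≠ 0)
    (g := fun a : CTree s => pre ++ a.word ++ post) (f := g)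
    (fun a _ b _ hab => word_injective (by simpa using hab))]
  refine sum_le_sum_comp (fun t : ℕ × Fin s => insertPeak t.1 t.2 (pre ++ a'.word ++ post)) g hg ?_
  intro l hl
  obtain ⟨a, ha, rfl⟩ := Finset.mem_image.1 hl
  obtain ⟨k, l₁, l₂, e1, e2⟩ := exists_peak_of_peel_ne_zero a a' (Finset.mem_filter.1 ha).2
  refine ⟨((pre ++ l₁).length, k), ?_, ?_⟩
  · rw [Finset.mem_product, Finset.mem_range]
    refine ⟨?_, Finset.mem_univ _⟩
    rw [e2] at hM
    simp only [List.length_append] at hM ⊢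
    omega
  · simp only [insertPeak]
    rw [e1, e2, show pre ++ (l₁ ++ l₂) ++ post = (pre ++ l₁) ++ (l₂ ++ post) by simp,
      List.take_left' rfl, List.drop_left' rfl]
    simp

/-- `transport` for G a b = F(x a c b y). The center γ is `frontMean` of the word with one peak
missing, which is the same whether the peak was removed from the left or from the right tree. -/
theorem context_transport (hs : 1 ≤ s) (F : List (Spin s) → ℂ) (x c y : List (Spin s)) {p M : ℕ}
    (hM : M + 2 = x.length + 2 * p + c.length + y.length) :
    ∑ w ∈ trees s p, ∑ w' ∈ trees s p,
      ‖F (x ++ w.word ++ c ++ y) - F (x ++ c ++ w'.word ++ y)‖ ^ 2 ≤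
      numTrees s p * (4 * (p + 1) ^ 4 * ∑ i ∈ Finset.range p, ∑ a ∈ trees s (p - 1 - i),
        ∑ b ∈ trees s i, spread F M (x ++ a.word ++ c ++ b.word ++ y)) := by
  have h := transport hs (fun a b => F (x ++ a.word ++ c ++ b.word ++ y))
    (fun a b => spread F M (x ++ a.word ++ c ++ b.word ++ y)) (fun a b => spread_nonneg _ _ _) p ?_
  · simpa [word] using h
  · intro j m hjm a' ha' b hb
    rw [mem_trees] at ha' hb
    refine ⟨frontMean F (x ++ a'.word ++ c ++ b.word ++ y), ?_, ?_⟩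
    · have := sum_peel_le ha' x (c ++ b.word ++ y) (M := M)
        (by simp only [List.length_append, length_word]; omega)
        (fun l => ‖F l - frontMean F (x ++ a'.word ++ c ++ b.word ++ y)‖ ^ 2)
        (fun l => by positivity)
      simpa only [List.append_assoc, spread] using this
    · have := sum_peel_le hb (x ++ a'.word ++ c) y (M := M)
        (by simp only [List.length_append, length_word]; omega)
        (fun l => ‖F l - frontMean F (x ++ a'.word ++ c ++ b.word ++ y)‖ ^ 2)
        (fun l => by positivity)
      simpa only [List.append_assoc, spread] using this

/-- Summation of the transport estimate over a family of surroundings of fixed lengths. -/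
theorem sum_context_transport (hs : 1 ≤ s) (F : List (Spin s) → ℂ) {ι : Type*} (I : Finset ι)
    (x c y : ι → List (Spin s)) {p M lx lc ly : ℕ} (hM1 : 1 ≤ M)
    (hx : ∀ i ∈ I, (x i).length = lx) (hc : ∀ i ∈ I, (c i).length = lc)
    (hy : ∀ i ∈ I, (y i).length = ly) (hM : M + 2 = lx + 2 * p + lc + ly)
    (hinj : ∀ i ∈ I, ∀ j ∈ I, x i = x j → c i = c j → y i = y j → i = j) :
    ∑ i ∈ I, ∑ w ∈ trees s p, ∑ w' ∈ trees s p,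
      ‖F (x i ++ w.word ++ c i ++ y i) - F (x i ++ c i ++ w'.word ++ y i)‖ ^ 2 ≤
      numTrees s p * (16 * (p + 1) ^ 4 * p * (M + 1) ^ 2 * energy s (M + 2) F) := by
  -- For a fixed number j of transferred peaks all segments have fixed lengths, so the word
  -- determines the surroundings and both trees. The spreads are therefore summed over distinct
  -- words, without multiplicity.
  have h1 : ∀ j ∈ Finset.range p, ∑ i ∈ I, ∑ a ∈ trees s (p - 1 - j), ∑ b ∈ trees s j,
      spread F M (x i ++ a.word ++ c i ++ b.word ++ y i) ≤
      4 * (M + 1) ^ 2 * energy s (M + 2) F := by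
    intro j hj
    have hj' := Finset.mem_range.1 hj
    refine le_trans ?_ (sum_spread_le hs hM1 F)
    simp_rw [← Finset.sum_product']
    refine sum_comp_le_sum (fun t : ι × CTree s × CTree s =>
      x t.1 ++ t.2.1.word ++ c t.1 ++ t.2.2.word ++ y t.1) (spread F M)
      (fun l => spread_nonneg F M l) ?_ ?_
    · rintro ⟨i, a, b⟩ ht
      simp only [Finset.mem_product, mem_trees] at ht
      simp only [mem_words, List.length_append, length_word, ht.2.1, ht.2.2, hx i ht.1, hc i ht.1,
        hy i ht.1]
      omega
    · rintro ⟨i, a, b⟩ ht ⟨i', a', b'⟩ ht' heq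
      simp only [Finset.coe_product, Set.mem_prod, Finset.mem_coe, mem_trees] at ht ht'
      simp only [List.append_assoc] at heq
      obtain ⟨e1, heq⟩ := List.append_inj heq (by rw [hx i ht.1, hx i' ht'.1])
      obtain ⟨e2, heq⟩ := List.append_inj heq
        (by rw [length_word, length_word, ht.2.1, ht'.2.1])
      obtain ⟨e3, heq⟩ := List.append_inj heq (by rw [hc i ht.1, hc i' ht'.1])
      obtain ⟨e4, e5⟩ := List.append_inj heq
        (by rw [length_word, length_word, ht.2.2, ht'.2.2])
      rw [hinj i ht.1 i' ht'.1 e1 e3 e5, word_injective e2, word_injective e4]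
  calc _ ≤ ∑ i ∈ I, numTrees s p * (4 * (p + 1) ^ 4 * ∑ j ∈ Finset.range p,
        ∑ a ∈ trees s (p - 1 - j), ∑ b ∈ trees s j,
          spread F M (x i ++ a.word ++ c i ++ b.word ++ y i)) :=
        Finset.sum_le_sum fun i hi => context_transport hs F _ _ _
          (by rw [hx i hi, hc i hi, hy i hi, hM])
    _ = numTrees s p * (4 * (p + 1) ^ 4 * ∑ j ∈ Finset.range p, ∑ i ∈ I,
        ∑ a ∈ trees s (p - 1 - j), ∑ b ∈ trees s j,
          spread F M (x i ++ a.word ++ c i ++ b.word ++ y i)) := by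
        rw [← Finset.mul_sum, ← Finset.mul_sum, Finset.sum_comm]
    _ ≤ numTrees s p * (4 * (p + 1) ^ 4 * (p * (4 * (M + 1) ^ 2 * energy s (M + 2) F))) := by
        have h2 := Finset.sum_le_card_nsmul _ _ _ h1
        rw [Finset.card_range, nsmul_eq_mul] at h2
        have := (numTrees_pos hs p).le
        gcongr
    _ = _ := by ring

end Fredkin

namespace Fredkin

open CTree

variable {s : ℕ}

/-! ### Spectral inequalities -/

theorem transport_constant_le {p n M : ℕ} (hp : p ≤ n) (hn : 1 ≤ n) (hM : M + 2 = 2 * n) :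
    (16 : ℝ) * (p + 1) ^ 4 * p * (M + 1) ^ 2 ≤ 1024 * n ^ 7 := by
  have h1 : (p : ℝ) ≤ n := by exact_mod_cast hp
  have h2 : (1 : ℝ) ≤ n := by exact_mod_cast hn
  have h3 : (M : ℝ) + 2 = 2 * n := by exact_mod_cast hM
  have h4 : (p : ℝ) + 1 ≤ 2 * n := by linarith
  have h5 : (M : ℝ) + 1 ≤ 2 * n := by linarith
  calc (16 : ℝ) * (p + 1) ^ 4 * p * (M + 1) ^ 2 ≤ 16 * (2 * n) ^ 4 * n * (2 * n) ^ 2 := by gcongr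
    _ = 1024 * (n : ℝ) ^ 7 := by ring

/-- The Poincaré inequality on the balanced subspace. -/
theorem balanced_poincare (hs : 1 ≤ s) {n : ℕ} (hn : 2 ≤ n) (F : List (Spin s) → ℂ)
    (hF : ∑ w ∈ trees s n, F w.word = 0) :
    ∑ w ∈ trees s n, ‖F w.word‖ ^ 2 ≤ 1024 * n ^ 7 * energy s (2 * n) F := by
  obtain ⟨M, hM⟩ : ∃ M, M + 2 = 2 * n := ⟨2 * n - 2, by omega⟩
  have hS := numTrees_pos hs n
  have h1 := sum_context_transport hs F (Finset.univ : Finset Unit) (fun _ => []) (fun _ => [])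
    (fun _ => []) (p := n) (M := M) (lx := 0) (lc := 0) (ly := 0) (by omega) (by simp) (by simp)
    (by simp) (by omega) (by simp)
  simp only [Finset.univ_unique, Finset.sum_singleton, List.nil_append, List.append_nil] at h1
  -- Because the amplitudes have mean zero, |F w|^2 is at most the average over w' of |F w - F
  -- w'|^2.
  have h2 : numTrees s n * ∑ w ∈ trees s n, ‖F w.word‖ ^ 2 ≤
      ∑ w ∈ trees s n, ∑ w' ∈ trees s n, ‖F w.word - F w'.word‖ ^ 2 := by
    rw [Finset.mul_sum]
    refine Finset.sum_le_sum fun w _ => ?_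
    have h3 := sq_norm_sub_mean_le (trees s n) (by rw [numTrees] at hS; exact_mod_cast hS)
      (fun w => F w.word) (F w.word)
    rw [hF, mul_zero, sub_zero] at h3
    change _ ≤ (numTrees s n)⁻¹ * _ at h3
    rwa [inv_mul_eq_div, le_div_iff₀ hS, mul_comm] at h3
  have h4 := le_of_mul_le_mul_left (h2.trans h1) hS
  refine h4.trans ?_
  rw [hM]
  exact mul_le_mul_of_nonneg_right (transport_constant_le le_rfl (by omega) hM)
    (energy_nonneg _ _ _)

theorem card_mul_sum_sq_norm_le {ι κ : Type*} (T : Finset ι) (T' : Finset κ) (u : ι → ℂ)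
    (v : κ → ℂ) : (T'.card : ℝ) * ∑ w ∈ T, ‖u w‖ ^ 2 ≤
      2 * ∑ w ∈ T, ∑ w' ∈ T', ‖u w - v w'‖ ^ 2 + 2 * (T.card * ∑ w' ∈ T', ‖v w'‖ ^ 2) := by
  have h : ∀ w ∈ T, ∀ w' ∈ T', ‖u w‖ ^ 2 ≤ 2 * ‖u w - v w'‖ ^ 2 + 2 * ‖v w'‖ ^ 2 := by
    intro w _ w' _
    have := sq_norm_sub_le_two (u w) (v w') 0
    simpa using this
  calc (T'.card : ℝ) * ∑ w ∈ T, ‖u w‖ ^ 2 = ∑ w ∈ T, ∑ w' ∈ T', ‖u w‖ ^ 2 := by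
        rw [Finset.mul_sum]
        exact Finset.sum_congr rfl fun w _ => by rw [Finset.sum_const, nsmul_eq_mul]
    _ ≤ ∑ w ∈ T, ∑ w' ∈ T', (2 * ‖u w - v w'‖ ^ 2 + 2 * ‖v w'‖ ^ 2) :=
        Finset.sum_le_sum fun w hw => Finset.sum_le_sum fun w' hw' => h w hw w' hw'
    _ = _ := by
        simp_rw [Finset.sum_add_distrib, ← Finset.mul_sum]
        rw [Finset.sum_const, nsmul_eq_mul]

theorem sum_context_transport_le (hs : 1 ≤ s) {n : ℕ} (hn : 2 ≤ n) (F : List (Spin s) → ℂ)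
    {ι : Type*} (I : Finset ι) (x c y : ι → List (Spin s)) {p lx lc ly : ℕ}
    (hx : ∀ i ∈ I, (x i).length = lx) (hc : ∀ i ∈ I, (c i).length = lc)
    (hy : ∀ i ∈ I, (y i).length = ly) (hM : 2 * n = lx + 2 * p + lc + ly)
    (hinj : ∀ i ∈ I, ∀ j ∈ I, x i = x j → c i = c j → y i = y j → i = j) :
    ∑ i ∈ I, ∑ w ∈ trees s p, ∑ w' ∈ trees s p,
      ‖F (x i ++ w.word ++ c i ++ y i) - F (x i ++ c i ++ w'.word ++ y i)‖ ^ 2 ≤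
      numTrees s p * (1024 * n ^ 7 * energy s (2 * n) F) := by
  obtain ⟨M, hM'⟩ : ∃ M, M + 2 = 2 * n := ⟨2 * n - 2, by omega⟩
  refine (sum_context_transport hs F I x c y (p := p) (M := M) (by omega) hx hc hy (by omega)
    hinj).trans ?_
  rw [hM']
  exact mul_le_mul_of_nonneg_left (mul_le_mul_of_nonneg_right
    (transport_constant_le (by omega) (by omega) hM') (energy_nonneg _ _ _))
    (numTrees_pos hs p).le

/-- Used with `c` a down step whose Dyck word `w` separates it from the place where it is penalized.
Moving `w` behind `c` changes the amplitudes by an amount controlled by the energy, and the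
remaining sum consists of penalized words. The constant is twice that of `sum_context_transport_le`,
from |u|^2 ≤ 2|u-v|^2 + 2|v|^2. -/
theorem sum_escape_right (hs : 1 ≤ s) {n : ℕ} (hn : 2 ≤ n) (F : List (Spin s) → ℂ)
    {ι : Type*} (I : Finset ι) (x c y : ι → List (Spin s)) {p lx lc ly : ℕ}
    (hx : ∀ i ∈ I, (x i).length = lx) (hc : ∀ i ∈ I, (c i).length = lc)
    (hy : ∀ i ∈ I, (y i).length = ly) (hM : 2 * n = lx + 2 * p + lc + ly)
    (hinj : ∀ i ∈ I, ∀ j ∈ I, x i = x j → c i = c j → y i = y j → i = j) :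
    ∑ i ∈ I, ∑ w ∈ trees s p, ‖F (x i ++ w.word ++ c i ++ y i)‖ ^ 2 ≤
    2048 * n ^ 7 * energy s (2 * n) F +
      2 * ∑ i ∈ I, ∑ w ∈ trees s p, ‖F (x i ++ c i ++ w.word ++ y i)‖ ^ 2 := by
  have hS := numTrees_pos hs p
  have h1 := sum_context_transport_le hs hn F I x c y hx hc hy hM hinj
  have h2 := Finset.sum_le_sum fun i (_ : i ∈ I) => card_mul_sum_sq_norm_le (trees s p) (trees s p)
    (fun w => F (x i ++ w.word ++ c i ++ y i)) (fun w => F (x i ++ c i ++ w.word ++ y i))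
  simp_rw [Finset.sum_add_distrib, ← Finset.mul_sum] at h2
  change numTrees s p * _ ≤ _ + 2 * (numTrees s p * _) at h2
  refine le_of_mul_le_mul_left ?_ hS
  linarith

theorem sum_escape_left (hs : 1 ≤ s) {n : ℕ} (hn : 2 ≤ n) (F : List (Spin s) → ℂ)
    {ι : Type*} (I : Finset ι) (x c y : ι → List (Spin s)) {p lx lc ly : ℕ}
    (hx : ∀ i ∈ I, (x i).length = lx) (hc : ∀ i ∈ I, (c i).length = lc)
    (hy : ∀ i ∈ I, (y i).length = ly) (hM : 2 * n = lx + 2 * p + lc + ly)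
    (hinj : ∀ i ∈ I, ∀ j ∈ I, x i = x j → c i = c j → y i = y j → i = j) :
    ∑ i ∈ I, ∑ w ∈ trees s p, ‖F (x i ++ c i ++ w.word ++ y i)‖ ^ 2 ≤
    2048 * n ^ 7 * energy s (2 * n) F +
      2 * ∑ i ∈ I, ∑ w ∈ trees s p, ‖F (x i ++ w.word ++ c i ++ y i)‖ ^ 2 := by
  have hS := numTrees_pos hs p
  have h1 := sum_context_transport_le hs hn F I x c y hx hc hy hM hinj
  have h2 := Finset.sum_le_sum fun i (_ : i ∈ I) => card_mul_sum_sq_norm_le (trees s p) (trees s p)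
    (fun w => F (x i ++ c i ++ w.word ++ y i)) (fun w => F (x i ++ w.word ++ c i ++ y i))
  simp_rw [Finset.sum_add_distrib, ← Finset.mul_sum] at h2
  have h3 : ∀ i ∈ I, ∑ w ∈ trees s p, ∑ w' ∈ trees s p,
      ‖F (x i ++ c i ++ w.word ++ y i) - F (x i ++ w'.word ++ c i ++ y i)‖ ^ 2 =
      ∑ w ∈ trees s p, ∑ w' ∈ trees s p,
      ‖F (x i ++ w.word ++ c i ++ y i) - F (x i ++ c i ++ w'.word ++ y i)‖ ^ 2 := by
    intro i _
    rw [Finset.sum_comm]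
    exact Finset.sum_congr rfl fun w _ => Finset.sum_congr rfl fun w' _ => by rw [norm_sub_rev]
  rw [Finset.sum_congr rfl h3] at h2
  change numTrees s p * _ ≤ _ + 2 * (numTrees s p * _) at h2
  refine le_of_mul_le_mul_left ?_ hS
  linarith

theorem boundaryEnergy_le_energy (s L : ℕ) (F : List (Spin s) → ℂ) :
    boundaryEnergy s L F ≤ energy s L F := by
  have := bulkEnergy_nonneg s L F
  have := crossEnergy_nonneg s L F
  rw [energy]
  linarith

theorem crossEnergy_le_energy (s L : ℕ) (F : List (Spin s) → ℂ) :
    crossEnergy s L F ≤ energy s L F := by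
  have := bulkEnergy_nonneg s L F
  have := boundaryEnergy_nonneg s L F
  rw [energy]
  linarith

/-- The weight of the words with an unmatched down step behind a Dyck word of length `2p`. -/
theorem sum_unmatched_down_le (hs : 1 ≤ s) {n : ℕ} (hn : 2 ≤ n) (F : List (Spin s) → ℂ) {p : ℕ}
    (hp : p < n) :
    ∑ t ∈ (Finset.univ : Finset (Fin s)) ×ˢ words s (2 * n - 1 - 2 * p), ∑ w ∈ trees s p,
      ‖F (w.word ++ dn t.1 :: t.2)‖ ^ 2 ≤ 2050 * n ^ 7 * energy s (2 * n) F := by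
  have h1 := sum_escape_right hs hn F
    ((Finset.univ : Finset (Fin s)) ×ˢ words s (2 * n - 1 - 2 * p)) (fun _ => [])
    (fun t => [dn t.1]) (fun t => t.2) (p := p) (lx := 0) (lc := 1) (ly := 2 * n - 1 - 2 * p)
    (by simp) (by simp) (fun t ht => mem_words.1 (Finset.mem_product.1 ht).2) (by omega) (by
      rintro ⟨k, z⟩ _ ⟨k', z'⟩ _ _ h h'
      simp only [List.cons.injEq, dn_inj, and_true] at h
      simp only at h'
      rw [h, h'])
  have h2 : ∑ t ∈ (Finset.univ : Finset (Fin s)) ×ˢ words s (2 * n - 1 - 2 * p),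
      ∑ w ∈ trees s p, ‖F ([] ++ [dn t.1] ++ w.word ++ t.2)‖ ^ 2 ≤ energy s (2 * n) F := by
    refine le_trans ?_ (boundaryEnergy_le_energy s (2 * n) F)
    rw [boundaryEnergy, Finset.sum_add_distrib]
    refine le_trans ?_ (le_add_of_nonneg_right (by positivity))
    simp_rw [← Finset.sum_product']
    refine sum_comp_le_sum (fun t : (Fin s × List (Spin s)) × CTree s =>
      (t.1.1, t.2.word ++ t.1.2)) (fun t => ‖F (dn t.1 :: t.2)‖ ^ 2) (fun t => by positivity) ?_ ?_
    · rintro ⟨⟨k, z⟩, w⟩ ht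
      simp only [Finset.mem_product, Finset.mem_univ, true_and, mem_words, mem_trees] at ht
      simp only [Finset.mem_product, Finset.mem_univ, true_and, mem_words, List.length_append,
        length_word]
      omega
    · rintro ⟨⟨k, z⟩, w⟩ ht ⟨⟨k', z'⟩, w'⟩ ht' h
      simp only [Finset.coe_product, Set.mem_prod, Finset.mem_coe, mem_trees] at ht ht'
      simp only [Prod.mk.injEq] at h
      obtain ⟨e1, e2⟩ := List.append_inj h.2 (by rw [length_word, length_word, ht.2, ht'.2])
      rw [h.1, word_injective e1, e2]
  -- The penalty contributes twice the energy; as n^7 ≥ 1 it is absorbed by 2048 + 2 = 2050.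
  have h3 : (1 : ℝ) ≤ (n : ℝ) ^ 7 := one_le_pow₀ (by exact_mod_cast (by omega : 1 ≤ n))
  have h4 := mul_le_mul_of_nonneg_right h3 (energy_nonneg s (2 * n) F)
  simp only [List.nil_append, List.append_assoc, List.cons_append] at h1 h2
  linarith

/-- The weight of the words with an unmatched up step in front of a final Dyck word of length
`2p`. -/
theorem sum_unmatched_up_le (hs : 1 ≤ s) {n : ℕ} (hn : 2 ≤ n) (F : List (Spin s) → ℂ) {p : ℕ}
    (hp : p < n) :
    ∑ t ∈ (Finset.univ : Finset (Fin s)) ×ˢ words s (2 * n - 1 - 2 * p), ∑ w ∈ trees s p,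
      ‖F (t.2 ++ up t.1 :: w.word)‖ ^ 2 ≤ 2050 * n ^ 7 * energy s (2 * n) F := by
  have h1 := sum_escape_left hs hn F
    ((Finset.univ : Finset (Fin s)) ×ˢ words s (2 * n - 1 - 2 * p)) (fun t => t.2)
    (fun t => [up t.1]) (fun _ => []) (p := p) (lx := 2 * n - 1 - 2 * p) (lc := 1) (ly := 0)
    (fun t ht => mem_words.1 (Finset.mem_product.1 ht).2) (by simp) (by simp) (by omega) (by
      rintro ⟨k, z⟩ _ ⟨k', z'⟩ _ h' h _
      simp only [List.cons.injEq, up_inj, and_true] at h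
      simp only at h'
      rw [h, h'])
  have h2 : ∑ t ∈ (Finset.univ : Finset (Fin s)) ×ˢ words s (2 * n - 1 - 2 * p),
      ∑ w ∈ trees s p, ‖F (t.2 ++ w.word ++ [up t.1] ++ [])‖ ^ 2 ≤ energy s (2 * n) F := by
    refine le_trans ?_ (boundaryEnergy_le_energy s (2 * n) F)
    rw [boundaryEnergy, Finset.sum_add_distrib]
    refine le_trans ?_ (le_add_of_nonneg_left (by positivity))
    simp_rw [← Finset.sum_product', List.append_nil]
    refine sum_comp_le_sum (fun t : (Fin s × List (Spin s)) × CTree s =>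
      (t.1.1, t.1.2 ++ t.2.word)) (fun t => ‖F (t.2 ++ [up t.1])‖ ^ 2) (fun t => by positivity) ?_ ?_
    · rintro ⟨⟨k, z⟩, w⟩ ht
      simp only [Finset.mem_product, Finset.mem_univ, true_and, mem_words, mem_trees] at ht
      simp only [Finset.mem_product, Finset.mem_univ, true_and, mem_words, List.length_append,
        length_word]
      omega
    · rintro ⟨⟨k, z⟩, w⟩ ht ⟨⟨k', z'⟩, w'⟩ ht' h
      simp only [Finset.coe_product, Set.mem_prod, Finset.mem_coe, mem_trees, mem_words] at ht ht'
      simp only [Prod.mk.injEq] at h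
      obtain ⟨e1, e2⟩ := List.append_inj h.2 (by rw [ht.1.2, ht'.1.2])
      rw [h.1, e1, word_injective e2]
  have h3 : (1 : ℝ) ≤ (n : ℝ) ^ 7 := one_le_pow₀ (by exact_mod_cast (by omega : 1 ≤ n))
  have h4 := mul_le_mul_of_nonneg_right h3 (energy_nonneg s (2 * n) F)
  simp only [List.append_nil, List.append_assoc, List.cons_append, List.nil_append] at h1 h2
  linarith

/-- The weight of the words in which an up and a down step of different colors enclose a Dyck word
of length `2p`. -/
theorem sum_mismatch_le (hs : 1 ≤ s) {n : ℕ} (hn : 2 ≤ n) (F : List (Spin s) → ℂ) {p q : ℕ}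
    (hpq : q + 2 + 2 * p ≤ 2 * n) :
    ∑ t ∈ words s q ×ˢ ((Finset.univ : Finset (Fin s × Fin s)).filter fun k => k.1 ≠ k.2) ×ˢ
      words s (2 * n - 2 - q - 2 * p), ∑ w ∈ trees s p,
      ‖F (t.1 ++ up t.2.1.1 :: (w.word ++ dn t.2.1.2 :: t.2.2))‖ ^ 2 ≤
      2050 * n ^ 7 * energy s (2 * n) F := by
  have h1 := sum_escape_right hs hn F
    (words s q ×ˢ ((Finset.univ : Finset (Fin s × Fin s)).filter fun k => k.1 ≠ k.2) ×ˢ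
      words s (2 * n - 2 - q - 2 * p)) (fun t => t.1 ++ [up t.2.1.1])
    (fun t => [dn t.2.1.2]) (fun t => t.2.2) (p := p) (lx := q + 1) (lc := 1)
    (ly := 2 * n - 2 - q - 2 * p)
    (fun t ht => by simp [mem_words.1 (Finset.mem_product.1 ht).1]) (by simp)
    (fun t ht => mem_words.1 (Finset.mem_product.1 (Finset.mem_product.1 ht).2).2) (by omega) (by
      rintro ⟨x, ⟨j, k⟩, z⟩ hx ⟨x', ⟨j', k'⟩, z'⟩ hx' h h' h''
      simp only [Finset.mem_product, mem_words] at hx hx'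
      simp only [List.cons.injEq, dn_inj, and_true] at h'
      simp only at h''
      obtain ⟨e1, e2⟩ := List.append_inj h (hx.1.trans hx'.1.symm)
      simp only [List.cons.injEq, up_inj, and_true] at e1 e2
      rw [e1, e2, h', h''])
  have h2 : ∑ t ∈ words s q ×ˢ ((Finset.univ : Finset (Fin s × Fin s)).filter
      fun k => k.1 ≠ k.2) ×ˢ words s (2 * n - 2 - q - 2 * p), ∑ w ∈ trees s p,
      ‖F (t.1 ++ [up t.2.1.1] ++ [dn t.2.1.2] ++ w.word ++ t.2.2)‖ ^ 2 ≤ energy s (2 * n) F := by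
    refine le_trans ?_ (crossEnergy_le_energy s (2 * n) F)
    rw [crossEnergy]
    -- After the Dyck word has been moved away, the two differently colored letters are neighbors at
    -- position q, so the crossing penalty at this one position suffices.
    refine le_trans ?_ (Finset.single_le_sum (s := Finset.univ) (fun j _ =>
      Finset.sum_nonneg fun k _ => Finset.sum_nonneg fun l _ => by split_ifs <;> positivity)
      (Finset.mem_univ (⟨q, by omega⟩ : Fin (2 * n - 1))))
    have e : ∑ k₁ : Fin s, ∑ k₂ : Fin s, (if k₁ ≠ k₂ then ∑ x ∈ words s q,
        ∑ y ∈ words s (2 * n - 2 - q), ‖F (x ++ [up k₁, dn k₂] ++ y)‖ ^ 2 else 0) =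
        ∑ t ∈ ((Finset.univ : Finset (Fin s × Fin s)).filter fun k => k.1 ≠ k.2) ×ˢ words s q ×ˢ
          words s (2 * n - 2 - q), ‖F (t.2.1 ++ [up t.1.1, dn t.1.2] ++ t.2.2)‖ ^ 2 := by
      rw [Finset.sum_product, Finset.sum_filter, Fintype.sum_prod_type]
      simp_rw [Finset.sum_product]
    simp only
    rw [e, ← Finset.sum_product']
    have := sum_comp_le_sum (S := (words s q ×ˢ ((Finset.univ : Finset (Fin s × Fin s)).filter
      fun k => k.1 ≠ k.2) ×ˢ words s (2 * n - 2 - q - 2 * p)) ×ˢ trees s p)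
      (T := ((Finset.univ : Finset (Fin s × Fin s)).filter fun k => k.1 ≠ k.2) ×ˢ words s q ×ˢ
          words s (2 * n - 2 - q))
      (fun t => (t.1.2.1, t.1.1, t.2.word ++ t.1.2.2))
      (fun t => ‖F (t.2.1 ++ [up t.1.1, dn t.1.2] ++ t.2.2)‖ ^ 2) (fun t => by positivity) ?_ ?_
    · simpa using this
    · rintro ⟨⟨x, ⟨j, k⟩, z⟩, w⟩ ht
      simp only [Finset.mem_product, mem_words, mem_trees] at ht
      simp only [Finset.mem_product, mem_words, List.length_append, length_word]
      exact ⟨ht.1.2.1, ht.1.1, by omega⟩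
    · rintro ⟨⟨x, ⟨j, k⟩, z⟩, w⟩ ht ⟨⟨x', ⟨j', k'⟩, z'⟩, w'⟩ ht' h
      simp only [Finset.coe_product, Set.mem_prod, Finset.mem_coe, mem_trees] at ht ht'
      simp only [Prod.mk.injEq] at h
      obtain ⟨e1, e2⟩ := List.append_inj h.2.2 (by rw [length_word, length_word, ht.2, ht'.2])
      rw [h.1.1, h.1.2, h.2.1, word_injective e1, e2]
  have h3 : (1 : ℝ) ≤ (n : ℝ) ^ 7 := one_le_pow₀ (by exact_mod_cast (by omega : 1 ≤ n))
  have h4 := mul_le_mul_of_nonneg_right h3 (energy_nonneg s (2 * n) F)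
  simp only [List.append_assoc, List.cons_append, List.nil_append] at h1 h2
  linarith

open Classical in
/-- The lower bound for the energy on the unbalanced subspace. -/
theorem unbalanced_energy_bound (hs : 1 ≤ s) {n : ℕ} (hn : 2 ≤ n) (F : List (Spin s) → ℂ) :
    ∑ l ∈ words s (2 * n) with ¬ IsColoredDyck l, ‖F l‖ ^ 2 ≤
      8200 * n ^ 9 * energy s (2 * n) F := by
  set K := 2050 * (n : ℝ) ^ 7 * energy s (2 * n) F with hK
  have hK0 : 0 ≤ K := mul_nonneg (by positivity) (energy_nonneg _ _ _)
  set S₁ := (words s (2 * n)).filter fun l => ∃ w k z, IsColoredDyck w ∧ l = w ++ dn k :: z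
  set S₂ := (words s (2 * n)).filter fun l => ∃ z k w, IsColoredDyck w ∧ l = z ++ up k :: w
  set S₃ := (words s (2 * n)).filter fun l => ∃ x j w k z, IsColoredDyck w ∧ j ≠ k ∧
    l = x ++ up j :: (w ++ dn k :: z)
  have h1 : ∑ l ∈ S₁, ‖F l‖ ^ 2 ≤ n * K := by
    have e1 := Finset.sum_le_card_nsmul (Finset.range n) _ K fun p hp =>
      sum_unmatched_down_le hs hn F (Finset.mem_range.1 hp)
    rw [Finset.card_range, nsmul_eq_mul] at e1
    refine le_trans ?_ e1
    simp_rw [← Finset.sum_product']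
    rw [Finset.sum_sigma']
    refine sum_le_sum_comp (fun t : (_ : ℕ) × ((Fin s × List (Spin s)) × CTree s) =>
      t.2.2.word ++ dn t.2.1.1 :: t.2.1.2) (fun l => ‖F l‖ ^ 2) (fun l => by positivity) ?_
    intro l hl
    obtain ⟨hl, w, k, z, hw, rfl⟩ := Finset.mem_filter.1 hl
    obtain ⟨t, rfl⟩ := hw.exists_word
    rw [mem_words] at hl
    simp only [List.length_append, List.length_cons, length_word] at hl
    refine ⟨⟨t.size, (k, z), t⟩, ?_, rfl⟩
    simp only [Finset.mem_sigma, Finset.mem_range, Finset.mem_product, Finset.mem_univ, mem_words,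
      mem_trees, true_and, and_true]
    omega
  have h2 : ∑ l ∈ S₂, ‖F l‖ ^ 2 ≤ n * K := by
    have e1 := Finset.sum_le_card_nsmul (Finset.range n) _ K fun p hp =>
      sum_unmatched_up_le hs hn F (Finset.mem_range.1 hp)
    rw [Finset.card_range, nsmul_eq_mul] at e1
    refine le_trans ?_ e1
    simp_rw [← Finset.sum_product']
    rw [Finset.sum_sigma']
    refine sum_le_sum_comp (fun t : (_ : ℕ) × ((Fin s × List (Spin s)) × CTree s) =>
      t.2.1.2 ++ up t.2.1.1 :: t.2.2.word) (fun l => ‖F l‖ ^ 2) (fun l => by positivity) ?_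
    intro l hl
    obtain ⟨hl, z, k, w, hw, rfl⟩ := Finset.mem_filter.1 hl
    obtain ⟨t, rfl⟩ := hw.exists_word
    rw [mem_words] at hl
    simp only [List.length_append, List.length_cons, length_word] at hl
    refine ⟨⟨t.size, (k, z), t⟩, ?_, rfl⟩
    simp only [Finset.mem_sigma, Finset.mem_range, Finset.mem_product, Finset.mem_univ, mem_words,
      mem_trees, true_and, and_true]
    omega
  -- A mismatch is located by the length of the prefix and the size of the enclosed Dyck word, which
  -- leaves at most 2n·n cases.
  have h3 : ∑ l ∈ S₃, ‖F l‖ ^ 2 ≤ (2 * n * n) * K := by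
    set J := (Finset.range (2 * n) ×ˢ Finset.range n).filter fun t => t.1 + 2 + 2 * t.2 ≤ 2 * n
    have e1 := Finset.sum_le_card_nsmul J _ K fun t ht =>
      sum_mismatch_le hs hn F (q := t.1) (p := t.2) (Finset.mem_filter.1 ht).2
    have e2 : (J.card : ℝ) ≤ 2 * n * n := by
      have := Finset.card_filter_le (Finset.range (2 * n) ×ˢ Finset.range n)
        fun t => t.1 + 2 + 2 * t.2 ≤ 2 * n
      rw [Finset.card_product, Finset.card_range, Finset.card_range] at this
      exact_mod_cast this
    rw [nsmul_eq_mul] at e1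
    refine le_trans ?_ (e1.trans (mul_le_mul_of_nonneg_right e2 hK0))
    simp_rw [← Finset.sum_product']
    rw [Finset.sum_sigma']
    refine sum_le_sum_comp (fun t : (_ : ℕ × ℕ) ×
      ((List (Spin s) × (Fin s × Fin s) × List (Spin s)) × CTree s) =>
      t.2.1.1 ++ up t.2.1.2.1.1 :: (t.2.2.word ++ dn t.2.1.2.1.2 :: t.2.1.2.2))
      (fun l => ‖F l‖ ^ 2) (fun l => by positivity) ?_
    intro l hl
    obtain ⟨hl, x, j, w, k, z, hw, hjk, rfl⟩ := Finset.mem_filter.1 hl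
    obtain ⟨t, rfl⟩ := hw.exists_word
    rw [mem_words] at hl
    simp only [List.length_append, List.length_cons, length_word] at hl
    refine ⟨⟨(x.length, t.size), (x, (j, k), z), t⟩, ?_, rfl⟩
    simp only [J, Finset.mem_sigma, Finset.mem_filter, Finset.mem_range, Finset.mem_product,
      Finset.mem_univ, mem_words, mem_trees, true_and, and_true]
    exact ⟨by omega, hjk, by omega⟩
  -- A word may have several defects; since all terms are nonnegative, counting it several times
  -- does no harm.
  have h4 : ∑ l ∈ words s (2 * n) with ¬ IsColoredDyck l, ‖F l‖ ^ 2 ≤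
      ∑ l ∈ S₁, ‖F l‖ ^ 2 + (∑ l ∈ S₂, ‖F l‖ ^ 2 + ∑ l ∈ S₃, ‖F l‖ ^ 2) := by
    simp only [S₁, S₂, S₃, Finset.sum_filter]
    rw [← Finset.sum_add_distrib, ← Finset.sum_add_distrib]
    refine Finset.sum_le_sum fun l _ => ?_
    have hnn : ∀ P : Prop, 0 ≤ (if P then ‖F l‖ ^ 2 else 0) := fun P => by
      split_ifs <;> positivity
    by_cases hl : IsColoredDyck l
    · rw [if_neg (not_not.2 hl)]
      exact add_nonneg (hnn _) (add_nonneg (hnn _) (hnn _))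
    · rw [if_pos hl]
      rcases (exists_defect l).resolve_left hl with h | h | h
      · rw [if_pos h]
        exact le_add_of_nonneg_right (add_nonneg (hnn _) (hnn _))
      · rw [if_pos h]
        exact le_add_of_nonneg_of_le (hnn _) (le_add_of_nonneg_right (hnn _))
      · rw [if_pos h]
        exact le_add_of_nonneg_of_le (hnn _) (le_add_of_nonneg_left (hnn _))
  have hn1 : (1 : ℝ) ≤ n := by exact_mod_cast (by omega : 1 ≤ n)
  have h5 : (n : ℝ) * K ≤ n * n * K := by
    refine mul_le_mul_of_nonneg_right ?_ hK0
    nlinarith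
  calc _ ≤ _ := h4
    -- The three kinds contribute n, n and 2n^2 times K, together at most 4n^2 K, and 4·2050 = 8200.
    _ ≤ 4 * (n * n * K) := by linarith
    _ = _ := by rw [hK]; ring

end Fredkin

namespace Fredkin

/-! ### Variational bounds for the lowest eigenvalues -/

theorem inner_toLp_eq {ι : Type*} [Fintype ι] (f g : ι → ℂ) :
    inner ℂ (WithLp.toLp 2 f) (WithLp.toLp 2 g) = star f ⬝ᵥ g := by
  simp [PiLp.inner_apply, dotProduct, mul_comm]

section Spectral

variable {ι : Type*} [Fintype ι] [DecidableEq ι] {A : Matrix ι ι ℂ} (hA : A.IsHermitian)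

/-- Sorting the indices rather than the eigenvalues keeps track of multiplicities: the two smallest
eigenvalues belong to two distinct indices even when they coincide. -/
theorem exists_energies_eq_map : ∃ l : List ι, l.Nodup ∧ (∀ i, i ∈ l) ∧
    energies hA = l.map hA.eigenvalues ∧
    l.Pairwise fun i j => hA.eigenvalues i ≤ hA.eigenvalues j := by
  have h1 : energies hA = ((Finset.univ : Finset ι).toList.mergeSort
      (fun i j => decide (hA.eigenvalues i ≤ hA.eigenvalues j))).map hA.eigenvalues := by
    rw [energies, ← Finset.coe_toList, Multiset.map_coe, Multiset.coe_sort]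
    exact (List.map_mergeSort (by simp)).symm
  refine ⟨_, ?_, ?_, h1, ?_⟩
  · exact (List.mergeSort_perm _ _).nodup_iff.2 (Finset.nodup_toList _)
  · intro i
    rw [List.mem_mergeSort, Finset.mem_toList]
    exact Finset.mem_univ i
  · rw [← List.pairwise_map, ← h1]
    exact Multiset.pairwise_sort _ _

theorem exists_groundEnergy_eq [Nonempty ι] : ∃ i, groundEnergy hA = hA.eigenvalues i := by
  obtain ⟨l, -, h2, h3, -⟩ := exists_energies_eq_map hA
  rcases l with _ | ⟨i, l⟩
  · simpa using h2 (Classical.arbitrary ι)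
  · exact ⟨i, by simp [groundEnergy, h3]⟩

theorem exists_gap_eq (hcard : 2 ≤ Fintype.card ι) : ∃ i j, i ≠ j ∧
    gap hA = hA.eigenvalues j - hA.eigenvalues i ∧ (∀ k, hA.eigenvalues i ≤ hA.eigenvalues k) ∧
    ∀ k, k ≠ i → hA.eigenvalues j ≤ hA.eigenvalues k := by
  obtain ⟨l, h1, h2, h3, h4⟩ := exists_energies_eq_map hA
  rcases l with _ | ⟨i, _ | ⟨j, l⟩⟩
  · have : IsEmpty ι := ⟨fun i => by simpa using h2 i⟩
    simp at hcard
  · have : Subsingleton ι := ⟨fun a b => by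
      rw [List.mem_singleton.1 (h2 a), List.mem_singleton.1 (h2 b)]⟩
    have := Fintype.card_le_one_iff_subsingleton.2 this
    omega
  · rw [List.pairwise_cons, List.pairwise_cons] at h4
    refine ⟨i, j, ?_, by simp [gap, h3], ?_, ?_⟩
    · rintro rfl
      simp at h1
    · intro k
      rcases List.mem_cons.1 (h2 k) with rfl | hk
      · exact le_rfl
      · exact h4.1 k hk
    · intro k hk
      rcases List.mem_cons.1 ((List.mem_cons.1 (h2 k)).resolve_left hk) with rfl | hk'
      · exact le_rfl
      · exact h4.2.1 k hk'

/-- The coefficient of `f` with respect to the eigenvector `i`. -/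
noncomputable def eigenCoeff (f : ι → ℂ) (i : ι) : ℂ :=
  star (hA.eigenvectorBasis i).ofLp ⬝ᵥ f

theorem inner_eigenvectorBasis (f : ι → ℂ) (i : ι) :
    inner ℂ (hA.eigenvectorBasis i) (WithLp.toLp 2 f) = eigenCoeff hA f i :=
  inner_toLp_eq (hA.eigenvectorBasis i).ofLp f

theorem sum_sq_eigenCoeff (f : ι → ℂ) :
    ∑ i, ‖eigenCoeff hA f i‖ ^ 2 = ∑ x, ‖f x‖ ^ 2 := by
  have := hA.eigenvectorBasis.sum_sq_norm_inner_right (WithLp.toLp 2 f)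
  rw [EuclideanSpace.norm_sq_eq] at this
  rw [← this]
  simp only [inner_eigenvectorBasis]

theorem qform_eq_sum_eigenCoeff (f : ι → ℂ) :
    qform A f = ∑ i, hA.eigenvalues i * ‖eigenCoeff hA f i‖ ^ 2 := by
  have h1 := hA.eigenvectorBasis.sum_inner_mul_inner (WithLp.toLp 2 f) (WithLp.toLp 2 (A.mulVec f))
  rw [inner_toLp_eq] at h1
  rw [qform, ← h1, Complex.re_sum]
  refine Finset.sum_congr rfl fun i _ => ?_
  have h2 : inner ℂ (hA.eigenvectorBasis i) (WithLp.toLp 2 (A.mulVec f)) =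
      (hA.eigenvalues i : ℂ) * eigenCoeff hA f i := by
    have h3 : Matrix.vecMul (star (hA.eigenvectorBasis i).ofLp) A =
        star (A.mulVec (hA.eigenvectorBasis i).ofLp) := by
      rw [Matrix.star_mulVec, hA.eq]
    rw [inner_eigenvectorBasis, eigenCoeff, Matrix.dotProduct_mulVec, h3,
      hA.mulVec_eigenvectorBasis, eigenCoeff]
    simp [dotProduct, Finset.mul_sum, mul_assoc]
  have h4 : inner ℂ (WithLp.toLp 2 f) (hA.eigenvectorBasis i) = star (eigenCoeff hA f i) := by
    rw [← inner_conj_symm, inner_eigenvectorBasis]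
    rfl
  rw [h2, h4, mul_left_comm, Complex.star_def, Complex.conj_mul', Complex.re_ofReal_mul,
    ← Complex.ofReal_pow, Complex.ofReal_re]

theorem eigenCoeff_add (f g : ι → ℂ) (i : ι) :
    eigenCoeff hA (f + g) i = eigenCoeff hA f i + eigenCoeff hA g i := by
  simp [eigenCoeff, dotProduct_add]

theorem eigenCoeff_smul (a : ℂ) (f : ι → ℂ) (i : ι) :
    eigenCoeff hA (a • f) i = a * eigenCoeff hA f i := by
  simp [eigenCoeff, dotProduct_smul]

theorem eigenCoeff_eigenvector (i j : ι) :
    eigenCoeff hA (hA.eigenvectorBasis j).ofLp i = if i = j then 1 else 0 := by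
  rw [← inner_eigenvectorBasis]
  exact orthonormal_iff_ite.1 hA.eigenvectorBasis.orthonormal i j

theorem sum_mul_sq_eigenCoeff_eigenvector (g : ι → ℝ) (i : ι) :
    ∑ k, g k * ‖eigenCoeff hA (hA.eigenvectorBasis i).ofLp k‖ ^ 2 = g i := by
  rw [Finset.sum_eq_single i]
  · simp [eigenCoeff_eigenvector]
  · intro k _ hk
    simp [eigenCoeff_eigenvector, hk]
  · simp

theorem le_groundEnergy [Nonempty ι] {c : ℝ}
    (h : ∀ f : ι → ℂ, c * ∑ x, ‖f x‖ ^ 2 ≤ qform A f) : c ≤ groundEnergy hA := by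
  obtain ⟨i, hi⟩ := exists_groundEnergy_eq hA
  have h1 := h (hA.eigenvectorBasis i).ofLp
  rw [qform_eq_sum_eigenCoeff hA, ← sum_sq_eigenCoeff hA, Finset.mul_sum,
    sum_mul_sq_eigenCoeff_eigenvector hA (fun _ => c), sum_mul_sq_eigenCoeff_eigenvector] at h1
  rwa [hi]

/-- If the form is at most `0` at `ψ` and at least `c` on the complement of `ψ`, then the gap is
at least `c`. -/
theorem le_gap (hcard : 2 ≤ Fintype.card ι) {c : ℝ} (ψ : ι → ℂ) (hψ : ψ ≠ 0)
    (hψ0 : qform A ψ ≤ 0)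
    (h : ∀ f : ι → ℂ, star ψ ⬝ᵥ f = 0 → c * ∑ x, ‖f x‖ ^ 2 ≤ qform A f) : c ≤ gap hA := by
  obtain ⟨i, j, hij, hg, hi, hj⟩ := exists_gap_eq hA hcard
  have hlow : hA.eigenvalues i ≤ 0 := by
    have h1 : hA.eigenvalues i * ∑ x, ‖ψ x‖ ^ 2 ≤ 0 := by
      refine le_trans ?_ hψ0
      rw [qform_eq_sum_eigenCoeff hA, ← sum_sq_eigenCoeff hA, Finset.mul_sum]
      exact Finset.sum_le_sum fun k _ => mul_le_mul_of_nonneg_right (hi k) (by positivity)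
    have h2 : 0 < ∑ x, ‖ψ x‖ ^ 2 := by
      obtain ⟨x, hx⟩ := Function.ne_iff.1 hψ
      exact Finset.sum_pos' (fun _ _ => by positivity)
        ⟨x, Finset.mem_univ x, pow_pos (norm_pos_iff.2 hx) 2⟩
    nlinarith
  have hhigh : c ≤ hA.eigenvalues j := by
    set u := (hA.eigenvectorBasis i).ofLp with hu
    set v := (hA.eigenvectorBasis j).ofLp with hv
    -- The span of the two lowest eigenvectors is two-dimensional, so it contains a nonzero vector
    -- orthogonal to ψ. The form there is at most the second eigenvalue times the squared norm.
    obtain ⟨a, b, hab, h0⟩ : ∃ a b : ℂ, (a ≠ 0 ∨ b ≠ 0) ∧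
        star ψ ⬝ᵥ (a • u + b • v) = 0 := by
      by_cases hz : star ψ ⬝ᵥ u = 0
      · exact ⟨1, 0, Or.inl one_ne_zero, by simp [hz]⟩
      · refine ⟨-(star ψ ⬝ᵥ v), star ψ ⬝ᵥ u, Or.inr hz, ?_⟩
        simp only [dotProduct_add, dotProduct_smul, smul_eq_mul]
        ring
    have h1 := h _ h0
    rw [qform_eq_sum_eigenCoeff hA, ← sum_sq_eigenCoeff hA] at h1
    have h2 : ∀ k, eigenCoeff hA (a • u + b • v) k =
        (if k = i then a else 0) + (if k = j then b else 0) := by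
      intro k
      rw [eigenCoeff_add, eigenCoeff_smul, eigenCoeff_smul, hu, hv, eigenCoeff_eigenvector,
        eigenCoeff_eigenvector]
      simp
    have h3 : ∀ g : ι → ℝ, ∑ k, g k * ‖eigenCoeff hA (a • u + b • v) k‖ ^ 2 =
        g i * ‖a‖ ^ 2 + g j * ‖b‖ ^ 2 := by
      intro g
      rw [Finset.sum_eq_add i j hij]
      · rw [h2, h2]
        simp [hij, hij.symm]
      · intro k _ hk
        rw [h2]
        simp [hk.1, hk.2]
      · simp
      · simp
    have h4 := h3 fun _ => 1
    simp only [one_mul] at h4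
    rw [h3, h4] at h1
    have h5 : 0 < ‖a‖ ^ 2 + ‖b‖ ^ 2 := by
      rcases hab with h | h
      · have := norm_pos_iff.2 h; positivity
      · have := norm_pos_iff.2 h; positivity
    have h6 : hA.eigenvalues i * ‖a‖ ^ 2 ≤ hA.eigenvalues j * ‖a‖ ^ 2 :=
      mul_le_mul_of_nonneg_right (hi j) (by positivity)
    refine le_of_mul_le_mul_right ?_ h5
    linarith
  rw [hg]
  linarith

/-- If the form is nonnegative, and at most `C` on the span of two orthogonal vectors, then the
gap is at most `C`. -/
theorem gap_le (hcard : 2 ≤ Fintype.card ι) {C : ℝ} (h0 : ∀ f : ι → ℂ, 0 ≤ qform A f)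
    (ψ φ : ι → ℂ) (hne : ∀ a b : ℂ, a • ψ + b • φ = 0 → a = 0 ∧ b = 0)
    (h : ∀ a b : ℂ, qform A (a • ψ + b • φ) ≤ C * ∑ x, ‖(a • ψ + b • φ) x‖ ^ 2) :
    gap hA ≤ C := by
  obtain ⟨i, j, hij, hg, hi, hj⟩ := exists_gap_eq hA hcard
  have hlow : 0 ≤ hA.eigenvalues i := by
    have h1 := h0 (hA.eigenvectorBasis i).ofLp
    rwa [qform_eq_sum_eigenCoeff hA, sum_mul_sq_eigenCoeff_eigenvector] at h1
  have hhigh : hA.eigenvalues j ≤ C := by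
    -- Dually, the span of ψ and φ contains a nonzero vector orthogonal to the lowest eigenvector,
    -- where the form is at least the second eigenvalue times the squared norm.
    obtain ⟨a, b, hab, hz⟩ : ∃ a b : ℂ, (a ≠ 0 ∨ b ≠ 0) ∧
        eigenCoeff hA (a • ψ + b • φ) i = 0 := by
      by_cases hz : eigenCoeff hA ψ i = 0
      · exact ⟨1, 0, Or.inl one_ne_zero, by simp [hz]⟩
      · refine ⟨-(eigenCoeff hA φ i), eigenCoeff hA ψ i, Or.inr hz, ?_⟩
        rw [eigenCoeff_add, eigenCoeff_smul, eigenCoeff_smul]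
        ring
    set g := a • ψ + b • φ with hgdef
    have hgne : g ≠ 0 := fun H => by
      obtain ⟨rfl, rfl⟩ := hne a b H
      simp at hab
    have h2 : 0 < ∑ x, ‖g x‖ ^ 2 := by
      obtain ⟨x, hx⟩ := Function.ne_iff.1 hgne
      exact Finset.sum_pos' (fun _ _ => by positivity)
        ⟨x, Finset.mem_univ x, pow_pos (norm_pos_iff.2 hx) 2⟩
    have h3 : hA.eigenvalues j * ∑ x, ‖g x‖ ^ 2 ≤ qform A g := by
      rw [qform_eq_sum_eigenCoeff hA, ← sum_sq_eigenCoeff hA, Finset.mul_sum]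
      refine Finset.sum_le_sum fun k _ => ?_
      by_cases hk : k = i
      · subst hk
        simp [hz]
      · exact mul_le_mul_of_nonneg_right (hj k hk) (by positivity)
    exact le_of_mul_le_mul_right (h3.trans (h a b)) h2
  rw [hg]
  linarith

end Spectral

end Fredkin

namespace Fredkin

open CTree

variable {s : ℕ}

/-! ### A state of low energy -/

/-- The number of letters in front of the first unmatched down step, if `st` is the stack of the
letters read before. -/
def firstDrop : List (Spin s) → List (Spin s) → ℕ
  | _, [] => 0
  | st, c :: l => if st = [] ∧ c.1 = false then 0 else firstDrop (pushSpin st c) l + 1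

@[simp] theorem firstDrop_up (st l : List (Spin s)) (k : Fin s) :
    firstDrop st (up k :: l) = firstDrop (up k :: st) l + 1 := by
  rw [firstDrop, if_neg (by simp [up]), pushSpin_up]

@[simp] theorem firstDrop_dn_nil (l : List (Spin s)) (k : Fin s) :
    firstDrop [] (dn k :: l) = 0 := by
  rw [firstDrop, if_pos (by simp [dn])]

theorem firstDrop_dn {st : List (Spin s)} (hst : st ≠ []) (l : List (Spin s)) (k : Fin s) :
    firstDrop st (dn k :: l) = firstDrop (pushSpin st (dn k)) l + 1 := by
  rw [firstDrop, if_neg (by simp [hst])]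

@[simp] theorem firstDrop_dn_up (st l : List (Spin s)) (k : Fin s) :
    firstDrop (up k :: st) (dn k :: l) = firstDrop st l + 1 := by
  rw [firstDrop_dn (by simp), pushSpin_dn_up]

/-- Either the first unmatched down step lies in the prefix and the rest is irrelevant, or the
prefix matters only through its length and its stack. Hence a local move has to be examined on its
own window only, for an arbitrary stack. -/
theorem firstDrop_append (x : List (Spin s)) : ∀ st : List (Spin s),
    (∀ y, firstDrop st (x ++ y) = firstDrop st x) ∨
    (∀ y, firstDrop st (x ++ y) = firstDrop (reduce st x) y + x.length) := by
  induction x with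
  | nil => exact fun st => Or.inr fun y => rfl
  | cons c x ih =>
    intro st
    by_cases h : st = [] ∧ c.1 = false
    · exact Or.inl fun y => by rw [List.cons_append, firstDrop, if_pos h, firstDrop, if_pos h]
    · rcases ih (pushSpin st c) with h' | h'
      · exact Or.inl fun y => by rw [List.cons_append, firstDrop, if_neg h, firstDrop, if_neg h, h']
      · refine Or.inr fun y => ?_
        rw [List.cons_append, firstDrop, if_neg h, h', reduce_cons, List.length_cons]
        ring

theorem firstDrop_word_append (t : CTree s) : ∀ st y : List (Spin s),
    firstDrop st (t.word ++ y) = firstDrop st y + 2 * t.size := by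
  induction t with
  | nil => intro st y; rfl
  | node k a b iha ihb =>
    intro st y
    simp only [word, List.cons_append, List.append_assoc]
    rw [firstDrop_up, iha, firstDrop_dn (by simp), pushSpin_dn_up, ihb, size]
    ring

/-- The word with two unmatched down steps of color `k` that separate three Dyck words. -/
def twoDrops (k : Fin s) (t : CTree s × CTree s × CTree s) : List (Spin s) :=
  t.1.word ++ dn k :: (t.2.1.word ++ dn k :: t.2.2.word)

theorem reduce_twoDrops (k : Fin s) (t : CTree s × CTree s × CTree s) :
    reduce [] (twoDrops k t) = [dn k, dn k] := by
  simp [twoDrops, (isColoredDyck_word _).reduce_eq]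

theorem firstDrop_twoDrops (k : Fin s) (t : CTree s × CTree s × CTree s) :
    firstDrop [] (twoDrops k t) = 2 * t.1.size := by
  rw [twoDrops, firstDrop_word_append, firstDrop_dn_nil, zero_add]

theorem length_twoDrops (k : Fin s) (t : CTree s × CTree s × CTree s) :
    (twoDrops k t).length = 2 * (t.1.size + t.2.1.size + t.2.2.size + 1) := by
  simp only [twoDrops, List.length_append, List.length_cons, length_word]
  ring

theorem twoDrops_injective (k : Fin s) : Function.Injective (twoDrops k) := by
  rintro ⟨a, b, c⟩ ⟨a', b', c'⟩ h
  change a.word ++ dn k :: (b.word ++ dn k :: c.word) =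
    a'.word ++ dn k :: (b'.word ++ dn k :: c'.word) at h
  obtain ⟨rfl, h₁⟩ := word_append_inj a a' _ _ (by simp [up, dn]) (by simp [up, dn]) h
  simp only [List.cons.injEq, true_and] at h₁
  obtain ⟨rfl, h₂⟩ := word_append_inj b b' _ _ (by simp [up, dn]) (by simp [up, dn]) h₁
  simp only [List.cons.injEq, true_and] at h₂
  rw [word_injective h₂]

/-- The bottom of the stack is the first unmatched letter. The two other kinds of defects would
leave an up step on the stack, which the hypotheses exclude. -/
theorem exists_drop_of_reduce {l st : List (Spin s)} {k : Fin s}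
    (hst : ∀ c ∈ st, ∃ j, c = dn j) (h : reduce [] l = st ++ [dn k]) :
    ∃ (w : CTree s) (z : List (Spin s)), l = w.word ++ dn k :: z ∧ reduce [] z = st := by
  have hst' : ∀ j, up j ∉ st ++ [dn k] := by
    intro j hj
    rcases List.mem_append.1 hj with hj | hj
    · obtain ⟨i, hi⟩ := hst _ hj
      exact up_ne_dn _ _ hi
    · exact up_ne_dn _ _ (List.mem_singleton.1 hj)
  rcases exists_defect l with h' | ⟨w, j, z, hw, rfl⟩ | ⟨z, j, w, hw, rfl⟩ |
    ⟨x, i, w, j, z, hw, hij, rfl⟩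
  · rw [h'.reduce_eq] at h
    simp at h
  · obtain ⟨t, rfl⟩ := hw.exists_word
    simp only [reduce_append, hw.reduce_eq, reduce_cons, pushSpin_dn_nil, reduce_dn_cons] at h
    obtain ⟨h1, h2⟩ := List.append_inj' h rfl
    simp only [List.cons.injEq, dn_inj, and_true] at h2
    subst h2
    exact ⟨t, z, rfl, h1⟩
  · refine absurd ?_ (hst' j)
    rw [← h]
    simp [hw.reduce_eq]
  · refine absurd ?_ (hst' i)
    rw [← h]
    simp [hw.reduce_eq, pushSpin_dn_up_ne _ hij, reduce_dn_cons]

theorem exists_twoDrops {l : List (Spin s)} {k : Fin s} (h : reduce [] l = [dn k, dn k]) :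
    ∃ t, twoDrops k t = l := by
  obtain ⟨a, z, rfl, hz⟩ := exists_drop_of_reduce (st := [dn k]) (by simp) h
  obtain ⟨b, z', rfl, hz'⟩ := exists_drop_of_reduce (st := []) (by simp) hz
  obtain ⟨c, rfl⟩ := (isColoredDyck_iff.2 hz').exists_word
  exact ⟨(a, b, c), rfl⟩

/-- The sum over the words with two unmatched down steps of color `k`. -/
theorem sum_twoDrops (k : Fin s) (m : ℕ) (g : ℕ → ℝ) :
    ∑ l ∈ words s (2 * (m + 1)), (if reduce [] l = [dn k, dn k] then g (firstDrop [] l) else 0) =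
      (s : ℝ)⁻¹ * ∑ i ∈ Finset.range (m + 1),
        g (2 * i) * (numTrees s i * numTrees s (m + 1 - i)) := by
  have hs : (s : ℝ) ≠ 0 := by
    have := k.pos
    exact_mod_cast this.ne'
  have h1 : ∑ i ∈ Finset.range (m + 1), ∑ a ∈ trees s i,
      ∑ jl ∈ Finset.HasAntidiagonal.antidiagonal (m - i), ∑ b ∈ trees s jl.1, ∑ c ∈ trees s jl.2,
        g (2 * i) = (s : ℝ)⁻¹ * ∑ i ∈ Finset.range (m + 1),
        g (2 * i) * (numTrees s i * numTrees s (m + 1 - i)) := by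
    rw [Finset.mul_sum]
    refine Finset.sum_congr rfl fun i hi => ?_
    -- The pairs of trees behind the first drop have m-i nodes in total; by the Catalan recursion
    -- their number is 1/s times the number of trees with m-i+1 nodes.
    have hi' : m + 1 - i = (m - i) + 1 := by have := Finset.mem_range.1 hi; omega
    rw [hi', numTrees_succ]
    simp only [Finset.sum_const, nsmul_eq_mul]
    change numTrees s i * ∑ jl ∈ Finset.HasAntidiagonal.antidiagonal (m - i),
      numTrees s jl.1 * (numTrees s jl.2 * g (2 * i)) = _
    simp_rw [← mul_assoc, ← Finset.sum_mul]
    field_simp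
  have h2 : ∑ i ∈ Finset.range (m + 1), ∑ a ∈ trees s i,
      ∑ jl ∈ Finset.HasAntidiagonal.antidiagonal (m - i), ∑ b ∈ trees s jl.1, ∑ c ∈ trees s jl.2,
        g (2 * i) = ∑ t ∈ ((Finset.range (m + 1)).sigma fun i => trees s i).sigma fun x =>
          (Finset.HasAntidiagonal.antidiagonal (m - x.1)).sigma fun jl =>
            trees s jl.1 ×ˢ trees s jl.2, g (2 * t.1.1) := by
    rw [Finset.sum_sigma, Finset.sum_sigma]
    refine Finset.sum_congr rfl fun i _ => Finset.sum_congr rfl fun a _ => ?_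
    rw [Finset.sum_sigma]
    refine Finset.sum_congr rfl fun jl _ => ?_
    rw [Finset.sum_product]
  rw [← h1, ← Finset.sum_filter, h2]
  symm
  refine Finset.sum_bij (fun t _ => twoDrops k (t.1.2, t.2.2.1, t.2.2.2)) ?_ ?_ ?_ ?_
  · rintro ⟨⟨i, a⟩, ⟨j, l⟩, b, c⟩ ht
    simp only [Finset.mem_sigma, Finset.mem_range, Finset.HasAntidiagonal.mem_antidiagonal,
      Finset.mem_product, mem_trees] at ht
    rw [Finset.mem_filter, mem_words, length_twoDrops]
    refine ⟨?_, reduce_twoDrops _ _⟩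
    simp only
    omega
  · rintro ⟨⟨i, a⟩, ⟨j, l⟩, b, c⟩ ht ⟨⟨i', a'⟩, ⟨j', l'⟩, b', c'⟩ ht' h
    simp only [Finset.mem_sigma, Finset.mem_range, Finset.HasAntidiagonal.mem_antidiagonal,
      Finset.mem_product, mem_trees] at ht ht'
    have := twoDrops_injective k h
    simp only [Prod.mk.injEq] at this
    obtain ⟨rfl, rfl, rfl⟩ := this
    obtain ⟨⟨-, rfl⟩, -, rfl, rfl⟩ := ht
    obtain ⟨⟨-, rfl⟩, -, rfl, rfl⟩ := ht'
    rfl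
  · intro l hl
    rw [Finset.mem_filter, mem_words] at hl
    obtain ⟨⟨a, b, c⟩, rfl⟩ := exists_twoDrops hl.2
    rw [length_twoDrops] at hl
    refine ⟨⟨⟨a.size, a⟩, ⟨(b.size, c.size), b, c⟩⟩, ?_, rfl⟩
    simp only [Finset.mem_sigma, Finset.mem_range, Finset.HasAntidiagonal.mem_antidiagonal,
      Finset.mem_product, mem_trees, and_self, and_true]
    simp only at hl
    omega
  · rintro ⟨⟨i, a⟩, ⟨j, l⟩, b, c⟩ ht
    simp only [Finset.mem_sigma, Finset.mem_range, Finset.HasAntidiagonal.mem_antidiagonal,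
      Finset.mem_product, mem_trees] at ht
    rw [firstDrop_twoDrops]
    simp only [ht.1.2]

/-- The amplitude of the test state: on the words with two unmatched down steps of color `k`, the
position of the first one. -/
noncomputable def dropState (k : Fin s) (l : List (Spin s)) : ℂ :=
  if reduce [] l = [dn k, dn k] then (firstDrop [] l : ℂ) else 0

theorem dropState_of_up_mem {k j : Fin s} {l : List (Spin s)} (h : up j ∈ reduce [] l) :
    dropState k l = 0 := by
  rw [dropState, if_neg]
  intro h'
  rw [h'] at h
  simp [up, dn] at h

/-- Applied to U-moves and φ-moves: a peak that changes its color or passes an up step affects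
neither the stack nor the position of the first unmatched down step, so these moves cost no energy.
-/
theorem dropState_congr {k : Fin s} {x u v : List (Spin s)}
    (hr : ∀ st, reduce st u = reduce st v)
    (hf : ∀ st y, firstDrop st (u ++ y) = firstDrop st (v ++ y)) (y : List (Spin s)) :
    dropState k (x ++ u ++ y) = dropState k (x ++ v ++ y) := by
  have h1 : reduce [] (x ++ u ++ y) = reduce [] (x ++ v ++ y) := by simp [hr]
  have h2 : firstDrop [] (x ++ u ++ y) = firstDrop [] (x ++ v ++ y) := by
    rw [List.append_assoc, List.append_assoc]
    rcases firstDrop_append x [] with h | h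
    · rw [h, h]
    · rw [h, h, hf]
  rw [dropState, dropState, h1, h2]

/-- Only a peak that passes the first unmatched down step itself changes the amplitude, namely by 2,
the length of the peak. The bound is attached to the word with the peak in front, whose first drop
is at the last letter of the window. -/
theorem sq_norm_dropState_sub_le (k k₁ k₂ : Fin s) (x y : List (Spin s)) :
    ‖dropState k (x ++ [dn k₁, up k₂, dn k₂] ++ y) -
      dropState k (x ++ [up k₂, dn k₂, dn k₁] ++ y)‖ ^ 2 ≤
      4 * (if reduce [] (x ++ [up k₂, dn k₂, dn k₁] ++ y) = [dn k, dn k] then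
        (if firstDrop [] (x ++ [up k₂, dn k₂, dn k₁] ++ y) = x.length + 2 then 1 else 0)
        else 0) := by
  have h1 : reduce [] (x ++ [dn k₁, up k₂, dn k₂] ++ y) =
      reduce [] (x ++ [up k₂, dn k₂, dn k₁] ++ y) := by simp
  rw [dropState, dropState, h1]
  split_ifs with h2 h3
  · by_cases hx : reduce [] x = []
    · rcases firstDrop_append x [] with h | h
      · simp [List.append_assoc, h]
      · have e1 : firstDrop [] (x ++ [dn k₁, up k₂, dn k₂] ++ y) = x.length := by
          rw [List.append_assoc, h, hx]
          simp
        rw [e1, h3]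
        push_cast
        rw [show ((x.length : ℂ) - (x.length + 2)) = ((-2 : ℝ) : ℂ) by push_cast; ring,
          Complex.norm_real]
        norm_num
    · have e : firstDrop [] (x ++ [dn k₁, up k₂, dn k₂] ++ y) =
          firstDrop [] (x ++ [up k₂, dn k₂, dn k₁] ++ y) := by
        rw [List.append_assoc, List.append_assoc]
        rcases firstDrop_append x [] with h | h
        · rw [h, h]
        · rw [h, h]
          simp [firstDrop_dn hx]
      rw [e]
      simp
  · have e : firstDrop [] (x ++ [dn k₁, up k₂, dn k₂] ++ y) =
        firstDrop [] (x ++ [up k₂, dn k₂, dn k₁] ++ y) := by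
      rw [List.append_assoc] at h3 ⊢
      rw [List.append_assoc]
      rcases firstDrop_append x [] with h | h
      · rw [h, h]
      · rw [h] at h3
        rw [h, h]
        by_cases hx : reduce [] x = []
        · exfalso
          apply h3
          rw [hx]
          simp
          ring
        · simp [firstDrop_dn hx]
    rw [e]
    simp
  · simp

/-- The position of the first drop determines the window of a costly move, so each word is charged
at most once. A word starting with its first drop is never charged, as no peak precedes it. The
constant is 4 times the factor 1/2 of the projectors. -/
theorem energy_dropState_le (k : Fin s) {L : ℕ} (hL : 3 ≤ L) :
    energy s L (dropState k) ≤ 2 * ∑ l ∈ words s L,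
      (if reduce [] l = [dn k, dn k] then (if firstDrop [] l = 0 then (0 : ℝ) else 1) else 0) := by
  have hcross : crossEnergy s L (dropState k) = 0 := by
    rw [crossEnergy]
    refine Finset.sum_eq_zero fun j _ => Finset.sum_eq_zero fun k₁ _ =>
      Finset.sum_eq_zero fun k₂ _ => ?_
    split_ifs with h
    · refine Finset.sum_eq_zero fun x _ => Finset.sum_eq_zero fun y _ => ?_
      rw [dropState_of_up_mem (j := k₁)]
      · simp
      · simp [pushSpin_dn_up_ne _ h, reduce_dn_cons]
    · rfl
  -- A final up step remains on the stack. An initial down step is allowed by the reduction, but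
  -- then the first drop is at position 0, so the amplitude vanishes.
  have hbdry : boundaryEnergy s L (dropState k) = 0 := by
    rw [boundaryEnergy]
    refine Finset.sum_eq_zero fun j _ => ?_
    rw [Finset.sum_eq_zero, Finset.sum_eq_zero, add_zero]
    · intro x _
      rw [dropState_of_up_mem (j := j)]
      · simp
      · simp
    · intro y _
      simp [dropState]
  rw [energy, hcross, hbdry, add_zero, add_zero, bulkEnergy]
  have h1 : ∀ j : Fin (L - 2), ∑ k₁ : Fin s, ∑ k₂ : Fin s,
    (1 / 2 * ∑ x ∈ words s j, ∑ y ∈ words s (L - 3 - j),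
        ‖dropState k (x ++ [up k₁, up k₂, dn k₂] ++ y) -
          dropState k (x ++ [up k₂, dn k₂, up k₁] ++ y)‖ ^ 2
      + 1 / 2 * ∑ x ∈ words s j, ∑ y ∈ words s (L - 3 - j),
        ‖dropState k (x ++ [dn k₁, up k₂, dn k₂] ++ y) -
          dropState k (x ++ [up k₂, dn k₂, dn k₁] ++ y)‖ ^ 2
      + 1 / 2 * ∑ x ∈ words s j, ∑ y ∈ words s (L - 2 - j),
        ‖dropState k (x ++ [up k₁, dn k₁] ++ y) - dropState k (x ++ [up k₂, dn k₂] ++ y)‖ ^ 2) ≤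
      2 * ∑ l ∈ words s L, (if reduce [] l = [dn k, dn k] then
        (if firstDrop [] l = j + 2 then (1 : ℝ) else 0) else 0) := by
    intro j
    have hj := j.2
    have e1 : ∀ k₁ k₂ x y, dropState k (x ++ [up k₁, up k₂, dn k₂] ++ y) =
        dropState k (x ++ [up k₂, dn k₂, up k₁] ++ y) := fun k₁ k₂ x y =>
      dropState_congr (by simp) (by simp) y
    have e2 : ∀ k₁ k₂ x y, dropState k (x ++ [up k₁, dn k₁] ++ y) =
        dropState k (x ++ [up k₂, dn k₂] ++ y) := fun k₁ k₂ x y =>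
      dropState_congr (by simp) (by simp) y
    simp only [e1, sub_self]
    have e3 : ∀ k₁ k₂ : Fin s, (1 / 2 * ∑ x ∈ words s j, ∑ y ∈ words s (L - 3 - j),
        ‖(0 : ℂ)‖ ^ 2 + 1 / 2 * ∑ x ∈ words s j, ∑ y ∈ words s (L - 3 - j),
        ‖dropState k (x ++ [dn k₁, up k₂, dn k₂] ++ y) -
          dropState k (x ++ [up k₂, dn k₂, dn k₁] ++ y)‖ ^ 2
        + 1 / 2 * ∑ x ∈ words s j, ∑ y ∈ words s (L - 2 - j),
        ‖dropState k (x ++ [up k₁, dn k₁] ++ y) - dropState k (x ++ [up k₂, dn k₂] ++ y)‖ ^ 2) ≤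
        2 * ∑ x ∈ words s j, ∑ y ∈ words s (L - 3 - j),
        (if reduce [] (x ++ [up k₂, dn k₂, dn k₁] ++ y) = [dn k, dn k] then
        (if firstDrop [] (x ++ [up k₂, dn k₂, dn k₁] ++ y) = j + 2 then (1 : ℝ) else 0)
        else 0) := by
      intro k₁ k₂
      have e4 : ∀ x y, dropState k (x ++ [up k₁, dn k₁] ++ y) -
        dropState k (x ++ [up k₂, dn k₂] ++ y) = 0 := fun x y => by rw [e2 k₁ k₂, sub_self]
      simp only [e4, norm_zero]
      rw [Finset.sum_eq_zero (fun x _ => Finset.sum_eq_zero fun y _ => by norm_num),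
        Finset.sum_eq_zero (s := words s j) (f := fun x => ∑ y ∈ words s (L - 2 - j), (0 : ℝ) ^ 2)
          (fun x _ => Finset.sum_eq_zero fun y _ => by norm_num), mul_zero, zero_add, add_zero]
      rw [Finset.mul_sum, Finset.mul_sum]
      refine Finset.sum_le_sum fun x hx => ?_
      rw [Finset.mul_sum, Finset.mul_sum]
      refine Finset.sum_le_sum fun y _ => ?_
      have := sq_norm_dropState_sub_le k k₁ k₂ x y
      rw [mem_words.1 hx] at this
      linarith
    refine (Finset.sum_le_sum fun k₁ _ => Finset.sum_le_sum fun k₂ _ => e3 k₁ k₂).trans ?_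
    simp_rw [← Finset.mul_sum]
    refine mul_le_mul_of_nonneg_left ?_ (by norm_num)
    simp_rw [← Finset.sum_product']
    refine sum_comp_le_sum (fun t : Fin s × Fin s × List (Spin s) × List (Spin s) =>
      t.2.2.1 ++ [up t.2.1, dn t.2.1, dn t.1] ++ t.2.2.2) (fun l =>
      if reduce [] l = [dn k, dn k] then (if firstDrop [] l = j + 2 then (1 : ℝ) else 0) else 0)
      (fun l => by split_ifs <;> norm_num) ?_ ?_
    · rintro ⟨k₁, k₂, x, y⟩ ht
      simp only [Finset.mem_product, Finset.mem_univ, mem_words, true_and] at ht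
      simp only [mem_words, List.length_append, List.length_cons, List.length_nil]
      omega
    · rintro ⟨k₁, k₂, x, y⟩ ht ⟨k₁', k₂', x', y'⟩ ht' h
      simp only [Finset.coe_product, Set.mem_prod, Finset.mem_coe, mem_words] at ht ht'
      simp only [List.append_assoc] at h
      obtain ⟨a1, a2⟩ := List.append_inj h (ht.2.2.1.trans ht'.2.2.1.symm)
      simp only [List.cons_append, List.nil_append, List.cons.injEq, up_inj, dn_inj] at a1 a2
      rw [a1, a2.1, a2.2.2.1, a2.2.2.2]
  refine (Finset.sum_le_sum fun j _ => h1 j).trans ?_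
  rw [← Finset.mul_sum]
  refine mul_le_mul_of_nonneg_left ?_ (by norm_num)
  rw [Finset.sum_comm]
  refine Finset.sum_le_sum fun l _ => ?_
  split_ifs with hr h0
  · refine le_of_eq (Finset.sum_eq_zero fun j _ => ?_)
    rw [if_neg (by omega)]
  · rw [Finset.sum_boole]
    have : (Finset.univ.filter fun j : Fin (L - 2) => firstDrop [] l = j + 2).card ≤ 1 := by
      rw [Finset.card_le_one]
      intro a ha b hb
      have h1 := (Finset.mem_filter.1 ha).2
      have h2 := (Finset.mem_filter.1 hb).2
      exact Fin.ext (by omega)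
    exact_mod_cast this
  · simp

/-- The energy of the test state is of order `n⁻²`. -/
theorem energy_dropState_mul_le (k : Fin s) {n : ℕ} (hn : 2 ≤ n) :
    energy s (2 * n) (dropState k) * n ^ 2 ≤
      2 * ∑ l ∈ words s (2 * n), ‖dropState k l‖ ^ 2 := by
  obtain ⟨m, rfl⟩ : ∃ m, n = m + 1 := ⟨n - 1, by omega⟩
  have h1 := energy_dropState_le k (L := 2 * (m + 1)) (by omega)
  rw [sum_twoDrops k m fun i => if i = 0 then (0 : ℝ) else 1] at h1
  have h2 : ∑ l ∈ words s (2 * (m + 1)), ‖dropState k l‖ ^ 2 = (s : ℝ)⁻¹ *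
      ∑ i ∈ Finset.range (m + 1), ((2 * i : ℕ) : ℝ) ^ 2 *
        (numTrees s i * numTrees s (m + 1 - i)) := by
    rw [← sum_twoDrops k m fun i => (i : ℝ) ^ 2]
    refine Finset.sum_congr rfl fun l _ => ?_
    rw [dropState]
    split_ifs
    · rw [Complex.norm_natCast]
    · simp
  rw [h2]
  set a : ℕ → ℝ := fun i => numTrees s i * numTrees s (m + 1 - i) with ha
  have ha0 : ∀ i, 0 ≤ a i := fun i => by simp only [ha, numTrees]; positivity
  have h3 : ∑ i ∈ Finset.range (m + 1), (if 2 * i = 0 then (0 : ℝ) else 1) * a i =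
      ∑ i ∈ Finset.range m, a (i + 1) := by
    rw [Finset.sum_range_succ']
    simp
  have h4 : ∑ i ∈ Finset.range (m + 1), ((2 * i : ℕ) : ℝ) ^ 2 * a i =
      ∑ i ∈ Finset.range m, 4 * ((i : ℝ) + 1) ^ 2 * a (i + 1) := by
    rw [Finset.sum_range_succ']
    simp only [mul_zero, Nat.cast_zero, ne_eq, OfNat.ofNat_ne_zero, not_false_eq_true, zero_pow,
      zero_mul, add_zero]
    refine Finset.sum_congr rfl fun i _ => ?_
    push_cast
    ring
  -- The weights a(i) are symmetric under i ↦ m+1-i, so the position of the first drop may be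
  -- reflected.
  have h5 : ∑ i ∈ Finset.range m, 4 * ((i : ℝ) + 1) ^ 2 * a (i + 1) =
      ∑ i ∈ Finset.range m, 4 * ((m : ℝ) - i) ^ 2 * a (i + 1) := by
    rw [← Finset.sum_range_reflect]
    refine Finset.sum_congr rfl fun i hi => ?_
    have hi' := Finset.mem_range.1 hi
    have e1 : m - 1 - i + 1 = m + 1 - (i + 1) := by omega
    have e2 : a (m - 1 - i + 1) = a (i + 1) := by
      simp only [ha]
      rw [e1, Nat.sub_sub_self (by omega), mul_comm]
    have e3 : ((m - 1 - i : ℕ) : ℝ) + 1 = m - i := by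
      rw [show m - 1 - i = m - (i + 1) by omega, Nat.cast_sub (by omega)]
      push_cast
      ring
    rw [e2, e3]
  have h6 : ((m : ℝ) + 1) ^ 2 * ∑ i ∈ Finset.range m, a (i + 1) ≤
      ∑ i ∈ Finset.range m, 4 * ((i : ℝ) + 1) ^ 2 * a (i + 1) := by
    have h7 : ((m : ℝ) + 1) ^ 2 * ∑ i ∈ Finset.range m, a (i + 1) ≤
        1 / 2 * (∑ i ∈ Finset.range m, 4 * ((i : ℝ) + 1) ^ 2 * a (i + 1) +
          ∑ i ∈ Finset.range m, 4 * ((m : ℝ) - i) ^ 2 * a (i + 1)) := by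
      rw [← Finset.sum_add_distrib, Finset.mul_sum, Finset.mul_sum]
      refine Finset.sum_le_sum fun i _ => ?_
      -- The position and its reflection have sum m+1 = n, so the mean of their squares is at least
      -- n^2/4. No asymptotics of Catalan numbers are required.
      have h8 : ((m : ℝ) + 1) ^ 2 ≤ 1 / 2 * (4 * ((i : ℝ) + 1) ^ 2 + 4 * ((m : ℝ) - i) ^ 2) := by
        nlinarith [sq_nonneg (((i : ℝ) + 1) - (m - i))]
      have := mul_le_mul_of_nonneg_right h8 (ha0 (i + 1))
      linarith
    rw [← h5] at h7
    linarith
  rw [h3] at h1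
  rw [h4]
  have hs : (0 : ℝ) ≤ (s : ℝ)⁻¹ := by positivity
  push_cast
  calc energy s (2 * (m + 1)) (dropState k) * ((m : ℝ) + 1) ^ 2
      ≤ 2 * ((s : ℝ)⁻¹ * ∑ i ∈ Finset.range m, a (i + 1)) * ((m : ℝ) + 1) ^ 2 := by gcongr
    _ = 2 * ((s : ℝ)⁻¹ * (((m : ℝ) + 1) ^ 2 * ∑ i ∈ Finset.range m, a (i + 1))) := by ring
    _ ≤ _ := by gcongr

end Fredkin

namespace Fredkin

open CTree

/-! ### Invariance of the balanced subspace -/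

section Invariance

variable {s L m : ℕ} {e : Fin m → Fin L}

/-- A local operator only connects words with the same reduction, if all local words it involves
have the same reduction. -/
theorem reduce_eq_of_onSites_ne_zero {j r : ℕ} (hL : L = j + m + r) (he : ∀ i, (e i : ℕ) = j + i)
    (v : Config s m → ℂ)
    (hv : ∀ a b, v a ≠ 0 → v b ≠ 0 → ∀ st, reduce st (List.ofFn a) = reduce st (List.ofFn b))
    {x y : Config s L} (h : onSites e (ketbra v) x y ≠ 0) :
    reduce [] (List.ofFn x) = reduce [] (List.ofFn y) := by
  have hinj := sites_injective he
  rw [onSites, Matrix.of_apply] at h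
  split_ifs at h with hxy
  · have h1 : v (x ∘ e) ≠ 0 ∧ v (y ∘ e) ≠ 0 := by
      rw [ketbra, Matrix.vecMulVec_apply] at h
      refine ⟨left_ne_zero_of_mul h, fun h0 => right_ne_zero_of_mul h ?_⟩
      rw [Pi.star_apply, h0, star_zero]
    have hy : y = Function.extend e (y ∘ e) x := by
      funext i
      by_cases hi : ∃ a, e a = i
      · obtain ⟨a, rfl⟩ := hi
        rw [hinj.extend_apply]; rfl
      · rw [Function.extend_apply' _ _ _ hi]
        exact (hxy i (by simpa using hi)).symm
    rw [hy, ofFn_extend hL he]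
    conv_lhs => rw [← extend_comp_self_sites hinj x, ofFn_extend hL he]
    simp only [reduce_append, hv _ _ h1.1 h1.2]
  · exact absurd rfl h

theorem mem_of_smul_sub_ket_ne_zero {α β a : Config s m} {c : ℂ}
    (h : (c • (ket α - ket β)) a ≠ 0) : a = α ∨ a = β := by
  by_contra! hne
  apply h
  simp [ket, hne.1, hne.2]

theorem reduce_eq_of_sub_ne_zero {j r : ℕ} (hL : L = j + m + r) (he : ∀ i, (e i : ℕ) = j + i)
    {α β : Config s m} {c : ℂ}
    (hαβ : ∀ st, reduce st (List.ofFn α) = reduce st (List.ofFn β))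
    {x y : Config s L} (h : onSites e (ketbra (c • (ket α - ket β))) x y ≠ 0) :
    reduce [] (List.ofFn x) = reduce [] (List.ofFn y) := by
  refine reduce_eq_of_onSites_ne_zero hL he _ ?_ h
  intro a b ha hb st
  rcases mem_of_smul_sub_ket_ne_zero ha with rfl | rfl <;>
    rcases mem_of_smul_sub_ket_ne_zero hb with rfl | rfl <;> simp [hαβ]

theorem reduce_eq_of_ket_ne_zero {j r : ℕ} (hL : L = j + m + r) (he : ∀ i, (e i : ℕ) = j + i)
    {α : Config s m} {x y : Config s L} (h : onSites e (ketbra (ket α)) x y ≠ 0) :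
    reduce [] (List.ofFn x) = reduce [] (List.ofFn y) := by
  refine reduce_eq_of_onSites_ne_zero hL he _ ?_ h
  intro a b ha hb st
  have h1 : ∀ a : Config s m, ket α a ≠ 0 → a = α := fun a ha => by
    by_contra hne
    exact ha (by simp [ket, hne])
  rw [h1 a ha, h1 b hb]

/-- The two words in each of U, D and φ have the same effect on every stack, and the penalties are
diagonal. The whole reduced word is conserved, not only its emptiness. -/
theorem reduce_eq_of_hamiltonian_ne_zero {n : ℕ} {x y : Config s (2 * n)}
    (h : hamiltonian s n x y ≠ 0) : reduce [] (List.ofFn x) = reduce [] (List.ofFn y) := by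
  by_contra hne
  apply h
  rw [hamiltonian, Matrix.add_apply, Matrix.add_apply, Matrix.sum_apply, Matrix.sum_apply,
    Finset.sum_eq_zero, Finset.sum_eq_zero, boundaryTerm]
  · split_ifs with h0
    · rw [Matrix.sum_apply, Finset.sum_eq_zero, add_zero, add_zero]
      intro k _
      rw [Matrix.add_apply]
      have t1 : onSites ![(⟨0, h0⟩ : Fin (2 * n))] (ketbra (ket ![dn k])) x y = 0 := by
        by_contra hh
        exact hne (reduce_eq_of_ket_ne_zero (j := 0) (r := 2 * n - 1) (by omega)
          (fun i => by fin_cases i; rfl) hh)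
      have t2 : onSites ![(⟨2 * n - 1, by omega⟩ : Fin (2 * n))] (ketbra (ket ![up k])) x y = 0 := by
        by_contra hh
        exact hne (reduce_eq_of_ket_ne_zero (j := 2 * n - 1) (r := 0) (by omega)
          (fun i => by fin_cases i; rfl) hh)
      rw [t1, t2, add_zero]
    · simp
  · intro j _
    have hj := j.2
    rw [crossTerm, Matrix.sum_apply]
    refine Finset.sum_eq_zero fun k₁ _ => ?_
    rw [Matrix.sum_apply]
    refine Finset.sum_eq_zero fun k₂ _ => ?_
    split_ifs
    · by_contra hh
      exact hne (reduce_eq_of_ket_ne_zero (j := j) (r := 2 * n - 2 - j) (by omega)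
        (fun i => by fin_cases i <;> rfl) hh)
    · rfl
  · intro j _
    have hj := j.2
    rw [bulkTerm, Matrix.sum_apply]
    refine Finset.sum_eq_zero fun k₁ _ => ?_
    rw [Matrix.sum_apply]
    refine Finset.sum_eq_zero fun k₂ _ => ?_
    rw [Matrix.add_apply, Matrix.add_apply]
    have t1 : onSites ![(⟨j, by omega⟩ : Fin (2 * n)), ⟨j + 1, by omega⟩, ⟨j + 2, by omega⟩]
        (ketbra (vecU k₁ k₂)) x y = 0 := by
      by_contra hh
      exact hne (reduce_eq_of_sub_ne_zero (j := j) (r := 2 * n - 3 - j) (by omega)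
        (fun i => by fin_cases i <;> rfl) (by simp [List.ofFn_succ]) hh)
    have t2 : onSites ![(⟨j, by omega⟩ : Fin (2 * n)), ⟨j + 1, by omega⟩, ⟨j + 2, by omega⟩]
        (ketbra (vecD k₁ k₂)) x y = 0 := by
      by_contra hh
      exact hne (reduce_eq_of_sub_ne_zero (j := j) (r := 2 * n - 3 - j) (by omega)
        (fun i => by fin_cases i <;> rfl) (by simp [List.ofFn_succ]) hh)
    have t3 : onSites ![(⟨j, by omega⟩ : Fin (2 * n)), ⟨j + 1, by omega⟩]
        (ketbra (vecPhi k₁ k₂)) x y = 0 := by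
      by_contra hh
      exact hne (reduce_eq_of_sub_ne_zero (j := j) (r := 2 * n - 2 - j) (by omega)
        (fun i => by fin_cases i <;> rfl) (by simp [List.ofFn_succ]) hh)
    rw [t1, t2, t3, add_zero, add_zero]

theorem isBalanced_iff {x : Config s L} : IsBalanced x ↔ reduce [] (List.ofFn x) = [] :=
  isColoredDyck_iff

theorem hamiltonian_invariant (s n : ℕ) (x y : Config s (2 * n)) (hx : IsBalanced x)
    (hy : ¬ IsBalanced y) : hamiltonian s n x y = 0 ∧ hamiltonian s n y x = 0 := by
  rw [isBalanced_iff] at hx hy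
  constructor
  · by_contra h
    exact hy ((reduce_eq_of_hamiltonian_ne_zero h).symm.trans hx)
  · by_contra h
    exact hy ((reduce_eq_of_hamiltonian_ne_zero h).trans hx)

end Invariance

/-! ### Decomposition of the quadratic form -/

open Classical in
theorem qform_split {ι : Type*} [Fintype ι] {A : Matrix ι ι ℂ} {P : ι → Prop}
    (hP : ∀ x y, P x → ¬ P y → A x y = 0 ∧ A y x = 0) (f : ι → ℂ) :
    qform A f = qform A (fun x => if P x then f x else 0) +
      qform A (fun x => if P x then 0 else f x) := by
  rw [qform, qform, qform, ← Complex.add_re]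
  congr 1
  simp only [dotProduct, Matrix.mulVec, Finset.mul_sum]
  rw [← Finset.sum_add_distrib]
  refine Finset.sum_congr rfl fun x _ => ?_
  rw [← Finset.sum_add_distrib]
  refine Finset.sum_congr rfl fun y _ => ?_
  simp only [Pi.star_apply]
  by_cases hx : P x <;> by_cases hy : P y
  · simp [hx, hy]
  · simp [hx, hy, (hP x y hx hy).1]
  · simp [hx, hy, (hP y x hy hx).2]
  · simp [hx, hy]

theorem qform_submatrix {ι : Type*} [Fintype ι] {P : ι → Prop} [DecidablePred P]
    (A : Matrix ι ι ℂ) (f : {x // P x} → ℂ) :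
    qform (A.submatrix Subtype.val Subtype.val) f =
      qform A (fun x => if h : P x then f ⟨x, h⟩ else 0) := by
  have key : ∀ g : ι → ℂ, (∀ x, ¬ P x → g x = 0) → ∑ x, g x = ∑ x : {x // P x}, g x := by
    intro g hg
    rw [← Finset.sum_filter_add_sum_filter_not Finset.univ P g,
      Finset.sum_eq_zero (s := Finset.univ.filter fun x => ¬ P x)
        (fun x hx => hg x (Finset.mem_filter.1 hx).2), add_zero]
    exact Finset.sum_subtype _ (by simp) g
  rw [qform, qform]
  congr 1
  simp only [dotProduct, Matrix.mulVec, Matrix.submatrix_apply]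
  rw [key]
  · refine Finset.sum_congr rfl fun x _ => ?_
    rw [key]
    · simp only [Pi.star_apply, dif_pos x.2, Subtype.coe_eta]
      congr 1
      exact Finset.sum_congr rfl fun y _ => by rw [dif_pos y.2]
    · intro y hy
      simp [hy]
  · intro x hx
    simp [hx]

/-! ### Bounds for states supported in one of the two subspaces -/

variable {s n : ℕ}

/-- The function on words that extends a function on configurations. -/
noncomputable def listExtend {L : ℕ} (f : Config s L → ℂ) : List (Spin s) → ℂ :=
  Function.extend List.ofFn f 0

theorem listExtend_ofFn {L : ℕ} (f : Config s L → ℂ) (z : Config s L) :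
    listExtend f (List.ofFn z) = f z :=
  List.ofFn_injective.extend_apply f 0 z

theorem qform_eq_energy (hn : 1 ≤ n) (f : Config s (2 * n) → ℂ) :
    qform (hamiltonian s n) f = energy s (2 * n) (listExtend f) := by
  rw [← qform_hamiltonian hn]
  simp only [listExtend_ofFn]

theorem qform_hamiltonian_nonneg (hn : 1 ≤ n) (f : Config s (2 * n) → ℂ) :
    0 ≤ qform (hamiltonian s n) f := by
  rw [qform_eq_energy hn]
  exact energy_nonneg _ _ _

open Classical in
theorem sum_trees_word {M : Type*} [AddCommMonoid M] (g : List (Spin s) → M) :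
    ∑ w ∈ trees s n, g w.word =
      ∑ z : Config s (2 * n), if IsBalanced z then g (List.ofFn z) else 0 := by
  have h1 := sum_ofFn (s := s) (L := 2 * n) fun l => if IsColoredDyck l then g l else 0
  change _ = ∑ z : Config s (2 * n), if IsColoredDyck (List.ofFn z) then g (List.ofFn z) else 0
  rw [h1, ← Finset.sum_filter]
  refine Finset.sum_bij (fun w _ => w.word) ?_ ?_ ?_ ?_
  · intro w hw
    rw [Finset.mem_filter, mem_words, length_word, mem_trees.1 hw]
    exact ⟨rfl, isColoredDyck_word w⟩
  · intro w _ w' _ h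
    exact word_injective h
  · intro l hl
    rw [Finset.mem_filter, mem_words] at hl
    obtain ⟨w, rfl⟩ := hl.2.exists_word
    rw [length_word] at hl
    exact ⟨w, mem_trees.2 (by omega), rfl⟩
  · intro w _
    rfl

open Classical in
theorem qform_balanced_ge (hs : 1 ≤ s) (hn : 2 ≤ n) (f : Config s (2 * n) → ℂ)
    (hf : ∀ z, ¬ IsBalanced z → f z = 0) (h0 : ∑ z, f z = 0) :
    ∑ z, ‖f z‖ ^ 2 ≤ 1024 * n ^ 7 * qform (hamiltonian s n) f := by
  have h1 := balanced_poincare hs hn (listExtend f) (by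
    rw [sum_trees_word]
    refine Eq.trans (Finset.sum_congr rfl fun z _ => ?_) h0
    split_ifs with hz
    · exact listExtend_ofFn f z
    · exact (hf z hz).symm)
  rw [qform_eq_energy (by omega)]
  refine le_trans (le_of_eq ?_) h1
  rw [sum_trees_word fun l => ‖listExtend f l‖ ^ 2]
  refine Finset.sum_congr rfl fun z _ => ?_
  split_ifs with hz
  · rw [listExtend_ofFn]
  · simp [hf z hz]

theorem qform_unbalanced_ge (hs : 1 ≤ s) (hn : 2 ≤ n) (f : Config s (2 * n) → ℂ)
    (hf : ∀ z, IsBalanced z → f z = 0) :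
    ∑ z, ‖f z‖ ^ 2 ≤ 8200 * n ^ 9 * qform (hamiltonian s n) f := by
  classical
  rw [qform_eq_energy (by omega)]
  refine le_trans (le_of_eq ?_) (unbalanced_energy_bound hs hn (listExtend f))
  rw [Finset.sum_filter, ← sum_ofFn]
  refine Finset.sum_congr rfl fun z _ => ?_
  split_ifs with hz
  · simp [hf z hz]
  · rw [listExtend_ofFn]

open Classical in
/-- The unnormalized ground state: the sum of all balanced words. -/
noncomputable def groundState (s n : ℕ) (z : Config s (2 * n)) : ℂ := if IsBalanced z then 1 else 0

-- The amplitude is a function of the reduced word, so all differences in the bulk vanish. Every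
-- penalized word has a nonempty reduction and thus amplitude zero.
open Classical in
theorem qform_groundState (hn : 1 ≤ n) : qform (hamiltonian s n) (groundState s n) = 0 := by
  set F : List (Spin s) → ℂ := fun l => if reduce [] l = [] then 1 else 0 with hF
  have h1 : groundState s n = fun z => F (List.ofFn z) := by
    funext z
    simp only [groundState, hF, isBalanced_iff]
  have h2 : ∀ x u v y : List (Spin s), (∀ st, reduce st u = reduce st v) →
      ‖F (x ++ u ++ y) - F (x ++ v ++ y)‖ ^ 2 = 0 := by
    intro x u v y huv
    simp [hF, huv]
  rw [h1, qform_hamiltonian hn, energy, bulkEnergy, crossEnergy, boundaryEnergy]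
  rw [Finset.sum_eq_zero, Finset.sum_eq_zero, Finset.sum_eq_zero, add_zero, add_zero]
  · intro k _
    rw [Finset.sum_eq_zero, Finset.sum_eq_zero, add_zero]
    · intro x _
      simp [hF]
    · intro y _
      simp [hF, reduce_dn_cons]
  · intro j _
    refine Finset.sum_eq_zero fun k₁ _ => Finset.sum_eq_zero fun k₂ _ => ?_
    split_ifs with h
    · refine Finset.sum_eq_zero fun x _ => Finset.sum_eq_zero fun y _ => ?_
      simp [hF, pushSpin_dn_up_ne _ h, reduce_dn_cons]
    · rfl
  · intro j _
    refine Finset.sum_eq_zero fun k₁ _ => Finset.sum_eq_zero fun k₂ _ => ?_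
    have z1 : ∀ r, ∑ x ∈ words s j, ∑ y ∈ words s r,
        ‖F (x ++ [up k₁, up k₂, dn k₂] ++ y) - F (x ++ [up k₂, dn k₂, up k₁] ++ y)‖ ^ 2 = 0 :=
      fun r => Finset.sum_eq_zero fun x _ => Finset.sum_eq_zero fun y _ => h2 x _ _ y (by simp)
    have z2 : ∀ r, ∑ x ∈ words s j, ∑ y ∈ words s r,
        ‖F (x ++ [dn k₁, up k₂, dn k₂] ++ y) - F (x ++ [up k₂, dn k₂, dn k₁] ++ y)‖ ^ 2 = 0 :=
      fun r => Finset.sum_eq_zero fun x _ => Finset.sum_eq_zero fun y _ => h2 x _ _ y (by simp)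
    have z3 : ∀ r, ∑ x ∈ words s j, ∑ y ∈ words s r,
        ‖F (x ++ [up k₁, dn k₁] ++ y) - F (x ++ [up k₂, dn k₂] ++ y)‖ ^ 2 = 0 :=
      fun r => Finset.sum_eq_zero fun x _ => Finset.sum_eq_zero fun y _ => h2 x _ _ y (by simp)
    rw [z1, z2, z3]
    norm_num

theorem two_le_numTrees (hs : 1 ≤ s) (hn : 2 ≤ n) : 2 ≤ numTrees s n := by
  have hs' : (1 : ℝ) ≤ s := by exact_mod_cast hs
  induction n, hn using Nat.le_induction with
  | base =>
    rw [numTrees_eq, catalan_two]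
    have : (1 : ℝ) ≤ (s : ℝ) ^ 2 := one_le_pow₀ hs'
    push_cast
    linarith
  | succ m _ ih =>
    refine le_trans ?_ (le_numTrees_succ s m)
    nlinarith

open Classical in
theorem two_le_card_balanced (hs : 1 ≤ s) (hn : 2 ≤ n) :
    2 ≤ Fintype.card {x : Config s (2 * n) // IsBalanced x} := by
  have h1 := sum_trees_word (s := s) (n := n) fun _ => (1 : ℝ)
  rw [Finset.sum_const, nsmul_one, Finset.sum_boole, ← Fintype.card_subtype] at h1
  have h2 := two_le_numTrees hs hn
  rw [numTrees, h1] at h2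
  exact_mod_cast h2

theorem two_le_card_config (hs : 1 ≤ s) (hn : 2 ≤ n) : 2 ≤ Fintype.card (Config s (2 * n)) := by
  classical
  exact (two_le_card_balanced hs hn).trans (Fintype.card_subtype_le _)

theorem groundState_ne_zero (hs : 1 ≤ s) (hn : 2 ≤ n) : groundState s n ≠ 0 := by
  classical
  have h := two_le_card_balanced hs hn
  have : Nonempty {x : Config s (2 * n) // IsBalanced x} := Fintype.card_pos_iff.1 (by omega)
  obtain ⟨x, hx⟩ := this
  exact Function.ne_iff.2 ⟨x, by simp [groundState, hx]⟩

/-! ### The bounds -/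

theorem balancedGap_ge (hs : 1 ≤ s) (hn : 2 ≤ n) : (1024 * (n : ℝ) ^ 7)⁻¹ ≤ balancedGap s n := by
  classical
  have hpos : 0 < 1024 * (n : ℝ) ^ 7 := by positivity
  have hsum : ∀ f : {x : Config s (2 * n) // IsBalanced x} → ℂ, ∀ h : ℂ → ℂ, h 0 = 0 →
      ∑ z, h (if hz : IsBalanced z then f ⟨z, hz⟩ else 0) = ∑ x, h (f x) := by
    intro f h h0
    rw [← Finset.sum_filter_add_sum_filter_not Finset.univ IsBalanced,
      Finset.sum_eq_zero (s := Finset.univ.filter fun x => ¬ IsBalanced x) (fun x hx => by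
        rw [dif_neg (Finset.mem_filter.1 hx).2, h0]), add_zero,
      Finset.sum_subtype (p := IsBalanced) _ (by simp)]
    exact Finset.sum_congr rfl fun x _ => by rw [dif_pos x.2]
  unfold balancedGap
  -- On the balanced subspace the ground state is the constant vector, and orthogonality to it is
  -- the mean-zero condition of the Poincaré inequality.
  refine le_gap _ (by convert two_le_card_balanced hs hn) (fun _ => 1) ?_ ?_ ?_
  · have h := two_le_card_balanced hs hn
    have : Nonempty {x : Config s (2 * n) // IsBalanced x} := Fintype.card_pos_iff.1 (by omega)
    obtain ⟨x⟩ := this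
    exact Function.ne_iff.2 ⟨x, one_ne_zero⟩
  · rw [qform_submatrix]
    refine le_of_eq (Eq.trans ?_ (qform_groundState (s := s) (n := n) (by omega)))
    congr 1
  · intro f hf
    rw [qform_submatrix]
    have h0 : ∑ x, f x = 0 := by
      rw [← hf]
      simp [dotProduct]
    have h1 := qform_balanced_ge hs hn (fun z => if hz : IsBalanced z then f ⟨z, hz⟩ else 0)
      (fun z hz => by simp [hz]) ((hsum f id rfl).trans h0)
    have h2 : ∑ z : Config s (2 * n), ‖if hz : IsBalanced z then f ⟨z, hz⟩ else 0‖ ^ 2 =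
        ∑ x, ‖f x‖ ^ 2 := by
      have := hsum f (fun z => ((‖z‖ ^ 2 : ℝ) : ℂ)) (by simp)
      exact_mod_cast this
    rw [h2] at h1
    rwa [inv_mul_le_iff₀ hpos]

theorem unbalancedGroundEnergy_ge (hs : 1 ≤ s) (hn : 2 ≤ n) :
    (8200 * (n : ℝ) ^ 9)⁻¹ ≤ unbalancedGroundEnergy s n := by
  classical
  have hpos : 0 < 8200 * (n : ℝ) ^ 9 := by positivity
  have hne : Nonempty {x : Config s (2 * n) // ¬ IsBalanced x} := by
    refine ⟨fun _ => dn ⟨0, hs⟩, ?_⟩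
    rw [isBalanced_iff]
    obtain ⟨m, hm⟩ : ∃ m, 2 * n = m + 1 := ⟨2 * n - 1, by omega⟩
    rw [hm, List.ofFn_succ]
    simp [reduce_dn_cons]
  unfold unbalancedGroundEnergy
  refine le_groundEnergy _ fun f => ?_
  rw [qform_submatrix]
  have h1 := qform_unbalanced_ge hs hn (fun z => if hz : ¬ IsBalanced z then f ⟨z, hz⟩ else 0)
    (fun z hz => by simp [hz])
  have h2 : ∑ z : Config s (2 * n), ‖if hz : ¬ IsBalanced z then f ⟨z, hz⟩ else 0‖ ^ 2 =
      ∑ x, ‖f x‖ ^ 2 := by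
    rw [← Finset.sum_filter_add_sum_filter_not Finset.univ (fun z => ¬ IsBalanced z),
      Finset.sum_eq_zero (s := Finset.univ.filter fun x => ¬ ¬ IsBalanced x) (fun x hx => by
        rw [dif_neg (Finset.mem_filter.1 hx).2]; simp), add_zero,
      Finset.sum_subtype (p := fun z => ¬ IsBalanced z) _ (by simp)]
    exact Finset.sum_congr rfl fun x _ => by rw [dif_pos x.2]
  rw [h2] at h1
  rwa [inv_mul_le_iff₀ hpos]

/-- There are no cross terms between the two subspaces. Orthogonality to the ground state constrains
the balanced part only, which is handled by the Poincaré inequality; the unbalanced part needs no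
condition and determines the constant. -/
theorem chainGap_ge (hs : 1 ≤ s) (hn : 2 ≤ n) : (8200 * (n : ℝ) ^ 9)⁻¹ ≤ chainGap s n := by
  classical
  have hpos : 0 < 8200 * (n : ℝ) ^ 9 := by positivity
  refine le_gap _ (two_le_card_config hs hn) (groundState s n) (groundState_ne_zero hs hn)
    (qform_groundState (by omega)).le ?_
  intro f hf
  rw [inv_mul_le_iff₀ hpos, qform_split (hamiltonian_invariant s n) f]
  have h0 : ∑ z, (if IsBalanced z then f z else 0) = 0 := by
    refine Eq.trans (Finset.sum_congr rfl fun z _ => ?_) hf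
    by_cases hz : IsBalanced z <;> simp [groundState, hz]
  have h1 := qform_balanced_ge hs hn (fun z => if IsBalanced z then f z else 0)
    (fun z hz => by simp [hz]) h0
  have h2 := qform_unbalanced_ge hs hn (fun z => if IsBalanced z then 0 else f z)
    (fun z hz => by simp [hz])
  have h3 : ∑ z, ‖f z‖ ^ 2 = ∑ z, ‖if IsBalanced z then f z else 0‖ ^ 2 +
      ∑ z, ‖if IsBalanced z then 0 else f z‖ ^ 2 := by
    rw [← Finset.sum_add_distrib]
    refine Finset.sum_congr rfl fun z _ => ?_
    split_ifs <;> simp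
  have h4 : 1024 * (n : ℝ) ^ 7 ≤ 8200 * (n : ℝ) ^ 9 := by
    have : (n : ℝ) ^ 7 ≤ (n : ℝ) ^ 9 :=
      pow_le_pow_right₀ (by exact_mod_cast (by omega : 1 ≤ n)) (by norm_num)
    nlinarith [pow_nonneg (Nat.cast_nonneg (α := ℝ) n) 9]
  have h5 := mul_le_mul_of_nonneg_right h4 (qform_hamiltonian_nonneg (s := s) (n := n) (by omega)
    (fun z => if IsBalanced z then f z else 0))
  rw [h3, mul_add]
  linarith

/-- The ground state and the test state have disjoint supports in different invariant subspaces, so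
the form and the squared norm are additive on their span. Only the test state contributes energy. -/
theorem chainGap_le (hs : 1 ≤ s) (hn : 2 ≤ n) : chainGap s n ≤ 2 / (n : ℝ) ^ 2 := by
  classical
  have hn0 : (0 : ℝ) < (n : ℝ) ^ 2 := by
    have : (0 : ℝ) < n := by exact_mod_cast (by omega : 0 < n)
    positivity
  set k : Fin s := ⟨0, hs⟩
  set φ : Config s (2 * n) → ℂ := fun z => dropState k (List.ofFn z) with hφ
  have hψb : ∀ z, ¬ IsBalanced z → groundState s n z = 0 := fun z hz => by simp [groundState, hz]
  have hφb : ∀ z, IsBalanced z → φ z = 0 := fun z hz => by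
    rw [isBalanced_iff] at hz
    simp [hφ, dropState, hz]
  have hφ0 : ∃ z, φ z ≠ 0 := by
    obtain ⟨t, ht⟩ : ∃ t : CTree s, t ∈ trees s (n - 1) := by
      have := numTrees_pos hs (n - 1)
      rw [numTrees, Nat.cast_pos, Finset.card_pos] at this
      exact this
    rw [mem_trees] at ht
    -- The test state is nonzero: with n-1 nodes in front of the first drop the amplitude is 2(n-1),
    -- positive because n ≥ 2.
    have hlen : twoDrops k (t, nil, nil) ∈ words s (2 * n) := by
      rw [mem_words, length_twoDrops]
      simp only [ht, size]
      omega
    obtain ⟨z, -, hz⟩ := Finset.mem_image.1 hlen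
    refine ⟨z, ?_⟩
    simp only [hφ]
    rw [hz, dropState, if_pos (reduce_twoDrops _ _), firstDrop_twoDrops]
    simp only [ht]
    exact_mod_cast (by omega : 2 * (n - 1) ≠ 0)
  have hψ0 : ∃ z, groundState s n z ≠ 0 := Function.ne_iff.1 (groundState_ne_zero hs hn)
  have e1 : ∀ a b : ℂ, (fun z => if IsBalanced z then (a • groundState s n + b • φ) z else 0) =
      a • groundState s n := by
    intro a b
    funext z
    by_cases hz : IsBalanced z
    · simp [hz, hφb z hz]
    · simp [hz, hψb z hz]
  have e2 : ∀ a b : ℂ, (fun z => if IsBalanced z then 0 else (a • groundState s n + b • φ) z) =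
      b • φ := by
    intro a b
    funext z
    by_cases hz : IsBalanced z
    · simp [hz, hφb z hz]
    · simp [hz, hψb z hz]
  have e3 : ∀ (a : ℂ) (f : Config s (2 * n) → ℂ),
      qform (hamiltonian s n) (a • f) = ‖a‖ ^ 2 * qform (hamiltonian s n) f := by
    intro a f
    rw [qform, qform, Matrix.mulVec_smul, star_smul, smul_dotProduct, dotProduct_smul, smul_smul,
      smul_eq_mul, Complex.star_def, Complex.conj_mul', ← Complex.ofReal_pow,
      Complex.re_ofReal_mul]
  refine gap_le _ (two_le_card_config hs hn) (fun f => qform_hamiltonian_nonneg (by omega) f)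
    (groundState s n) φ ?_ ?_
  · intro a b hab
    constructor
    · obtain ⟨z, hz⟩ := hψ0
      have hzb : IsBalanced z := by
        by_contra h
        exact hz (hψb z h)
      have := congrFun hab z
      simpa [hφb z hzb, hz] using this
    · obtain ⟨z, hz⟩ := hφ0
      have hzb : ¬ IsBalanced z := fun h => hz (hφb z h)
      have := congrFun hab z
      simpa [hψb z hzb, hz] using this
  · intro a b
    rw [qform_split (hamiltonian_invariant s n), e1, e2, e3, e3, qform_groundState (by omega),
      mul_zero, zero_add]
    have h1 := energy_dropState_mul_le k hn
    rw [← sum_ofFn fun l => ‖dropState k l‖ ^ 2, ← qform_hamiltonian (by omega)] at h1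
    change qform _ φ * _ ≤ 2 * ∑ z, ‖φ z‖ ^ 2 at h1
    have h2 : ‖b‖ ^ 2 * ∑ z, ‖φ z‖ ^ 2 ≤ ∑ z, ‖(a • groundState s n + b • φ) z‖ ^ 2 := by
      rw [Finset.mul_sum]
      refine Finset.sum_le_sum fun z _ => ?_
      by_cases hz : IsBalanced z
      · rw [hφb z hz]
        simp
      · simp [hψb z hz, mul_pow]
    have h3 : qform (hamiltonian s n) φ ≤ 2 / (n : ℝ) ^ 2 * ∑ z, ‖φ z‖ ^ 2 := by
      rw [div_mul_eq_mul_div, le_div_iff₀ hn0]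
      exact h1
    calc ‖b‖ ^ 2 * qform (hamiltonian s n) φ
        ≤ ‖b‖ ^ 2 * (2 / (n : ℝ) ^ 2 * ∑ z, ‖φ z‖ ^ 2) := by gcongr
      _ = 2 / (n : ℝ) ^ 2 * (‖b‖ ^ 2 * ∑ z, ‖φ z‖ ^ 2) := by ring
      _ ≤ _ := by gcongr

end Fredkin

/-! ### The bounds with explicit constants and real exponents -/

theorem mainTheorem1 :
    -- the balanced and the unbalanced subspace are invariant under the Hamiltonian
    (∀ (s n : ℕ) (x y : Fredkin.Config s (2 * n)), Fredkin.IsBalanced x → ¬ Fredkin.IsBalanced y →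
      Fredkin.hamiltonian s n x y = 0 ∧ Fredkin.hamiltonian s n y x = 0) ∧
    -- the gap is polynomially small: at most of order `n⁻²`, at least of order `n⁻ᵃ`
    (∃ c C a : ℝ, 0 < c ∧ 0 < C ∧ 2 ≤ a ∧ ∀ s n : ℕ, 1 ≤ s → 2 ≤ n →
      c * (n : ℝ) ^ (-a) ≤ Fredkin.chainGap s n ∧
        Fredkin.chainGap s n ≤ C * (n : ℝ) ^ (-2 : ℝ)) ∧
    -- the gap in the balanced subspace
    (∃ c : ℝ, 0 < c ∧ ∀ s : ℕ, 1 ≤ s →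
      (∀ n : ℕ, 2 ≤ n → c * (n : ℝ) ^ (-(15 / 2) : ℝ) ≤ Fredkin.balancedGap s n) ∧
        ∀ᶠ n : ℕ in atTop, c * s * (n : ℝ) ^ (-(15 / 2) : ℝ) ≤ Fredkin.balancedGap s n) ∧
    -- the ground energy in the unbalanced subspace
    (∃ c a : ℝ, 0 < c ∧ 0 < a ∧ ∀ s n : ℕ, 1 ≤ s → 2 ≤ n →
      c * (n : ℝ) ^ (-a) ≤ Fredkin.unbalancedGroundEnergy s n) := by
  have hpow : ∀ (n m : ℕ), (n : ℝ) ^ (-(m : ℝ)) = ((n : ℝ) ^ m)⁻¹ := fun n m => by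
    rw [Real.rpow_neg (Nat.cast_nonneg n), Real.rpow_natCast]
  have hnine : ∀ n : ℕ, 1 / 8200 * (n : ℝ) ^ (-9 : ℝ) = (8200 * (n : ℝ) ^ 9)⁻¹ := fun n => by
    rw [show (-9 : ℝ) = -((9 : ℕ) : ℝ) by norm_num, hpow, mul_inv, one_div]
  have hhalf : ∀ n : ℕ, 1 ≤ n → (n : ℝ) ^ (-(15 / 2) : ℝ) = ((n : ℝ) ^ 7)⁻¹ * (√n)⁻¹ := by
    intro n hn
    have hn0 : (0 : ℝ) < n := by exact_mod_cast hn
    rw [show (-(15 / 2) : ℝ) = -((7 : ℕ) : ℝ) + -(1 / 2) by norm_num, Real.rpow_add hn0, hpow,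
      Real.rpow_neg hn0.le, Real.sqrt_eq_rpow]
  refine ⟨Fredkin.hamiltonian_invariant, ⟨1 / 8200, 2, 9, by norm_num, by norm_num, by norm_num,
    fun s n hs hn => ⟨?_, ?_⟩⟩, ⟨1 / 1024, by norm_num, fun s hs => ⟨fun n hn => ?_, ?_⟩⟩,
    ⟨1 / 8200, 9, by norm_num, by norm_num, fun s n hs hn => ?_⟩⟩
  · rw [hnine]
    exact Fredkin.chainGap_ge hs hn
  · refine (Fredkin.chainGap_le hs hn).trans (le_of_eq ?_)
    rw [show (-2 : ℝ) = -((2 : ℕ) : ℝ) by norm_num, hpow, div_eq_mul_inv]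
  · refine le_trans ?_ (Fredkin.balancedGap_ge hs hn)
    have hn1 : (1 : ℝ) ≤ n := by exact_mod_cast (by omega : 1 ≤ n)
    have h1 : (√(n : ℝ))⁻¹ ≤ 1 := inv_le_one_of_one_le₀ (Real.one_le_sqrt.2 hn1)
    rw [hhalf n (by omega), mul_inv, one_div]
    exact mul_le_mul_of_nonneg_left (mul_le_of_le_one_right (by positivity) h1) (by norm_num)
  -- The bound of order n^{-7} is uniform in s and exceeds n^{-15/2} by the factor √n, which
  -- dominates s as soon as n ≥ s^2.
  · filter_upwards [eventually_ge_atTop (max 2 (s ^ 2))] with n hn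
    have hn2 : 2 ≤ n := le_of_max_le_left hn
    have hns : s ^ 2 ≤ n := le_of_max_le_right hn
    refine le_trans ?_ (Fredkin.balancedGap_ge hs hn2)
    have hn0 : (0 : ℝ) < n := by exact_mod_cast (by omega : 0 < n)
    have h1 : (s : ℝ) * (√(n : ℝ))⁻¹ ≤ 1 := by
      rw [← div_eq_mul_inv, div_le_one (Real.sqrt_pos.2 hn0)]
      exact Real.le_sqrt_of_sq_le (by exact_mod_cast hns)
    rw [hhalf n (by omega), mul_inv]
    calc 1 / 1024 * (s : ℝ) * (((n : ℝ) ^ 7)⁻¹ * (√(n : ℝ))⁻¹)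
        = 1024⁻¹ * ((n : ℝ) ^ 7)⁻¹ * ((s : ℝ) * (√(n : ℝ))⁻¹) := by ring
      _ ≤ 1024⁻¹ * ((n : ℝ) ^ 7)⁻¹ := mul_le_of_le_one_right (by positivity) h1
  · rw [hnine]
    exact Fredkin.unbalancedGroundEnergy_ge hs hn
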